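/- Theorem 1. Consider the following downlink network in the plane. Base stations form a homogeneous Poisson point process $\Phi_B$ of intensity $\lambda_B>0$ and eavesdroppers an independent homogeneous Poisson point process $\Phi_E$ of intensity $\lambda_E>0$; the typical authorized user is at the origin $o$. Given all locations, the links from base stations to receivers are independent. A link of length $r$ is line-of-sight ($L$) with probability $C$ if $r\le D$ and with probability $0$ if $r>D$, and otherwise it is non-line-of-sight ($N$); here $0\le C\le 1$ and $D>0$. For $j\in\{L,N\}$, the link from $x$ to $y$ in state $j$ has path loss $L(x,y)=C_j\|x-y\|^{-\alpha_j}$ with $C_j=10^{-\beta_j/10}$, $\alpha_j>0$, $\beta_j\in\mathbb R$, and its fading power gain ($h_{xo}$ for the user, $g_{xz}$ for an eavesdropper $z$) is gamma distributed with shape $N_j$ (a positive integer) and scale $1$. Assume $C_ND^{-\alpha_N}\le C_LD^{-\alpha_L}$ (this holds in particular if $D\ge 1$, $C_L>C_N$ and $\alpha_L<\alpha_N$). The antenna gain towards an eavesdropper is $G_b(\theta)=M_s$ if $|\theta|\le\theta_b$ and $G_b(\theta)=m_s$ otherwise, where $M_s,m_s>0$, $0\le\theta_b\le 180$ and the angles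 $\theta$ (in degrees) are independent of everything else and of each other, and uniform on $[-180,180]$; the gain towards the user is $M_s$. The user is served by the base station $x^*=\arg\max_{x\in\Phi_B}L(x,o)$. The secure connectivity probability for non-colluding eavesdroppers in the noise-limited case is $$\tau_n=\Pr\left(\frac{M_sL(x^*,o)h_{x^*o}}{\max_{z\in\Phi_E}G_b(\theta)L(x^*,z)g_{x^*z}}\ge 1\right).$$ Then $$\tau_n=\sum_{j\in\{L,N\}}A_j\int_0^{\infty}f_{r_j}(r)\int_0^\infty \exp\left(-\Lambda_E\left(0,\frac{r^{\alpha_j}}{M_swC_j}\right)\right)\frac{w^{N_j-1}e^{-w}}{\Gamma(N_j)}\,dw\,dr ,$$ where the quantities on the right are as follows (a term with $A_j=0$ is read as $0$). The association probabilities are $A_L=1-A_N$ and, with $\mu=(C_L/C_N)^{-1/\alpha_N}D^{\alpha_L/\alpha_N}$, $$A_N=\int_0^\mu\left(e^{-\pi C\lambda_B(C_L/C_N)^{2/\alpha_L}x^{2\alpha_N/\alpha_L}}-e^{-\pi C\lambda_BD^2}\right)2\pi(1-C)\lambda_Bx\,e^{-\pi(1-C)\lambda_Bx^2}dx+e^{-\pi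 C\lambda_BD^2}.$$ The serving distance densities are $$f_{r_L}(r)=\frac{1}{A_L}e^{-(1-C)\lambda_B\pi(C_N/C_L)^{2/\alpha_N}r^{2\alpha_L/\alpha_N}}\,2\pi C\lambda_Br\,e^{-C\lambda_B\pi r^2}\quad(0\le r\le D),\qquad f_{r_L}(r)=0\quad(r>D),$$ $$f_{r_N}(r)=\frac{2\pi\lambda_Bre^{-\pi\lambda_Br^2}}{A_N}\left((1-C)e^{\pi C\lambda_B(r^2-D^2)}\mathbb I(r\le D)+\mathbb I(r\ge D)\right)$$ $$\qquad+\frac{2\pi(1-C)\lambda_Bre^{-(1-C)\lambda_B\pi r^2}}{A_N}\left(e^{-C\lambda_B\pi(C_L/C_N)^{2/\alpha_L}r^{2\alpha_N/\alpha_L}}-e^{-C\lambda_B\pi D^2}\right)\mathbb I(r\le\mu).$$ With $q_L=C$, $q_N=1-C$, $\Pr_{G_b}(M_s)=\theta_b/180$, $\Pr_{G_b}(m_s)=(180-\theta_b)/180$, the lower and upper incomplete gamma functions $\gamma(\cdot,\cdot)$ and $\Gamma(\cdot,\cdot)$, and $$\Omega_{j,\mathrm{in}}(V,t)=\Pr\nolimits_{G_b}(V)\frac{(VC_jt)^{2/\alpha_j}}{\alpha_j}\sum_{m=0}^{N_j-1}\frac{\gamma\left(m+\frac2{\alpha_j},\frac{D^{\alpha_j}}{VC_jt}\right)}{m!},\qquad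 \Omega_{j,\mathrm{out}}(V,t)=\Pr\nolimits_{G_b}(V)\frac{(VC_jt)^{2/\alpha_j}}{\alpha_j}\sum_{m=0}^{N_j-1}\frac{\Gamma\left(m+\frac2{\alpha_j},\frac{D^{\alpha_j}}{VC_jt}\right)}{m!},$$ the function $\Lambda_E$ is $$\Lambda_E(0,t)=2\pi\lambda_E\left(\sum_{j\in\{L,N\}}q_j\left(\Omega_{j,\mathrm{in}}(M_s,t)+\Omega_{j,\mathrm{in}}(m_s,t)\right)+\Omega_{N,\mathrm{out}}(M_s,t)+\Omega_{N,\mathrm{out}}(m_s,t)\right).$$ -/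

import Mathlib

open MeasureTheory ProbabilityTheory
open scoped ENNReal

noncomputable section

namespace MmWave

/-- The plane `ℝ²` with its Euclidean distance and Lebesgue measure. -/
abbrev Plane : Type := EuclideanSpace ℝ (Fin 2)

/-- A link is either line-of-sight (LOS) or non-line-of-sight (NLOS). -/
inductive LinkState : Type
  | los
  | nlos
  deriving DecidableEq

instance : Fintype LinkState := ⟨{.los, .nlos}, fun j => by cases j <;> simp⟩

instance : MeasurableSpace LinkState := ⊤

instance : DiscreteMeasurableSpace LinkState := ⟨fun _ => trivial⟩

/-- The two lobes of the sectored antenna pattern. -/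
inductive Lobe : Type
  | main
  | side

/-- The deterministic parameters of the network. -/
structure Params where
  /-- intensity of the base stations -/
  lamB : ℝ
  /-- intensity of the eavesdroppers -/
  lamE : ℝ
  /-- probability that a link of length at most `D` is LOS -/
  C : ℝ
  /-- radius beyond which every link is NLOS -/
  D : ℝ
  /-- path loss exponents `α_L`, `α_N` -/
  alpha : LinkState → ℝ
  /-- path loss at the reference distance in dB, `β_L`, `β_N` -/
  beta : LinkState → ℝ
  /-- Nakagami fading parameters `N_L`, `N_N` -/
  nak : LinkState → ℕ
  /-- array gains: `gain main = M_s`, `gain side = m_s` -/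
  gain : Lobe → ℝ
  /-- beam width of the main lobe, in degrees -/
  thetaB : ℝ
  lamB_pos : 0 < lamB
  lamE_pos : 0 < lamE
  C_nonneg : 0 ≤ C
  C_le_one : C ≤ 1
  D_pos : 0 < D
  alpha_pos : ∀ j, 0 < alpha j
  nak_pos : ∀ j, 1 ≤ nak j
  gain_pos : ∀ l, 0 < gain l
  thetaB_nonneg : 0 ≤ thetaB
  thetaB_le : thetaB ≤ 180

namespace Params

variable (P : Params)

/-- The path loss intercepts `C_j = 10 ^ (-β_j / 10)`. -/
def pl (j : LinkState) : ℝ := (10 : ℝ) ^ (-(P.beta j) / 10)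

/-- The path loss `C_j d ^ (-α_j)` of a link of length `d` in state `j`. -/
def pathLoss (j : LinkState) (d : ℝ) : ℝ := P.pl j * d ^ (-(P.alpha j))

/-- Blockage model: the probability that a link of length `r` is in state `j`. -/
def stateProb (j : LinkState) (r : ℝ) : ℝ :=
  match j with
  | .los => if r ≤ P.D then P.C else 0
  | .nlos => 1 - if r ≤ P.D then P.C else 0

/-- The array gain in the direction at angle `θ` (in degrees) from the boresight. -/
def arrayGain (θ : ℝ) : ℝ := if |θ| ≤ P.thetaB then P.gain .main else P.gain .side

/-- The joint law of the state and of the power fading coefficient of a link of length `r`: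
the state is `j` with probability `stateProb j r`, and given this the fading coefficient is
gamma distributed with shape `N_j` and scale `1`. -/
def channelLaw (r : ℝ) : Measure (LinkState × ℝ) :=
  ∑ j, ENNReal.ofReal (P.stateProb j r) • (Measure.dirac j).prod (gammaMeasure (P.nak j) 1)

lemma stateProb_nonneg (j : LinkState) (r : ℝ) : 0 ≤ P.stateProb j r := by
  have h0 := P.C_nonneg
  have h1 := P.C_le_one
  cases j <;> simp only [stateProb] <;> split_ifs <;> linarith

instance isProbabilityMeasure_fading (j : LinkState) :
    IsProbabilityMeasure (gammaMeasure (P.nak j) 1) :=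
  isProbabilityMeasure_gammaMeasure (by exact_mod_cast P.nak_pos j) one_pos

lemma sum_state {M : Type*} [AddCommMonoid M] (f : LinkState → M) :
    ∑ j, f j = f .los + f .nlos := by
  have : (Finset.univ : Finset LinkState) = {.los, .nlos} := rfl
  rw [this, Finset.sum_pair (by decide)]

instance isProbabilityMeasure_channelLaw (r : ℝ) : IsProbabilityMeasure (P.channelLaw r) := by
  refine ⟨?_⟩
  rw [channelLaw, sum_state]
  simp only [Measure.add_apply, Measure.smul_apply, measure_univ, smul_eq_mul, mul_one]
  rw [← ENNReal.ofReal_add (P.stateProb_nonneg _ _) (P.stateProb_nonneg _ _)]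
  simp [stateProb]

lemma measurable_stateProb (j : LinkState) : Measurable (P.stateProb j) := by
  have h : Measurable fun r : ℝ => if r ≤ P.D then P.C else 0 :=
    Measurable.ite measurableSet_Iic measurable_const measurable_const
  cases j
  · exact h
  · exact h.const_sub 1

lemma measurable_channelLaw_apply {s : Set (LinkState × ℝ)} :
    Measurable fun r => P.channelLaw r s := by
  simp only [channelLaw, sum_state, Measure.add_apply, Measure.smul_apply, smul_eq_mul]
  have h := P.measurable_stateProb
  exact ((h .los).ennreal_ofReal.mul_const _).add ((h .nlos).ennreal_ofReal.mul_const _)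

end Params

/-- The locations of all base stations and of all eavesdroppers. -/
abbrev Locations : Type := (ℕ → Plane) × (ℕ → Plane)

/-- The links: `(i, none)` is the link from base station `i` to the typical authorized user at the
origin, `(i, some k)` the link from base station `i` to eavesdropper `k`. -/
abbrev Link : Type := ℕ × Option ℕ

/-- The position of a receiver. -/
def receiver (x : Locations) : Option ℕ → Plane
  | none => 0
  | some k => x.2 k

/-- The length of a link. -/
def linkLength (x : Locations) (l : Link) : ℝ := dist (x.1 l.1) (receiver x l.2)

lemma measurable_linkLength (l : Link) : Measurable fun x : Locations => linkLength x l := by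
  obtain ⟨i, _ | k⟩ := l
  · have : Measurable fun x : Locations => x.1 i := by fun_prop
    exact this.dist measurable_const
  · have h1 : Measurable fun x : Locations => x.1 i := by fun_prop
    have h2 : Measurable fun x : Locations => x.2 k := by fun_prop
    exact h1.dist h2

/-- Given all locations, the states and fading coefficients of the different links are
independent, each with the law prescribed by the length of the link. -/
def channelKernel (P : Params) : Kernel Locations (Link → LinkState × ℝ) where
  toFun x := Measure.infinitePi fun l => P.channelLaw (linkLength x l)
  measurable' := by
    refine Measurable.measure_of_isPiSystem_of_isProbabilityMeasure
      generateFrom_measurableCylinders.symm isPiSystem_measurableCylinders ?_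
    intro s hs
    obtain ⟨I, S, hS, rfl⟩ := (mem_measurableCylinders s).1 hs
    have hc : ∀ x : Locations, (Measure.infinitePi fun l => P.channelLaw (linkLength x l))
        (cylinder I S) = Measure.pi (fun l : I => P.channelLaw (linkLength x l)) S :=
      fun x => Measure.infinitePi_cylinder _ hS
    simp only [hc]
    have hm : Measurable fun x : Locations =>
        Measure.pi (fun l : I => P.channelLaw (linkLength x l)) := by
      refine Measurable.measure_of_isPiSystem_of_isProbabilityMeasure
        generateFrom_pi.symm isPiSystem_pi ?_
      rintro _ ⟨t, -, rfl⟩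
      simp only [Measure.pi_pi]
      refine Finset.measurable_prod _ fun l _ => ?_
      exact P.measurable_channelLaw_apply.comp (measurable_linkLength l)
    exact (Measure.measurable_coe hS).comp hm

instance isMarkovKernel_channelKernel (P : Params) : IsMarkovKernel (channelKernel P) :=
  ⟨fun x => inferInstanceAs
    (IsProbabilityMeasure (Measure.infinitePi fun l => P.channelLaw (linkLength x l)))⟩

/-- The number of points of the point pattern `X 0, X 1, X 2, …` in the set `A`. -/
def pointCount {Ω : Type*} (X : ℕ → Ω → Plane) (A : Set Plane) (ω : Ω) : ℕ∞ :=
  {i | X i ω ∈ A}.encard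

/-- The random points `X 0, X 1, X 2, …` form a homogeneous Poisson point process of intensity
`lam` in the plane: the number of points in a set of finite area is Poisson distributed with
parameter `lam` times the area, and the numbers of points in disjoint sets are independent. -/
structure IsHomogeneousPPP {Ω : Type*} [MeasurableSpace Ω] (μ : Measure Ω)
    (X : ℕ → Ω → Plane) (lam : ℝ) : Prop where
  measurable : ∀ i, Measurable (X i)
  count_law : ∀ A : Set Plane, MeasurableSet A → volume A ≠ ∞ →
    HasLaw (pointCount X A)
      ((poissonMeasure (lam * volume.real A).toNNReal).map (Nat.cast : ℕ → ℕ∞)) μ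
  count_indep : ∀ (n : ℕ) (A : Fin n → Set Plane), (∀ k, MeasurableSet (A k)) →
    (∀ k, volume (A k) ≠ ∞) → Pairwise (fun k l => Disjoint (A k) (A l)) →
    iIndepFun (fun k => pointCount X (A k)) μ

/-- The random mmWave network: base stations and eavesdroppers, the states (LOS or NLOS) and fading
coefficients of all links, and the angles from the boresight of base station `i` at which
eavesdropper `k` is seen. -/
structure Network (P : Params) {Ω : Type*} [MeasurableSpace Ω] (μ : Measure Ω) where
  bs : ℕ → Ω → Plane
  eve : ℕ → Ω → Plane
  channel : Link → Ω → LinkState × ℝ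
  angle : ℕ × ℕ → Ω → ℝ
  bs_ppp : IsHomogeneousPPP μ bs P.lamB
  eve_ppp : IsHomogeneousPPP μ eve P.lamE
  bs_indep_eve : IndepFun (fun ω i => bs i ω) (fun ω k => eve k ω) μ
  channel_measurable : ∀ l, Measurable (channel l)
  channel_law : HasCondDistrib (fun ω l => channel l ω)
    (fun ω => ((fun i => bs i ω, fun k => eve k ω) : Locations)) (channelKernel P) μ
  angle_measurable : ∀ m, Measurable (angle m)
  /-- the angles are uniform on `[-180°, 180°]` -/
  angle_law : ∀ m, μ.map (angle m) = ProbabilityTheory.cond volume (Set.Icc (-180) 180)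
  angle_indep : iIndepFun angle μ
  angle_indep_rest : IndepFun (fun ω m => angle m ω)
    (fun ω => (((fun i => bs i ω, fun k => eve k ω), fun l => channel l ω) :
      Locations × (Link → LinkState × ℝ))) μ

namespace Network

variable {P : Params} {Ω : Type*} [MeasurableSpace Ω] {μ : Measure Ω} (N : Network P μ)

/-- The realized locations. -/
def loc (ω : Ω) : Locations := (fun i => N.bs i ω, fun k => N.eve k ω)

/-- The path loss `L(x, y)` of a link. -/
def linkLoss (l : Link) (ω : Ω) : ℝ :=
  P.pathLoss (N.channel l ω).1 (linkLength (N.loc ω) l)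

/-- Base station `i` serves the typical user: among all base stations `x`, it maximizes
`L(x, o)`. -/
def IsServing (i : ℕ) (ω : Ω) : Prop :=
  ∀ k, N.linkLoss (k, none) ω ≤ N.linkLoss (i, none) ω

/-- `M_s L(x, o) h` for base station `x = i`. -/
def userStrength (i : ℕ) (ω : Ω) : ℝ :=
  P.gain .main * N.linkLoss (i, none) ω * (N.channel (i, none) ω).2

/-- `G_b(θ) L(x, z) g` for base station `x = i` and eavesdropper `z = k`. -/
def eveStrength (i k : ℕ) (ω : Ω) : ℝ :=
  P.arrayGain (N.angle (i, k) ω) * N.linkLoss (i, some k) ω * (N.channel (i, some k) ω).2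

/-- A secure connection is possible: for the serving base station, the ratio of the strength at the
user to the largest strength at an eavesdropper is at least `1`. -/
def secureEvent : Set Ω :=
  {ω | ∃ i, N.IsServing i ω ∧
    1 ≤ ENNReal.ofReal (N.userStrength i ω) / ⨆ k, ENNReal.ofReal (N.eveStrength i k ω)}

/-- The secure connectivity probability for non-colluding eavesdroppers. -/
def secureConnectivityProb : ℝ := μ.real N.secureEvent

end Network

/-- The lower incomplete gamma function `γ(s, x)`. -/
def lowerGamma (s x : ℝ) : ℝ := ∫ u in Set.Ioc 0 x, u ^ (s - 1) * Real.exp (-u)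

/-- The upper incomplete gamma function `Γ(s, x)`. -/
def upperGamma (s x : ℝ) : ℝ := ∫ u in Set.Ioi x, u ^ (s - 1) * Real.exp (-u)

namespace Params

variable (P : Params)

/-- `Pr_{G_b}(V)`: `θ_b / 180` for the main lobe, `(180 - θ_b) / 180` for the side lobes. -/
def lobeProb : Lobe → ℝ
  | .main => P.thetaB / 180
  | .side => (180 - P.thetaB) / 180

/-- `Ω_{j,in}(V, t)`. -/
def omegaIn (j : LinkState) (V : Lobe) (t : ℝ) : ℝ :=
  P.lobeProb V * ((P.gain V * P.pl j * t) ^ (2 / P.alpha j) / P.alpha j) *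
    ∑ m ∈ Finset.range (P.nak j),
      lowerGamma (m + 2 / P.alpha j) (P.D ^ P.alpha j / (P.gain V * P.pl j * t)) / m.factorial

/-- `Ω_{j,out}(V, t)`. -/
def omegaOut (j : LinkState) (V : Lobe) (t : ℝ) : ℝ :=
  P.lobeProb V * ((P.gain V * P.pl j * t) ^ (2 / P.alpha j) / P.alpha j) *
    ∑ m ∈ Finset.range (P.nak j),
      upperGamma (m + 2 / P.alpha j) (P.D ^ P.alpha j / (P.gain V * P.pl j * t)) / m.factorial

/-- `q_L = C` and `q_N = 1 - C`. -/
def q : LinkState → ℝ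
  | .los => P.C
  | .nlos => 1 - P.C

/-- `Λ_E(0, t)`. -/
def LambdaE (t : ℝ) : ℝ :=
  2 * Real.pi * P.lamE *
    ((∑ j, P.q j * (P.omegaIn j .main t + P.omegaIn j .side t)) +
      P.omegaOut .nlos .main t + P.omegaOut .nlos .side t)

/-- `μ = (C_L / C_N) ^ (-1 / α_N) D ^ (α_L / α_N)`. -/
def mu : ℝ :=
  (P.pl .los / P.pl .nlos) ^ (-1 / P.alpha .nlos) * P.D ^ (P.alpha .los / P.alpha .nlos)

/-- `A_N`, by its explicit formula. -/
def AN : ℝ :=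
  (∫ x in Set.Ioc 0 P.mu,
    (Real.exp (-(Real.pi * P.C * P.lamB * (P.pl .los / P.pl .nlos) ^ (2 / P.alpha .los) *
        x ^ (2 * P.alpha .nlos / P.alpha .los))) -
      Real.exp (-(Real.pi * P.C * P.lamB * P.D ^ 2))) *
    (2 * Real.pi * (1 - P.C) * P.lamB * x) *
    Real.exp (-(Real.pi * (1 - P.C) * P.lamB * x ^ 2))) +
  Real.exp (-(Real.pi * P.C * P.lamB * P.D ^ 2))

/-- The association probabilities `A_N` and `A_L = 1 - A_N`. -/
def A : LinkState → ℝ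
  | .los => 1 - P.AN
  | .nlos => P.AN

/-- `f_{r_L}`, which vanishes outside `[0, D]`. -/
def fL (r : ℝ) : ℝ :=
  if r ≤ P.D then
    Real.exp (-((1 - P.C) * P.lamB * Real.pi * (P.pl .nlos / P.pl .los) ^ (2 / P.alpha .nlos) *
        r ^ (2 * P.alpha .los / P.alpha .nlos))) *
      (2 * Real.pi * P.C * P.lamB * r) * Real.exp (-(P.C * P.lamB * Real.pi * r ^ 2)) / P.A .los
  else 0

/-- `f_{r_N}`. -/
def fN (r : ℝ) : ℝ :=
  2 * Real.pi * P.lamB * r * Real.exp (-(Real.pi * P.lamB * r ^ 2)) *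
      ((if r ≤ P.D then (1 - P.C) * Real.exp (Real.pi * P.C * P.lamB * (r ^ 2 - P.D ^ 2)) else 0) +
        if P.D ≤ r then 1 else 0) / P.A .nlos +
    2 * Real.pi * (1 - P.C) * P.lamB * r * Real.exp (-((1 - P.C) * P.lamB * Real.pi * r ^ 2)) *
      (Real.exp (-(P.C * P.lamB * Real.pi * (P.pl .los / P.pl .nlos) ^ (2 / P.alpha .los) *
          r ^ (2 * P.alpha .nlos / P.alpha .los))) -
        Real.exp (-(P.C * P.lamB * Real.pi * P.D ^ 2))) / P.A .nlos *
      if r ≤ (P.pl .nlos / P.pl .los) ^ (1 / P.alpha .nlos) *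
          P.D ^ (P.alpha .los / P.alpha .nlos) then 1 else 0

/-- The density `f_{r_j}` on `(0, ∞)` of the distance to the serving base station given that
its link to the user is in state `j`. -/
def f : LinkState → ℝ → ℝ
  | .los => P.fL
  | .nlos => P.fN

end Params

end MmWave

end

noncomputable section

namespace MmWave

open Filter Topology Finset

/-! Condition on all locations. Whether station `i` serves depends only on the states of the links
`(k, none)` to the user, whereas its eavesdroppers involve only the links `(i, some k)` and the
angles `(i, k)`. Given the locations and the link `(i, none)`, these two families are independent.
At user strength `s > 0`, an eavesdropper at distance `d` is harmless with probability `1 -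
exceedProb d s`. The probability generating functional `IsHomogeneousPPP.lintegral_infProd` turns
the product of these factors into the exponential of minus the mean number of harmful eavesdroppers.
By `lintegral_exceedProb` this mean is `LambdaE (1 / s)`: translation invariance removes the
position of the station, and in polar coordinates the gamma tails integrate to incomplete gamma
functions. Averaging over the user's fading leaves `secureProb j d`, a function of the state and
length of the serving link alone (`measure_serving_secure`).

The random choice of the serving station needs no Palm calculus. The secure event is split by state
and index. The pieces are almost surely disjoint because ties have probability zero
(`ae_isServing_unique`). After the sum over indices is moved inside the expectation, it collapses
pathwise to one term (`tsum_serving`). That term depends only on the distances to the nearest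
station in each state: the nearest one in state `j` serves exactly when the nearest one in the other
state is at least at the equivalent length, the length giving equal path loss. The same generating
functional, applied to the stations thinned by state, shows that the two nearest distances are
independent with tails `exp (-meanCount)`. This yields `measure_secureEvent`, an integral over the
serving distance.

It remains to recognize the weight in that integral as `A j * f j` (`A_mul_fL`, `A_mul_fN`). Only
here is the comparison of path losses at `D` used: it decides on which side of `D` the equivalent
lengths lie, hence which branch of the mean counts applies. -/

/-! ### Infinite products of factors in the unit interval -/

/-- The infinite product of a sequence of numbers in `[0, 1]`. -/
def infProd (u : ℕ → ℝ≥0∞) : ℝ≥0∞ := ⨅ n, ∏ k ∈ range n, u k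

lemma antitone_prod_range {u : ℕ → ℝ≥0∞} (hu : ∀ k, u k ≤ 1) :
    Antitone fun n => ∏ k ∈ range n, u k := by
  refine antitone_nat_of_succ_le fun n => ?_
  rw [prod_range_succ]
  exact mul_le_of_le_one_right' (hu n)

lemma tendsto_infProd {u : ℕ → ℝ≥0∞} (hu : ∀ k, u k ≤ 1) :
    Tendsto (fun n => ∏ k ∈ range n, u k) atTop (𝓝 (infProd u)) :=
  tendsto_atTop_iInf (antitone_prod_range hu)

lemma infProd_le_one (u : ℕ → ℝ≥0∞) : infProd u ≤ 1 :=
  (iInf_le _ 0).trans (by simp)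

lemma infProd_one : infProd (fun _ => 1) = 1 := by simp [infProd]

lemma measurable_infProd {α : Type*} [MeasurableSpace α] {u : ℕ → α → ℝ≥0∞}
    (hu : ∀ k, Measurable (u k)) : Measurable fun x => infProd fun k => u k x := by
  unfold infProd
  exact Measurable.iInf fun n => Finset.measurable_prod _ fun k _ => hu k

lemma infProd_mul {u v : ℕ → ℝ≥0∞} (hu : ∀ k, u k ≤ 1) (hv : ∀ k, v k ≤ 1) :
    infProd (fun k => u k * v k) = infProd u * infProd v := by
  refine tendsto_nhds_unique (tendsto_infProd fun k => mul_le_one' (hu k) (hv k)) ?_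
  simp only [prod_mul_distrib]
  exact ENNReal.Tendsto.mul (tendsto_infProd hu)
    (Or.inr ((infProd_le_one v).trans_lt ENNReal.one_lt_top).ne) (tendsto_infProd hv)
    (Or.inr ((infProd_le_one u).trans_lt ENNReal.one_lt_top).ne)

lemma infProd_prod {ι : Type*} (s : Finset ι) {u : ι → ℕ → ℝ≥0∞} (hu : ∀ i k, u i k ≤ 1) :
    infProd (fun k => ∏ i ∈ s, u i k) = ∏ i ∈ s, infProd (u i) := by
  classical
  induction s using Finset.induction_on with
  | empty => simp [infProd_one]
  | insert a s ha ih =>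
    simp only [prod_insert ha]
    rw [infProd_mul (hu a) fun k => Finset.prod_le_one' fun i _ => hu i k, ih]

lemma infProd_ite (p : ℕ → Prop) [DecidablePred p] [Decidable (∀ k, p k)] :
    infProd (fun k => if p k then 1 else 0) = if ∀ k, p k then 1 else 0 := by
  split_ifs with h
  · simp [h, infProd_one]
  · push Not at h
    obtain ⟨k, hk⟩ := h
    refine le_antisymm ((iInf_le _ (k + 1)).trans ?_) bot_le
    rw [prod_range_succ]
    simp [hk]

lemma infProd_ite_mem {S : Set ℕ} [DecidablePred (· ∈ S)] (hS : S.Finite) {d : ℝ≥0∞} (hd : d ≤ 1) :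
    infProd (fun k => if k ∈ S then d else 1) = d ^ S.encard.toNat := by
  have hu : ∀ k, (if k ∈ S then d else 1) ≤ 1 := fun k => by split_ifs <;> simp [hd]
  refine tendsto_nhds_unique (tendsto_infProd hu) ?_
  obtain ⟨N, hN⟩ := hS.bddAbove
  refine tendsto_const_nhds.congr' ?_
  filter_upwards [eventually_ge_atTop (N + 1)] with n hn
  rw [prod_ite, prod_const, prod_const_one, mul_one]
  congr 1
  rw [← Set.ncard_def, ← Set.ncard_coe_finset]
  congr 1
  ext k
  simp only [coe_filter, mem_range, Set.mem_ofPred_eq]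
  exact ⟨fun h => ⟨by have := hN h; omega, h⟩, fun h => h.2⟩

/-- The partial products decrease pointwise, so the expectation passes to their infimum. It is
therefore enough that the finite products factor in the mean. -/
lemma lintegral_infProd {α : Type*} [MeasurableSpace α] {ν : Measure α} [IsProbabilityMeasure ν]
    {u : ℕ → α → ℝ≥0∞} (hu : ∀ k, Measurable (u k)) (h1 : ∀ k x, u k x ≤ 1) {a : ℕ → ℝ≥0∞}
    (ha : ∀ n, ∫⁻ x, ∏ k ∈ range n, u k x ∂ν = ∏ k ∈ range n, a k) :
    ∫⁻ x, infProd (fun k => u k x) ∂ν = infProd a := by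
  unfold infProd
  rw [lintegral_iInf]
  · simp only [ha]
  · exact fun n => Finset.measurable_prod _ fun k _ => hu k
  · exact fun m n hmn x => antitone_prod_range (fun k => h1 k x) hmn
  -- Convergence along a decreasing sequence needs one finite integral; the empty product supplies
  -- it.
  · rw [ha 0]; simp

/-! ### Extended exponential and the Poisson generating function -/

/-- `exp (-x)` for `x ∈ [0, ∞]`. -/
def negExp (x : ℝ≥0∞) : ℝ≥0∞ := EReal.exp (-(x : EReal))

lemma continuous_negExp : Continuous negExp :=
  ENNReal.continuous_exp.comp (continuous_neg.comp continuous_coe_ennreal_ereal)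

lemma negExp_add (x y : ℝ≥0∞) : negExp (x + y) = negExp x * negExp y := by
  unfold negExp
  rw [EReal.coe_ennreal_add, EReal.neg_add (by simp) (by simp), sub_eq_add_neg, EReal.exp_add]

lemma negExp_zero : negExp 0 = 1 := by simp [negExp]

lemma negExp_le_one (x : ℝ≥0∞) : negExp x ≤ 1 := by
  rw [negExp, EReal.exp_le_one_iff, EReal.neg_le_zero]
  exact EReal.coe_ennreal_nonneg x

lemma negExp_ofReal {x : ℝ} (hx : 0 ≤ x) :
    negExp (ENNReal.ofReal x) = ENNReal.ofReal (Real.exp (-x)) := by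
  unfold negExp
  rw [EReal.coe_ennreal_ofReal, max_eq_left hx, ← EReal.coe_neg, EReal.exp_coe]

lemma negExp_sum {ι : Type*} (s : Finset ι) (f : ι → ℝ≥0∞) :
    negExp (∑ i ∈ s, f i) = ∏ i ∈ s, negExp (f i) := by
  classical
  induction s using Finset.induction_on with
  | empty => simp [negExp_zero]
  | insert a s ha ih => rw [sum_insert ha, prod_insert ha, negExp_add, ih]

/-- Weighting by `d ^ n` turns the exponential series at `r` into the one at `r * d`. -/
lemma lintegral_pow_poissonMeasure (r : NNReal) {d : ℝ≥0∞} (hd : d ≤ 1) :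
    ∫⁻ n, d ^ n ∂(poissonMeasure r) = negExp (r * (1 - d)) := by
  lift d to NNReal using (hd.trans_lt ENNReal.one_lt_top).ne
  have hd' : (d : ℝ) ≤ 1 := by exact_mod_cast hd
  have h0 : (0 : ℝ) ≤ r * (1 - d) := mul_nonneg r.coe_nonneg (by linarith)
  have e : (r : ℝ≥0∞) * (1 - d) = ENNReal.ofReal (r * (1 - d)) := by
    rw [ENNReal.ofReal_mul r.coe_nonneg, ENNReal.ofReal_sub _ d.coe_nonneg]
    simp
  rw [e, negExp_ofReal h0, poissonMeasure, lintegral_sum_measure]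
  simp only [lintegral_smul_measure, lintegral_dirac, smul_eq_mul]
  have hs : HasSum (fun n : ℕ => Real.exp (-r) * r ^ n / n.factorial * d ^ n)
      (Real.exp (-(r * (1 - d)))) := by
    have := (NormedSpace.expSeries_div_hasSum_exp ((r : ℝ) * d)).mul_left (Real.exp (-r))
    rw [← Real.exp_eq_exp_ℝ, ← Real.exp_add] at this
    convert! this using 1
    · ext n; rw [mul_pow]; ring
    · congr 1; ring
  rw [← hs.tsum_eq, ENNReal.ofReal_tsum_of_nonneg (fun n => by positivity) hs.summable]
  congr 1; ext n
  rw [ENNReal.ofReal_mul (by positivity), ENNReal.ofReal_pow d.coe_nonneg]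
  simp

/-! ### Poisson point processes: generating functional and absence of ties -/

section PPP

variable {Ω : Type*} [MeasurableSpace Ω] {μ : Measure Ω}
  {X : ℕ → Ω → Plane} {lam : ℝ}

lemma IsHomogeneousPPP.ae_finite (h : IsHomogeneousPPP μ X lam) {A : Set Plane}
    (hA : MeasurableSet A) (hA' : volume A ≠ ∞) : ∀ᵐ ω ∂μ, {i | X i ω ∈ A}.Finite := by
  have hl := h.count_law A hA hA'
  have := (hl.ae_iff (p := fun n => n ≠ ⊤) (by fun_prop)).2 (by
    rw [ae_map_iff (by fun_prop) (MeasurableSet.of_discrete)]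
    simp)
  filter_upwards [this] with ω hω
  exact Set.encard_ne_top_iff.1 hω

lemma IsHomogeneousPPP.lintegral_pow (h : IsHomogeneousPPP μ X lam) {A : Set Plane}
    (hA : MeasurableSet A) (hA' : volume A ≠ ∞) {d : ℝ≥0∞} (hd : d ≤ 1) :
    ∫⁻ ω, d ^ (pointCount X A ω).toNat ∂μ =
      negExp (ENNReal.ofReal lam * volume A * (1 - d)) := by
  have hl := h.count_law A hA hA'
  rw [hl.lintegral_comp (f := fun n => d ^ n.toNat) (by fun_prop),
    lintegral_map (by fun_prop) (by fun_prop)]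
  simp only [ENat.toNat_natCast]
  rw [lintegral_pow_poissonMeasure _ hd]
  congr 2
  have : ((lam * volume.real A).toNNReal : ℝ≥0∞) = ENNReal.ofReal (lam * volume.real A) := rfl
  rw [this, ENNReal.ofReal_mul' measureReal_nonneg, ofReal_measureReal hA']

/-- Each region contributes its factor once per point it contains, so the product over points
regroups into powers of the `d k` with the counts as exponents. The counts in disjoint regions are
independent Poisson variables. -/
lemma IsHomogeneousPPP.lintegral_infProd_disjoint [IsProbabilityMeasure μ]
    (h : IsHomogeneousPPP μ X lam) {n : ℕ} {A : Fin n → Set Plane}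
    (hA : ∀ k, MeasurableSet (A k)) (hA' : ∀ k, volume (A k) ≠ ∞)
    (hd : Pairwise fun k l => Disjoint (A k) (A l)) {d : Fin n → ℝ≥0∞} (hd1 : ∀ k, d k ≤ 1)
    [∀ k, DecidablePred (· ∈ A k)] :
    ∫⁻ ω, infProd (fun i => ∏ k, if X i ω ∈ A k then d k else 1) ∂μ =
      negExp (ENNReal.ofReal lam * ∑ k, volume (A k) * (1 - d k)) := by
  have hae : ∀ᵐ ω ∂μ, infProd (fun i => ∏ k, if X i ω ∈ A k then d k else 1) =
      ∏ k, d k ^ (pointCount X (A k) ω).toNat := by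
    have := ae_all_iff.2 fun k => h.ae_finite (hA k) (hA' k)
    filter_upwards [this] with ω hω
    rw [infProd_prod _ (u := fun k i => if X i ω ∈ A k then d k else 1)
      fun k i => by split_ifs <;> simp [hd1]]
    refine prod_congr rfl fun k _ => ?_
    exact infProd_ite_mem (S := {i | X i ω ∈ A k}) (hω k) (hd1 k)
  rw [lintegral_congr_ae hae]
  have hind := (h.count_indep n A hA hA' hd).comp (fun k m => d k ^ m.toNat) fun k => by fun_prop
  -- The law of a count provides only almost everywhere measurability, so independence is carried
  -- over to measurable modifications before the expectation is factored.
  have hae2 : ∀ k, AEMeasurable (fun ω => d k ^ (pointCount X (A k) ω).toNat) μ := fun k =>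
    (by fun_prop : Measurable fun m : ℕ∞ => d k ^ m.toNat).comp_aemeasurable
      (h.count_law (A k) (hA k) (hA' k)).aemeasurable
  have hind' := hind.congr fun k => (hae2 k).ae_eq_mk
  have hm : ∀ᵐ ω ∂μ, ∏ k, d k ^ (pointCount X (A k) ω).toNat = ∏ k, (hae2 k).mk _ ω := by
    filter_upwards [ae_all_iff.2 fun k => (hae2 k).ae_eq_mk] with ω hω
    exact prod_congr rfl fun k _ => hω k
  rw [lintegral_congr_ae hm, lintegral_prod_eq_prod_lintegral_of_indepFun _ _ hind'
    fun k => (hae2 k).measurable_mk, mul_sum, negExp_sum]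
  refine prod_congr rfl fun k _ => ?_
  rw [← lintegral_congr_ae (hae2 k).ae_eq_mk, h.lintegral_pow (hA k) (hA' k) (hd1 k), mul_assoc]

lemma IsHomogeneousPPP.lintegral_infProd_simpleFunc [IsProbabilityMeasure μ]
    (h : IsHomogeneousPPP μ X lam) (s : SimpleFunc Plane ℝ≥0∞) (hs1 : ∀ y, s y ≤ 1)
    (hs : volume (Function.support s) ≠ ∞) :
    ∫⁻ ω, infProd (fun i => 1 - s (X i ω)) ∂μ =
      negExp (ENNReal.ofReal lam * ∫⁻ y, s y) := by
  classical
  -- The value `0` is dropped: its level set has infinite area, but points in it contribute only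
  -- factors `1`.
  set R := s.range.erase 0
  let c : Fin R.card → ℝ≥0∞ := fun k => R.equivFin.symm k
  have hc : ∀ k, c k ∈ R := fun k => (R.equivFin.symm k).2
  have hinj : Function.Injective c := Subtype.val_injective.comp R.equivFin.symm.injective
  have hsum : ∀ {M : Type} [AddCommMonoid M] (f : ℝ≥0∞ → M), ∑ k, f (c k) = ∑ x ∈ R, f x :=
    fun f => by
      rw [← Finset.sum_coe_sort R]
      exact Equiv.sum_comp R.equivFin.symm fun x => f x
  have hprod : ∀ f : ℝ≥0∞ → ℝ≥0∞, ∏ k, f (c k) = ∏ x ∈ R, f x := fun f => by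
    rw [← Finset.prod_coe_sort R]
    exact Equiv.prod_comp R.equivFin.symm fun x => f x
  have hc1 : ∀ k, c k ≤ 1 := fun k => by
    obtain ⟨y, hy⟩ := SimpleFunc.mem_range.1 (mem_of_mem_erase (hc k))
    rw [← hy]; exact hs1 y
  have key := h.lintegral_infProd_disjoint (A := fun k => s ⁻¹' {c k}) (d := fun k => 1 - c k)
    (fun k => s.measurableSet_fiber _) (fun k => ?_) ?_ fun k => tsub_le_self
  · have e1 : ∀ y, ∏ k, (if y ∈ s ⁻¹' {c k} then 1 - c k else 1) = 1 - s y := fun y => by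
      have := hprod fun x => if s y = x then 1 - x else 1
      simp only [Set.mem_preimage, Set.mem_singleton_iff]
      rw [this, prod_ite_eq]
      split_ifs with hy
      · rfl
      · have : s y = 0 := by
          by_contra h0
          exact hy (mem_erase.2 ⟨h0, s.mem_range_self y⟩)
        simp [this]
    simp only [e1] at key
    rw [key]
    congr 2
    have e2 : ∀ k, volume (s ⁻¹' {c k}) * (1 - (1 - c k)) = c k * volume (s ⁻¹' {c k}) := fun k => by
      rw [ENNReal.sub_sub_cancel ENNReal.one_ne_top (hc1 k), mul_comm]
    simp only [e2]
    rw [hsum fun x => x * volume (s ⁻¹' {x}), SimpleFunc.lintegral_eq_lintegral,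
      SimpleFunc.lintegral]
    refine sum_subset (erase_subset _ _) fun x hx hx' => ?_
    have : x = 0 := by
      by_contra h0
      exact hx' (mem_erase.2 ⟨h0, hx⟩)
    simp [this]
  · refine ne_top_of_le_ne_top hs (measure_mono fun y hy => ?_)
    rw [Function.mem_support, Set.mem_singleton_iff.1 (Set.mem_preimage.1 hy)]
    exact (mem_erase.1 (hc k)).1
  · intro k l hkl
    exact Disjoint.preimage _ (by simpa using fun h' => hkl (hinj h'))

/-- The probability generating functional of a homogeneous Poisson point process. -/
theorem IsHomogeneousPPP.lintegral_infProd [IsProbabilityMeasure μ]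
    (h : IsHomogeneousPPP μ X lam) {p : Plane → ℝ≥0∞} (hp : Measurable p) (hp1 : ∀ y, p y ≤ 1) :
    ∫⁻ ω, infProd (fun i => 1 - p (X i ω)) ∂μ =
      negExp (ENNReal.ofReal lam * ∫⁻ y, p y) := by
  -- Restriction to balls gives supports of finite area; the balls grow with `n`, so the truncations
  -- still increase to `p`.
  let s : ℕ → SimpleFunc Plane ℝ≥0∞ := fun n =>
    (SimpleFunc.eapprox p n).restrict (Metric.ball 0 n)
  have hsn : ∀ n y, s n y = (Metric.ball 0 (n : ℝ)).indicator (SimpleFunc.eapprox p n) y :=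
    fun n y => by rw [SimpleFunc.restrict_apply _ measurableSet_ball]
  have hmono : ∀ y, Monotone fun n => s n y := fun y m n hmn => by
    simp only [hsn]
    refine (Set.indicator_le_indicator (SimpleFunc.monotone_eapprox p hmn y)).trans ?_
    exact Set.indicator_le_indicator_of_subset (Metric.ball_subset_ball (by exact_mod_cast hmn))
      (fun _ => bot_le) y
  have hlim : ∀ y, Tendsto (fun n => s n y) atTop (𝓝 (p y)) := fun y => by
    have h1 : Tendsto (fun n => SimpleFunc.eapprox p n y) atTop (𝓝 (p y)) := by
      rw [← SimpleFunc.iSup_eapprox_apply hp y]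
      exact tendsto_atTop_iSup fun m n hmn => SimpleFunc.monotone_eapprox p hmn y
    refine h1.congr' ?_
    obtain ⟨N, hN⟩ := exists_nat_gt ‖y‖
    filter_upwards [eventually_ge_atTop N] with n hn
    rw [hsn, Set.indicator_of_mem]
    rw [mem_ball_zero_iff]
    exact hN.trans_le (by exact_mod_cast hn)
  have hle : ∀ n y, s n y ≤ p y := fun n y => (hmono y).ge_of_tendsto (hlim y) n
  have hs1 : ∀ n y, s n y ≤ 1 := fun n y => (hle n y).trans (hp1 y)
  have key : ∀ n, ∫⁻ ω, infProd (fun i => 1 - s n (X i ω)) ∂μ =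
      negExp (ENNReal.ofReal lam * ∫⁻ y, s n y) := fun n => by
    refine h.lintegral_infProd_simpleFunc (s n) (hs1 n) ?_
    refine ne_top_of_le_ne_top (measure_ball_lt_top (x := (0 : Plane)) (r := n)).ne
      (measure_mono fun y hy => ?_)
    by_contra hy'
    exact hy (by rw [hsn, Set.indicator_of_notMem hy'])
  have hmeas : ∀ n, Measurable fun ω => infProd fun i => 1 - s n (X i ω) := fun n =>
    measurable_infProd fun k => ((s n).measurable.comp (h.measurable k)).const_sub 1
  -- The infimum over approximations and the infimum over partial products commute, and for a
  -- partial product of fixed length the limit can be taken factor by factor.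
  have hiInf : ∀ ω, infProd (fun i => 1 - p (X i ω)) = ⨅ n, infProd fun i => 1 - s n (X i ω) := by
    intro ω
    unfold infProd
    rw [iInf_comm]
    refine iInf_congr fun m => ?_
    refine tendsto_nhds_unique (f := fun n => ∏ k ∈ range m, (1 - s n (X k ω))) (l := atTop) ?_ ?_
    · refine ENNReal.tendsto_finsetProd_of_ne_top _ (fun k _ => ?_) fun k _ => ?_
      · exact ENNReal.Tendsto.sub tendsto_const_nhds (hlim _) (Or.inl ENNReal.one_ne_top)
      · exact (tsub_le_self.trans_lt ENNReal.one_lt_top).ne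
    · exact tendsto_atTop_iInf fun a b hab => prod_le_prod' fun k _ => tsub_le_tsub_left
        (hmono _ hab) 1
  simp only [hiInf]
  rw [lintegral_iInf hmeas]
  · simp only [key]
    refine tendsto_nhds_unique (f := fun n => negExp (ENNReal.ofReal lam * ∫⁻ y, s n y)) (l := atTop)
      ?_ ?_
    · refine tendsto_atTop_iInf ?_
      intro a b hab
      simp only [← key]
      exact lintegral_mono fun ω => iInf_mono fun m => prod_le_prod' fun k _ => tsub_le_tsub_left
        (hmono _ hab) 1
    · refine (continuous_negExp.tendsto _).comp
        (ENNReal.Tendsto.const_mul ?_ (Or.inr ENNReal.ofReal_ne_top))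
      exact lintegral_tendsto_of_tendsto_of_monotone (fun n => (s n).measurable.aemeasurable)
        (Eventually.of_forall hmono) (Eventually.of_forall hlim)
  · intro a b hab ω
    exact iInf_mono fun m => prod_le_prod' fun k _ => tsub_le_tsub_left (hmono _ hab) 1
  · rw [key]
    exact ((negExp_le_one _).trans_lt ENNReal.one_lt_top).ne

lemma volume_ball_zero {r : ℝ} (hr : 0 ≤ r) :
    volume (Metric.ball (0 : Plane) r) = ENNReal.ofReal (Real.pi * r ^ 2) := by
  rw [EuclideanSpace.volume_ball_fin_two, ENNReal.ofReal_mul Real.pi_pos.le, mul_comm,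
    ENNReal.ofReal_pow hr]

lemma IsHomogeneousPPP.ae_notMem (h : IsHomogeneousPPP μ X lam) {A : Set Plane}
    (hA : MeasurableSet A) (hA' : volume A = 0) : ∀ᵐ ω ∂μ, ∀ i, X i ω ∉ A := by
  have hl := h.count_law A hA (by simp [hA'])
  have := (hl.ae_iff (p := fun n => n = 0) (by fun_prop)).2 (by
    rw [ae_map_iff (by fun_prop) (MeasurableSet.of_discrete), measureReal_def, hA', ae_iff]
    rw [poissonMeasure, Measure.sum_apply _ MeasurableSet.of_discrete]
    simp only [ENNReal.tsum_eq_zero]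
    intro n
    rcases n with _ | n <;> simp)
  filter_upwards [this] with ω hω i hi
  have : {i | X i ω ∈ A} = ∅ := Set.encard_eq_zero.1 hω
  exact (Set.eq_empty_iff_forall_notMem.1 this) i hi

/-- From `exp (-r) ≥ 1 - r` one gets `1 - (1 + r) exp (-r) ≤ 1 - (1 + r) (1 - r) = r ^ 2`. -/
lemma poissonMeasure_two_le (r : NNReal) : poissonMeasure r {n | 2 ≤ n} ≤ (r : ℝ≥0∞) ^ 2 := by
  have hc : {n : ℕ | 2 ≤ n} = ({0, 1} : Set ℕ)ᶜ := by
    ext n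
    simp only [Set.mem_ofPred_eq, Set.mem_compl_iff, Set.mem_insert_iff, Set.mem_singleton_iff]
    omega
  rw [hc, prob_compl_eq_one_sub MeasurableSet.of_discrete, Set.insert_eq,
    measure_union (by simp) MeasurableSet.of_discrete, poissonMeasure_singleton,
    poissonMeasure_singleton, ← ENNReal.ofReal_add (by positivity) (by positivity),
    ← ENNReal.ofReal_one, ← ENNReal.ofReal_sub _ (by positivity)]
  have : (r : ℝ≥0∞) ^ 2 = ENNReal.ofReal ((r : ℝ) ^ 2) := by
    rw [ENNReal.ofReal_pow r.coe_nonneg]; simp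
  rw [this]
  refine ENNReal.ofReal_le_ofReal ?_
  have h1 := Real.add_one_le_exp (-(r : ℝ))
  have h0 := r.coe_nonneg
  simp
  nlinarith

lemma IsHomogeneousPPP.measure_two_le (h : IsHomogeneousPPP μ X lam) {A : Set Plane}
    (hA : MeasurableSet A) (hA' : volume A ≠ ∞) :
    μ {ω | ∃ i k, i ≠ k ∧ X i ω ∈ A ∧ X k ω ∈ A} ≤ (ENNReal.ofReal lam * volume A) ^ 2 := by
  have hl := h.count_law A hA hA'
  calc μ {ω | ∃ i k, i ≠ k ∧ X i ω ∈ A ∧ X k ω ∈ A} ≤ μ {ω | 2 ≤ pointCount X A ω} := by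
        refine measure_mono ?_
        rintro ω ⟨i, k, hik, hi, hk⟩
        rw [Set.mem_ofPred_eq, pointCount, ← Set.encard_pair hik]
        exact Set.encard_le_encard (by rintro x (rfl | rfl) <;> assumption)
    _ = poissonMeasure (lam * volume.real A).toNNReal {n | 2 ≤ n} := by
        rw [hl.measure_eq (p := fun n => 2 ≤ n) MeasurableSet.of_discrete,
          Measure.map_apply (by fun_prop) MeasurableSet.of_discrete]
        congr 1
        ext n
        simp only [Set.mem_preimage, Set.mem_ofPred_eq]
        exact_mod_cast Iff.rfl
    _ ≤ _ := by
        refine (poissonMeasure_two_le _).trans_eq ?_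
        congr 1
        have : ((lam * volume.real A).toNNReal : ℝ≥0∞) = ENNReal.ofReal (lam * volume.real A) := rfl
        rw [this, ENNReal.ofReal_mul' measureReal_nonneg, ofReal_measureReal hA']

/-- Cut a disc into `n + 1` annuli of equal width. Two points of equal norm lie in the same annulus.
An annulus has area of order `1 / n`, hence holds two points with probability of order `1 / n ^ 2`,
and the union bound tends to zero. -/
lemma IsHomogeneousPPP.ae_norm_injective (h : IsHomogeneousPPP μ X lam) :
    ∀ᵐ ω ∂μ, ∀ i k, ‖X i ω‖ = ‖X k ω‖ → i = k := by
  suffices H : ∀ R : ℕ, μ {ω | ∃ i k, i ≠ k ∧ ‖X i ω‖ = ‖X k ω‖ ∧ ‖X i ω‖ < R + 1} = 0 by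
    have H' : ∀ᵐ ω ∂μ, ∀ R : ℕ, ¬ ∃ i k, i ≠ k ∧ ‖X i ω‖ = ‖X k ω‖ ∧ ‖X i ω‖ < R + 1 :=
      ae_all_iff.2 fun R => by rw [ae_iff]; simpa only [not_not] using H R
    filter_upwards [H'] with ω hω i k hik
    by_contra hne
    obtain ⟨R, hR⟩ := exists_nat_gt ‖X i ω‖
    exact hω R ⟨i, k, hne, hik, hR.trans (by linarith)⟩
  intro R
  set c : ℝ := R + 1
  have hc : 0 < c := by positivity
  -- The sign of `lam` is not known here; `max lam 0` keeps the real bound nonnegative.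
  have bound : ∀ n : ℕ, μ {ω | ∃ i k, i ≠ k ∧ ‖X i ω‖ = ‖X k ω‖ ∧ ‖X i ω‖ < c} ≤
      ENNReal.ofReal ((max lam 0 * (Real.pi * (2 * c ^ 2))) ^ 2 * (1 / ((n : ℝ) + 1))) := by
    intro n
    set δ : ℝ := c / (n + 1)
    have hδ : 0 < δ := by positivity
    have hδn : δ * (n + 1) = c := by simp only [δ]; field_simp
    let A : ℕ → Set Plane := fun m => Metric.ball 0 ((m + 1) * δ) \ Metric.ball 0 (m * δ)
    have hA : ∀ m, MeasurableSet (A m) := fun m => measurableSet_ball.diff measurableSet_ball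
    have hv : ∀ m ∈ range (n + 1), volume (A m) ≤ ENNReal.ofReal (Real.pi * (2 * c ^ 2) / (n + 1)) := by
      intro m hm
      have hmn : (m : ℝ) ≤ n := by exact_mod_cast Nat.lt_succ_iff.1 (mem_range.1 hm)
      rw [measure_sdiff (Metric.ball_subset_ball (by nlinarith)) measurableSet_ball.nullMeasurableSet
        measure_ball_lt_top.ne, volume_ball_zero (by positivity), volume_ball_zero (by positivity),
        ← ENNReal.ofReal_sub _ (by positivity)]
      refine ENNReal.ofReal_le_ofReal ?_
      have e : Real.pi * (2 * c ^ 2) / (n + 1) = Real.pi * (2 * δ ^ 2 * (n + 1)) := by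
        rw [← hδn]; field_simp
      rw [e, ← mul_sub]
      refine mul_le_mul_of_nonneg_left ?_ Real.pi_pos.le
      nlinarith [sq_nonneg δ, mul_le_mul_of_nonneg_left hmn (sq_nonneg δ)]
    calc μ {ω | ∃ i k, i ≠ k ∧ ‖X i ω‖ = ‖X k ω‖ ∧ ‖X i ω‖ < c}
        ≤ μ (⋃ m ∈ range (n + 1), {ω | ∃ i k, i ≠ k ∧ X i ω ∈ A m ∧ X k ω ∈ A m}) := by
          refine measure_mono ?_
          rintro ω ⟨i, k, hik, he, hlt⟩
          have hf0 : 0 ≤ ‖X i ω‖ / δ := by positivity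
          have h1 : (⌊‖X i ω‖ / δ⌋₊ : ℝ) * δ ≤ ‖X i ω‖ :=
            (le_div_iff₀ hδ).1 (Nat.floor_le hf0)
          have h2 : ‖X i ω‖ < (⌊‖X i ω‖ / δ⌋₊ + 1) * δ :=
            (div_lt_iff₀ hδ).1 (Nat.lt_floor_add_one _)
          simp only [Set.mem_iUnion]
          refine ⟨⌊‖X i ω‖ / δ⌋₊, ?_, i, k, hik, ?_, ?_⟩
          · rw [mem_range, Nat.floor_lt hf0, div_lt_iff₀ hδ]
            push_cast
            linarith
          · simp only [A, Set.mem_sdiff, mem_ball_zero_iff, not_lt]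
            exact ⟨h2, h1⟩
          · simp only [A, Set.mem_sdiff, mem_ball_zero_iff, not_lt]
            rw [← he]
            exact ⟨h2, h1⟩
      _ ≤ ∑ m ∈ range (n + 1), μ {ω | ∃ i k, i ≠ k ∧ X i ω ∈ A m ∧ X k ω ∈ A m} :=
          measure_biUnion_finset_le _ _
      _ ≤ ∑ m ∈ range (n + 1), ENNReal.ofReal ((max lam 0 * (Real.pi * (2 * c ^ 2) / (n + 1))) ^ 2) := by
          refine sum_le_sum fun m hm => ?_
          refine (h.measure_two_le (hA m) ?_).trans ?_
          · exact ne_top_of_le_ne_top (measure_ball_lt_top (x := (0 : Plane))).ne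
              (measure_mono Set.sdiff_subset)
          · rw [ENNReal.ofReal_pow (by positivity), ENNReal.ofReal_mul (by positivity)]
            refine pow_le_pow_left' (mul_le_mul' (ENNReal.ofReal_le_ofReal (le_max_left _ _))
              (hv m hm)) 2
      _ = _ := by
          rw [sum_const, card_range, nsmul_eq_mul, ← ENNReal.ofReal_natCast,
            ← ENNReal.ofReal_mul (by positivity)]
          congr 1
          push_cast
          field_simp
  refine le_antisymm (ge_of_tendsto' (f := fun n : ℕ => ENNReal.ofReal
    ((max lam 0 * (Real.pi * (2 * c ^ 2))) ^ 2 * (1 / ((n : ℝ) + 1)))) (x := atTop) ?_ bound) bot_le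
  have := (tendsto_one_div_add_atTop_nhds_zero_nat (𝕜 := ℝ)).const_mul
    ((max lam 0 * (Real.pi * (2 * c ^ 2))) ^ 2)
  simpa using ENNReal.tendsto_ofReal this

end PPP

/-! ### Integration against infinite product measures -/

section InfinitePi

variable {ι E : Type*} [MeasurableSpace E] {ν : ι → Measure E} [∀ i, IsProbabilityMeasure (ν i)]

/-- Resampling one coordinate from its own law does not change a product measure. This allows a
single coordinate to be integrated separately from all others. -/
lemma map_update_infinitePi [DecidableEq ι] (i : ι) :
    ((ν i).prod (Measure.infinitePi ν)).map (fun p => Function.update p.2 i p.1) =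
      Measure.infinitePi ν := by
  have hm : Measurable fun p : E × (ι → E) => Function.update p.2 i p.1 := by
    refine measurable_pi_lambda _ fun k => ?_
    by_cases hk : k = i
    · subst hk; simpa using measurable_fst
    · simp only [Function.update_of_ne hk]; fun_prop
  refine Measure.eq_infinitePi _ fun s t ht => ?_
  rw [Measure.map_apply hm (.pi s.countable_toSet fun k _ => ht k)]
  have : (fun p : E × (ι → E) => Function.update p.2 i p.1) ⁻¹' Set.pi s t =
      (if i ∈ s then t i else Set.univ) ×ˢ Set.pi (s.erase i : Finset ι) t := by
    ext ⟨a, c⟩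
    simp only [Set.mem_preimage, Set.mem_pi, Set.mem_prod, coe_erase, Set.mem_sdiff, mem_coe,
      Set.mem_singleton_iff]
    constructor
    · intro h
      refine ⟨?_, fun k hk => by simpa [Function.update_of_ne hk.2] using h k hk.1⟩
      split_ifs with his
      · simpa using h i his
      · trivial
    · rintro ⟨h1, h2⟩ k hk
      by_cases hki : k = i
      · subst hki; simpa [hk] using h1
      · simpa [Function.update_of_ne hki] using h2 k ⟨hk, hki⟩
  rw [this, Measure.prod_prod, Measure.infinitePi_pi _ fun k _ => ht k]
  by_cases his : i ∈ s
  · rw [if_pos his, mul_prod_erase s (fun k => ν k (t k)) his]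
  · rw [if_neg his, erase_eq_of_notMem his, measure_univ, one_mul]

lemma lintegral_infinitePi_update [DecidableEq ι] (i : ι) {f : (ι → E) → ℝ≥0∞} (hf : Measurable f) :
    ∫⁻ c, f c ∂(Measure.infinitePi ν) =
      ∫⁻ a, ∫⁻ c, f (Function.update c i a) ∂(Measure.infinitePi ν) ∂(ν i) := by
  have hm : Measurable fun p : E × (ι → E) => Function.update p.2 i p.1 := by
    refine measurable_pi_lambda _ fun k => ?_
    by_cases hk : k = i
    · subst hk; simpa using measurable_fst
    · simp only [Function.update_of_ne hk]; fun_prop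
  conv_lhs => rw [← map_update_infinitePi i]
  rw [lintegral_map hf hm]
  exact lintegral_prod _ (hf.comp hm).aemeasurable

lemma lintegral_infinitePi_prod {κ : Type*} {e : κ → ι} (he : e.Injective) (F : Finset κ)
    {φ : κ → E → ℝ≥0∞} (hφ : ∀ l, Measurable (φ l)) :
    ∫⁻ c, ∏ l ∈ F, φ l (c (e l)) ∂(Measure.infinitePi ν) = ∏ l ∈ F, ∫⁻ a, φ l a ∂(ν (e l)) := by
  have h0 : iIndepFun (fun i (c : ι → E) => c i) (Measure.infinitePi ν) :=
    iIndepFun_infinitePi (X := fun _ a => a) fun _ => measurable_id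
  have h1 : iIndepFun (fun l (c : ι → E) => φ l (c (e l))) (Measure.infinitePi ν) :=
    (h0.precomp he).comp φ hφ
  rw [lintegral_prod_eq_prod_lintegral_of_indepFun F _ h1 fun l =>
    (hφ l).comp (measurable_pi_apply _)]
  refine prod_congr rfl fun l _ => ?_
  conv_rhs => rw [← Measure.infinitePi_map_eval ν (e l)]
  rw [lintegral_map (hφ l) (measurable_pi_apply _)]

lemma lintegral_infinitePi_infProd {e : ℕ → ι} (he : e.Injective) {φ : ℕ → E → ℝ≥0∞}
    (hφ : ∀ k, Measurable (φ k)) (hφ1 : ∀ k a, φ k a ≤ 1) :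
    ∫⁻ c, infProd (fun k => φ k (c (e k))) ∂(Measure.infinitePi ν) =
      infProd fun k => ∫⁻ a, φ k a ∂(ν (e k)) :=
  lintegral_infProd (fun k => (hφ k).comp (measurable_pi_apply _)) (fun _ _ => hφ1 _ _)
    fun _ => lintegral_infinitePi_prod he _ hφ

/-- The two families use disjoint coordinates, so together they form one injective family indexed by
a sum type, and independence of the coordinates factors everything at once. -/
lemma lintegral_infinitePi_infProd_mul {e e' : ℕ → ι} (he : e.Injective) (he' : e'.Injective)
    (hee : ∀ k l, e k ≠ e' l) {φ φ' : ℕ → E → ℝ≥0∞}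
    (hφ : ∀ k, Measurable (φ k)) (hφ1 : ∀ k a, φ k a ≤ 1)
    (hφ' : ∀ k, Measurable (φ' k)) (hφ1' : ∀ k a, φ' k a ≤ 1) :
    ∫⁻ c, infProd (fun k => φ k (c (e k))) * infProd (fun k => φ' k (c (e' k)))
        ∂(Measure.infinitePi ν) =
      (infProd fun k => ∫⁻ a, φ k a ∂(ν (e k))) * infProd fun k => ∫⁻ a, φ' k a ∂(ν (e' k)) := by
  have hle : ∀ {i : ι} {f : E → ℝ≥0∞}, (∀ a, f a ≤ 1) → ∫⁻ a, f a ∂(ν i) ≤ 1 := fun hf =>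
    (lintegral_mono hf).trans (by simp)
  rw [← infProd_mul (fun k => hle (hφ1 k)) fun k => hle (hφ1' k)]
  simp only [← infProd_mul (fun k => hφ1 k _) fun k => hφ1' k _]
  refine lintegral_infProd (fun k => ((hφ k).comp (measurable_pi_apply _)).mul
    ((hφ' k).comp (measurable_pi_apply _))) (fun _ _ => mul_le_one' (hφ1 _ _) (hφ1' _ _)) fun n => ?_
  have hinj : (Sum.elim e e').Injective := he.sumElim he' hee
  have := lintegral_infinitePi_prod (ν := ν) hinj ((range n).disjSum (range n)) (φ := Sum.elim φ φ')
    (by rintro (k | k) <;> simp [hφ, hφ'])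
  simpa [prod_disjSum, prod_mul_distrib] using this

end InfinitePi

/-! ### Exceedance at a single eavesdropper -/

/-- The law of an angle. -/
def angleLaw : Measure ℝ := ProbabilityTheory.cond volume (Set.Icc (-180) 180)

instance : IsProbabilityMeasure angleLaw :=
  cond_isProbabilityMeasure_of_finite (by simp) (by simp)

namespace Params

variable (P : Params)

lemma lintegral_channelLaw (r : ℝ) {f : LinkState × ℝ → ℝ≥0∞} (hf : Measurable f) :
    ∫⁻ a, f a ∂(P.channelLaw r) =
      ∑ j, ENNReal.ofReal (P.stateProb j r) * ∫⁻ w, f (j, w) ∂(gammaMeasure (P.nak j) 1) := by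
  rw [channelLaw, sum_state, sum_state, lintegral_add_measure, lintegral_smul_measure,
    lintegral_smul_measure, lintegral_prod _ hf.aemeasurable, lintegral_prod _ hf.aemeasurable,
    lintegral_dirac, lintegral_dirac]
  rfl

lemma measurable_pathLoss (j : LinkState) : Measurable (P.pathLoss j) := by
  unfold pathLoss; fun_prop

lemma measurable_pathLoss_uncurry : Measurable fun p : LinkState × ℝ => P.pathLoss p.1 p.2 :=
  measurable_from_prod_countable_right fun j => P.measurable_pathLoss j

lemma measurable_arrayGain : Measurable P.arrayGain := by
  unfold arrayGain
  exact Measurable.ite (measurableSet_le (by fun_prop) measurable_const) measurable_const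
    measurable_const

/-- The probability that the strength at an eavesdropper at distance `d` exceeds `s`. -/
def exceedProb (d s : ℝ) : ℝ≥0∞ :=
  ∫⁻ a, angleLaw {θ | s < P.arrayGain θ * P.pathLoss a.1 d * a.2} ∂(P.channelLaw d)

lemma measurable_angleLaw_exceed :
    Measurable fun p : (ℝ × ℝ) × (LinkState × ℝ) =>
      angleLaw {θ | p.1.2 < P.arrayGain θ * P.pathLoss p.2.1 p.1.1 * p.2.2} := by
  have h1 : Measurable fun q : ((ℝ × ℝ) × (LinkState × ℝ)) × ℝ => P.arrayGain q.2 :=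
    P.measurable_arrayGain.comp measurable_snd
  have h2 : Measurable fun q : ((ℝ × ℝ) × (LinkState × ℝ)) × ℝ =>
      P.pathLoss q.1.2.1 q.1.1.1 :=
    P.measurable_pathLoss_uncurry.comp (f := fun q : ((ℝ × ℝ) × (LinkState × ℝ)) × ℝ =>
      (q.1.2.1, q.1.1.1)) (by fun_prop)
  have hs : MeasurableSet {q : ((ℝ × ℝ) × (LinkState × ℝ)) × ℝ |
      q.1.1.2 < P.arrayGain q.2 * P.pathLoss q.1.2.1 q.1.1.1 * q.1.2.2} :=
    measurableSet_lt (by fun_prop) (by fun_prop)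
  exact measurable_measure_prodMk_left hs

lemma measurable_exceedProb : Measurable fun p : ℝ × ℝ => P.exceedProb p.1 p.2 := by
  unfold exceedProb
  have hm := P.measurable_angleLaw_exceed
  have : ∀ p : ℝ × ℝ, ∫⁻ a, angleLaw {θ | p.2 < P.arrayGain θ * P.pathLoss a.1 p.1 * a.2}
      ∂(P.channelLaw p.1) = ∑ j, ENNReal.ofReal (P.stateProb j p.1) *
        ∫⁻ w, angleLaw {θ | p.2 < P.arrayGain θ * P.pathLoss j p.1 * w} ∂(gammaMeasure (P.nak j) 1) :=
    fun p => P.lintegral_channelLaw p.1 (f := fun a => angleLaw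
      {θ | p.2 < P.arrayGain θ * P.pathLoss a.1 p.1 * a.2}) (hm.comp (by fun_prop :
        Measurable fun a : LinkState × ℝ => (p, a)))
  simp only [this]
  refine Finset.measurable_sum _ fun j _ => ?_
  refine (((P.measurable_stateProb j).comp measurable_fst).ennreal_ofReal).mul ?_
  refine Measurable.lintegral_prod_right' (f := fun q : (ℝ × ℝ) × ℝ =>
    angleLaw {θ | q.1.2 < P.arrayGain θ * P.pathLoss j q.1.1 * q.2}) ?_
  exact hm.comp (by fun_prop : Measurable fun q : (ℝ × ℝ) × ℝ => (q.1, (j, q.2)))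

lemma exceedProb_le_one (d s : ℝ) : P.exceedProb d s ≤ 1 :=
  (lintegral_mono fun _ => prob_le_one).trans (by simp)

lemma lintegral_angleLaw_le (d s : ℝ) :
    ∫⁻ a, angleLaw {θ | P.arrayGain θ * P.pathLoss a.1 d * a.2 ≤ s} ∂(P.channelLaw d) =
      1 - P.exceedProb d s := by
  have hm : Measurable fun a : LinkState × ℝ =>
      angleLaw {θ | s < P.arrayGain θ * P.pathLoss a.1 d * a.2} :=
    P.measurable_angleLaw_exceed.comp (by fun_prop :
        Measurable fun a : LinkState × ℝ => ((d, s), a))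
  have h : ∀ a : LinkState × ℝ, angleLaw {θ | P.arrayGain θ * P.pathLoss a.1 d * a.2 ≤ s} =
      1 - angleLaw {θ | s < P.arrayGain θ * P.pathLoss a.1 d * a.2} := fun a => by
    rw [← prob_compl_eq_one_sub]
    · congr 1; ext θ; simp
    · exact measurableSet_lt measurable_const
        ((P.measurable_arrayGain.mul_const _).mul_const _)
  simp only [h]
  rw [lintegral_sub hm]
  · simp [exceedProb]
  · exact ((P.exceedProb_le_one d s).trans_lt ENNReal.one_lt_top).ne
  · exact Eventually.of_forall fun _ => prob_le_one

end Params

/-! ### Joint law of the network -/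

namespace Network

variable {P : Params} {Ω : Type*} [MeasurableSpace Ω] {μ : Measure Ω}

/-- The independence assumptions and the conditional law of the channels combine into one iterated
integral: stations, eavesdroppers, then the channels given both, then the angles. -/
lemma lintegral_comp [IsProbabilityMeasure μ] (N : Network P μ)
    {F : Locations → (Link → LinkState × ℝ) → (ℕ × ℕ → ℝ) → ℝ≥0∞}
    (hF : Measurable fun p : (Locations × (Link → LinkState × ℝ)) × (ℕ × ℕ → ℝ) =>
      F p.1.1 p.1.2 p.2) :
    ∫⁻ ω, F (N.loc ω) (fun l => N.channel l ω) (fun m => N.angle m ω) ∂μ =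
      ∫⁻ x, ∫⁻ z, ∫⁻ c, ∫⁻ θ, F (x, z) c θ ∂(Measure.infinitePi fun _ => angleLaw)
        ∂(channelKernel P (x, z)) ∂(μ.map fun ω k => N.eve k ω) ∂(μ.map fun ω i => N.bs i ω) := by
  have hloc : Measurable N.loc := by
    have h1 := N.bs_ppp.measurable
    have h2 := N.eve_ppp.measurable
    unfold loc; fun_prop
  have hch : Measurable fun ω l => N.channel l ω := measurable_pi_lambda _ N.channel_measurable
  have hang : Measurable fun ω m => N.angle m ω := measurable_pi_lambda _ N.angle_measurable
  have hA : μ.map (fun ω m => N.angle m ω) = Measure.infinitePi fun _ => angleLaw := by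
    rw [N.angle_indep.map_fun_eq_infinitePi_map N.angle_measurable]
    simp only [N.angle_law]; rfl
  have hJ : μ.map (fun ω => ((N.loc ω, fun l => N.channel l ω), fun m => N.angle m ω)) =
      ((μ.map N.loc) ⊗ₘ channelKernel P).prod (Measure.infinitePi fun _ => angleLaw) := by
    have hc : μ.map N.loc ⊗ₘ channelKernel P =
        μ.map fun ω => (N.loc ω, fun l => N.channel l ω) := N.channel_law.map_eq.symm
    rw [← hA, hc]
    exact N.angle_indep_rest.symm.map_prod_eq_prod_map_map (hloc.prodMk hch).aemeasurable
      hang.aemeasurable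
  have hL : μ.map N.loc = (μ.map fun ω i => N.bs i ω).prod (μ.map fun ω k => N.eve k ω) :=
    N.bs_indep_eve.map_prod_eq_prod_map_map
      (measurable_pi_lambda _ N.bs_ppp.measurable).aemeasurable
      (measurable_pi_lambda _ N.eve_ppp.measurable).aemeasurable
  have hpb : IsProbabilityMeasure (μ.map fun ω i => N.bs i ω) :=
    Measure.isProbabilityMeasure_map (measurable_pi_lambda _ N.bs_ppp.measurable).aemeasurable
  have hpe : IsProbabilityMeasure (μ.map fun ω k => N.eve k ω) :=
    Measure.isProbabilityMeasure_map (measurable_pi_lambda _ N.eve_ppp.measurable).aemeasurable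
  have h1 : ∫⁻ ω, F (N.loc ω) (fun l => N.channel l ω) (fun m => N.angle m ω) ∂μ =
      ∫⁻ p, F p.1.1 p.1.2 p.2 ∂(μ.map (fun ω =>
        ((N.loc ω, fun l => N.channel l ω), fun m => N.angle m ω))) := by
    rw [lintegral_map hF ((hloc.prodMk hch).prodMk hang)]
  rw [h1, hJ, lintegral_prod _ hF.aemeasurable,
    Measure.lintegral_compProd (f := fun p => ∫⁻ θ, F p.1 p.2 θ ∂(Measure.infinitePi fun _ => angleLaw))
      hF.lintegral_prod_right', hL, lintegral_prod]
  refine Measurable.aemeasurable ?_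
  exact Measurable.lintegral_kernel_prod_right' (κ := channelKernel P)
    (f := fun p => ∫⁻ θ, F p.1 p.2 θ ∂(Measure.infinitePi fun _ => angleLaw)) hF.lintegral_prod_right'

end Network

/-! ### Gamma tails and evaluation of the mean number of harmful eavesdroppers -/

/-- The tail of the gamma distribution of integer shape `n` and scale `1`. -/
def gammaTail (n : ℕ) (x : ℝ) : ℝ := ∑ m ∈ range n, x ^ m * Real.exp (-x) / m.factorial

lemma gammaTail_nonneg (n : ℕ) {x : ℝ} (hx : 0 ≤ x) : 0 ≤ gammaTail n x :=
  sum_nonneg fun _ _ => by positivity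

/-- Term by term differentiation telescopes, leaving only the contribution of the top degree. -/
lemma hasDerivAt_gammaTail (n : ℕ) (x : ℝ) :
    HasDerivAt (gammaTail (n + 1)) (-(x ^ n * Real.exp (-x) / n.factorial)) x := by
  have hexp : HasDerivAt (fun x : ℝ => Real.exp (-x)) (-Real.exp (-x)) x := by
    simpa using (hasDerivAt_neg x).exp
  induction n with
  | zero =>
    have : gammaTail 1 = fun x => Real.exp (-x) := by ext y; simp [gammaTail]
    rw [this]
    simpa using hexp
  | succ n ih =>
    have : gammaTail (n + 1 + 1) = fun x => gammaTail (n + 1) x +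
        x ^ (n + 1) * Real.exp (-x) / (n + 1).factorial := by
      ext y; simp only [gammaTail, sum_range_succ]
    rw [this]
    have h := ih.add ((((hasDerivAt_pow (n + 1) x).mul hexp)).div_const ((n + 1).factorial : ℝ))
    refine h.congr_deriv ?_
    rw [Nat.factorial_succ]
    push_cast
    have : (n.factorial : ℝ) ≠ 0 := by positivity
    field_simp
    ring

lemma tendsto_gammaTail (n : ℕ) : Tendsto (gammaTail n) atTop (𝓝 0) := by
  unfold gammaTail
  rw [← Finset.sum_const_zero (s := range n)]
  refine tendsto_finsetSum _ fun m _ => ?_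
  simpa using (Real.tendsto_pow_mul_exp_neg_atTop_nhds_zero m).div_const (m.factorial : ℝ)

lemma gammaMeasure_Ioi {n : ℕ} (hn : 1 ≤ n) {x : ℝ} (hx : 0 ≤ x) :
    gammaMeasure n 1 (Set.Ioi x) = ENNReal.ofReal (gammaTail n x) := by
  obtain ⟨n, rfl⟩ : ∃ m, n = m + 1 := ⟨n - 1, by omega⟩
  have hderiv : ∀ u ∈ Set.Ici x, HasDerivAt (fun u => -gammaTail (n + 1) u)
      (u ^ n * Real.exp (-u) / n.factorial) u := fun u _ =>
    (hasDerivAt_gammaTail n u).neg.congr_deriv (neg_neg _)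
  have hpos : ∀ u ∈ Set.Ioi x, 0 ≤ u ^ n * Real.exp (-u) / n.factorial := fun u hu => by
    have : 0 ≤ u := hx.trans (le_of_lt hu)
    positivity
  have hlim : Tendsto (fun u => -gammaTail (n + 1) u) atTop (𝓝 0) := by
    simpa using (tendsto_gammaTail (n + 1)).neg
  have hint := integral_Ioi_of_hasDerivAt_of_nonneg' hderiv hpos hlim
  have hi := integrableOn_Ioi_deriv_of_nonneg' hderiv hpos hlim
  rw [zero_sub, neg_neg] at hint
  rw [← hint, ofReal_integral_eq_lintegral_ofReal hi
    ((ae_restrict_mem measurableSet_Ioi).mono hpos), gammaMeasure,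
    withDensity_apply _ measurableSet_Ioi]
  refine setLIntegral_congr_fun measurableSet_Ioi fun u hu => ?_
  have hu0 : 0 ≤ u := hx.trans (le_of_lt hu)
  simp only [gammaPDF, gammaPDFReal, if_pos hu0]
  congr 1
  have e : ((n + 1 : ℕ) : ℝ) - 1 = n := by push_cast; ring
  rw [e, Real.one_rpow, Real.rpow_natCast, Nat.cast_add_one, Real.Gamma_nat_eq_factorial, one_mul]
  ring

namespace Params

variable (P : Params)

lemma pl_pos (j : LinkState) : 0 < P.pl j := by unfold pl; positivity

lemma pathLoss_pos (j : LinkState) {d : ℝ} (hd : 0 < d) : 0 < P.pathLoss j d := by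
  have := P.pl_pos j
  unfold pathLoss; positivity

lemma lobeProb_nonneg (V : Lobe) : 0 ≤ P.lobeProb V := by
  have h0 := P.thetaB_nonneg
  have h1 := P.thetaB_le
  cases V <;> simp only [lobeProb] <;> linarith

lemma angleLaw_main : angleLaw {θ | |θ| ≤ P.thetaB} = ENNReal.ofReal (P.lobeProb .main) := by
  have h0 := P.thetaB_nonneg
  have h1 := P.thetaB_le
  have e : {θ : ℝ | |θ| ≤ P.thetaB} = Set.Icc (-P.thetaB) P.thetaB := by
    ext θ; simp [abs_le]
  have e2 : Set.Icc (-180) 180 ∩ Set.Icc (-P.thetaB) P.thetaB = Set.Icc (-P.thetaB) P.thetaB :=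
    Set.inter_eq_right.2 (Set.Icc_subset_Icc (by linarith) h1)
  rw [e, angleLaw, ProbabilityTheory.cond_apply measurableSet_Icc, e2, Real.volume_Icc,
    Real.volume_Icc, ← ENNReal.ofReal_inv_of_pos (by norm_num), ← ENNReal.ofReal_mul (by norm_num)]
  congr 1
  simp only [lobeProb]; ring

lemma angleLaw_side : angleLaw {θ | |θ| ≤ P.thetaB}ᶜ = ENNReal.ofReal (P.lobeProb .side) := by
  have hm : MeasurableSet {θ : ℝ | |θ| ≤ P.thetaB} :=
    measurableSet_le (by fun_prop) measurable_const
  rw [prob_compl_eq_one_sub hm, angleLaw_main, ← ENNReal.ofReal_one,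
    ← ENNReal.ofReal_sub _ (P.lobeProb_nonneg _)]
  congr 1
  simp only [lobeProb]; ring

/-- `P.exceedProb d (1 / t)`, by an explicit formula. -/
def exceedReal (t d : ℝ) : ℝ :=
  ∑ j, P.stateProb j d *
    (P.lobeProb .main * gammaTail (P.nak j) (d ^ P.alpha j / (P.gain .main * P.pl j * t)) +
      P.lobeProb .side * gammaTail (P.nak j) (d ^ P.alpha j / (P.gain .side * P.pl j * t)))

/-- For a fixed state and gain `V`, exceeding `1 / t` means that the fading exceeds `d ^ α / (V C_j
t)`, which is a gamma tail event. The angle matters only through the lobe it selects. -/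
lemma exceedProb_eq {t d : ℝ} (ht : 0 < t) (hd : 0 < d) :
    P.exceedProb d (1 / t) = ENNReal.ofReal (P.exceedReal t d) := by
  have hg : ∀ V j, 0 ≤ gammaTail (P.nak j) (d ^ P.alpha j / (P.gain V * P.pl j * t)) := fun V j => by
    have h1 := P.gain_pos V
    have h2 := P.pl_pos j
    exact gammaTail_nonneg _ (by positivity)
  have hnn : ∀ j, 0 ≤ P.lobeProb .main *
      gammaTail (P.nak j) (d ^ P.alpha j / (P.gain .main * P.pl j * t)) +
      P.lobeProb .side * gammaTail (P.nak j) (d ^ P.alpha j / (P.gain .side * P.pl j * t)) :=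
    fun j => add_nonneg (mul_nonneg (P.lobeProb_nonneg _) (hg _ j))
      (mul_nonneg (P.lobeProb_nonneg _) (hg _ j))
  have hm : Measurable fun a : LinkState × ℝ =>
      angleLaw {θ | 1 / t < P.arrayGain θ * P.pathLoss a.1 d * a.2} :=
    P.measurable_angleLaw_exceed.comp (by fun_prop :
        Measurable fun a : LinkState × ℝ => ((d, 1 / t), a))
  rw [exceedProb, P.lintegral_channelLaw d hm, exceedReal, ENNReal.ofReal_sum_of_nonneg
    fun j _ => mul_nonneg (P.stateProb_nonneg j d) (hnn j)]
  refine sum_congr rfl fun j _ => ?_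
  rw [ENNReal.ofReal_mul (P.stateProb_nonneg j d)]
  congr 1
  have hS : MeasurableSet {q : ℝ × ℝ | 1 / t < P.arrayGain q.2 * P.pathLoss j d * q.1} :=
    measurableSet_lt measurable_const
      (((P.measurable_arrayGain.comp measurable_snd).mul_const _).mul measurable_fst)
  -- Exchanging fading and angle lets the gain be fixed first.
  have hswap : ∫⁻ w, angleLaw {θ | 1 / t < P.arrayGain θ * P.pathLoss j d * w}
      ∂(gammaMeasure (P.nak j) 1) =
      ∫⁻ θ, gammaMeasure (P.nak j) 1 {w | 1 / t < P.arrayGain θ * P.pathLoss j d * w} ∂angleLaw :=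
    (Measure.prod_apply hS).symm.trans (Measure.prod_apply_symm hS)
  rw [hswap]
  have hval : ∀ V, gammaMeasure (P.nak j) 1 {w | 1 / t < P.gain V * P.pathLoss j d * w} =
      ENNReal.ofReal (gammaTail (P.nak j) (d ^ P.alpha j / (P.gain V * P.pl j * t))) := fun V => by
    have h1 := P.gain_pos V
    have h2 := P.pl_pos j
    rw [← gammaMeasure_Ioi (P.nak_pos j) (by positivity)]
    congr 1
    ext w
    have : 0 < d ^ P.alpha j := by positivity
    rw [Set.mem_ofPred_eq, Set.mem_Ioi, pathLoss, Real.rpow_neg hd.le, div_lt_iff₀ ht,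
      div_lt_iff₀ (c := P.gain V * P.pl j * t) (by positivity)]
    have e : P.gain V * (P.pl j * (d ^ P.alpha j)⁻¹) * w * t =
      w * (P.gain V * P.pl j * t) / d ^ P.alpha j := by field_simp
    rw [e, lt_div_iff₀ this, one_mul]
  have hmM : MeasurableSet {θ : ℝ | |θ| ≤ P.thetaB} :=
    measurableSet_le (by fun_prop) measurable_const
  rw [← lintegral_add_compl _ hmM, setLIntegral_congr_fun (g := fun _ => ENNReal.ofReal
      (gammaTail (P.nak j) (d ^ P.alpha j / (P.gain .main * P.pl j * t)))) hmM,
    setLIntegral_congr_fun (g := fun _ => ENNReal.ofReal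
      (gammaTail (P.nak j) (d ^ P.alpha j / (P.gain .side * P.pl j * t)))) hmM.compl,
    setLIntegral_const, setLIntegral_const, angleLaw_main, angleLaw_side,
    ← ENNReal.ofReal_mul (hg _ j), ← ENNReal.ofReal_mul (hg _ j),
    ← ENNReal.ofReal_add (mul_nonneg (hg _ j) (P.lobeProb_nonneg _))
      (mul_nonneg (hg _ j) (P.lobeProb_nonneg _))]
  · congr 1; ring
  · intro θ hθ
    have : ¬ |θ| ≤ P.thetaB := hθ
    simp only [arrayGain, if_neg this]
    exact hval .side
  · intro θ hθ
    have : |θ| ≤ P.thetaB := hθ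
    simp only [arrayGain, if_pos this]
    exact hval .main

end Params

/-- Substitute `x = r ^ α / K`, for which `r dr = (K ^ (2 / α) / α) x ^ (2 / α - 1) dx`. The set `S`
is kept general so that the parts inside and outside radius `D` are treated together. -/
lemma integral_rpow_comp {α K : ℝ} (hα : 0 < α) (hK : 0 < K) (m : ℕ) {S : Set ℝ}
    (hS : MeasurableSet S) :
    IntegrableOn (fun r => r * S.indicator (fun x => x ^ m * Real.exp (-x)) (r ^ α / K)) (Set.Ioi 0) ∧
    ∫ r in Set.Ioi 0, r * S.indicator (fun x => x ^ m * Real.exp (-x)) (r ^ α / K) =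
      K ^ (2 / α) / α * ∫ x in Set.Ioi 0 ∩ S, x ^ (m + 2 / α - 1) * Real.exp (-x) := by
  set g : ℝ → ℝ := S.indicator fun x => x ^ (m + 2 / α - 1) * Real.exp (-x)
  have hg : IntegrableOn g (Set.Ioi 0) := by
    have h := Real.GammaIntegral_convergent (s := m + 2 / α) (by positivity)
    refine IntegrableOn.indicator ?_ hS
    simpa only [mul_comm] using h
  have hgK : IntegrableOn (fun y => g (K⁻¹ * y)) (Set.Ioi 0) :=
    (integrableOn_Ioi_comp_mul_left_iff g 0 (inv_pos.2 hK)).2 (by simpa using hg)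
  have hgr := (integrableOn_Ioi_comp_rpow_iff (fun y => g (K⁻¹ * y)) hα.ne').2 hgK
  have e : Set.EqOn (fun r => r * S.indicator (fun x => x ^ m * Real.exp (-x)) (r ^ α / K))
      (fun r => K ^ (2 / α - 1) / α * ((|α| * r ^ (α - 1)) • g (K⁻¹ * r ^ α))) (Set.Ioi 0) := by
    intro r hr
    have hr0 : 0 < r := hr
    have hx : 0 < r ^ α / K := by positivity
    have hxx : K⁻¹ * r ^ α = r ^ α / K := by ring
    simp only [hxx, g, smul_eq_mul, abs_of_pos hα]
    by_cases hxS : r ^ α / K ∈ S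
    · rw [Set.indicator_of_mem hxS, Set.indicator_of_mem hxS]
      have e1 : (r ^ α / K) ^ ((m : ℝ) + 2 / α - 1) =
          (r ^ α / K) ^ m * (r ^ (2 - α) * K ^ (1 - 2 / α)) := by
        rw [add_sub_assoc, Real.rpow_add hx, Real.rpow_natCast]
        congr 1
        rw [Real.div_rpow (by positivity) hK.le, ← Real.rpow_mul hr0.le, div_eq_mul_inv,
          ← Real.rpow_neg hK.le]
        congr 2
        · field_simp
        · ring
      have e2 : r ^ (α - 1) * r ^ (2 - α) = r := by
        rw [← Real.rpow_add hr0]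
        have : α - 1 + (2 - α) = 1 := by ring
        rw [this, Real.rpow_one]
      have e3 : K ^ (2 / α - 1) * K ^ (1 - 2 / α) = 1 := by
        rw [← Real.rpow_add hK]; simp
      rw [e1]
      calc r * ((r ^ α / K) ^ m * Real.exp (-(r ^ α / K)))
          = (K ^ (2 / α - 1) * K ^ (1 - 2 / α)) * (r ^ (α - 1) * r ^ (2 - α)) *
            ((r ^ α / K) ^ m * Real.exp (-(r ^ α / K))) := by rw [e2, e3, one_mul]
        _ = _ := by field_simp
    · rw [Set.indicator_of_notMem hxS, Set.indicator_of_notMem hxS]; simp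
  constructor
  · exact IntegrableOn.congr_fun (hgr.const_mul (K ^ (2 / α - 1) / α)) e.symm measurableSet_Ioi
  · rw [setIntegral_congr_fun measurableSet_Ioi e, integral_const_mul,
      integral_comp_rpow_Ioi (fun y => g (K⁻¹ * y)) hα.ne',
      integral_comp_mul_left_Ioi g 0 (inv_pos.2 hK), mul_zero, inv_inv, smul_eq_mul,
      setIntegral_indicator hS, ← mul_assoc]
    congr 1
    rw [Real.rpow_sub hK, Real.rpow_one]
    field_simp

lemma integral_gammaTail_comp {α K : ℝ} (hα : 0 < α) (hK : 0 < K) (n : ℕ) {S : Set ℝ}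
    (hS : MeasurableSet S) :
    IntegrableOn (fun r => r * S.indicator (gammaTail n) (r ^ α / K)) (Set.Ioi 0) ∧
    ∫ r in Set.Ioi 0, r * S.indicator (gammaTail n) (r ^ α / K) =
      K ^ (2 / α) / α * ∑ m ∈ range n,
        (∫ x in Set.Ioi 0 ∩ S, x ^ (m + 2 / α - 1) * Real.exp (-x)) / m.factorial := by
  have e : ∀ r : ℝ, r * S.indicator (gammaTail n) (r ^ α / K) = ∑ m ∈ range n,
      r * S.indicator (fun x => x ^ m * Real.exp (-x)) (r ^ α / K) / m.factorial := fun r => by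
    by_cases h : r ^ α / K ∈ S
    · simp only [Set.indicator_of_mem h, gammaTail, mul_sum, mul_div_assoc]
    · simp [Set.indicator_of_notMem h]
  have h := fun m => integral_rpow_comp hα hK m hS
  simp only [e]
  constructor
  · exact integrable_finsetSum _ fun m _ => (h m).1.div_const _
  · rw [integral_finsetSum _ fun m _ => (h m).1.div_const _, mul_sum]
    refine sum_congr rfl fun m _ => ?_
    rw [integral_div, (h m).2, mul_div_assoc]

namespace Params

variable (P : Params)

lemma integral_gammaTail_in (j : LinkState) (V : Lobe) {t : ℝ} (ht : 0 < t) :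
    IntegrableOn (fun r => r * if r ≤ P.D then
      gammaTail (P.nak j) (r ^ P.alpha j / (P.gain V * P.pl j * t)) else 0) (Set.Ioi 0) ∧
    P.lobeProb V * ∫ r in Set.Ioi 0, (r * if r ≤ P.D then
      gammaTail (P.nak j) (r ^ P.alpha j / (P.gain V * P.pl j * t)) else 0) = P.omegaIn j V t := by
  have hα := P.alpha_pos j
  have hK : 0 < P.gain V * P.pl j * t := mul_pos (mul_pos (P.gain_pos V) (P.pl_pos j)) ht
  have h := integral_gammaTail_comp hα hK (P.nak j)
    (measurableSet_Iic (a := P.D ^ P.alpha j / (P.gain V * P.pl j * t)))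
  have e : Set.EqOn (fun r => r * (Set.Iic (P.D ^ P.alpha j / (P.gain V * P.pl j * t))).indicator
      (gammaTail (P.nak j)) (r ^ P.alpha j / (P.gain V * P.pl j * t)))
      (fun r => r * if r ≤ P.D then
      gammaTail (P.nak j) (r ^ P.alpha j / (P.gain V * P.pl j * t)) else 0) (Set.Ioi 0) := by
    intro r hr
    have : r ^ P.alpha j / (P.gain V * P.pl j * t) ≤ P.D ^ P.alpha j / (P.gain V * P.pl j * t) ↔
        r ≤ P.D := by
      rw [div_le_div_iff_of_pos_right hK, Real.rpow_le_rpow_iff (le_of_lt hr) P.D_pos.le hα]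
    simp only [Set.indicator_apply, Set.mem_Iic, this]
  refine ⟨IntegrableOn.congr_fun h.1 e measurableSet_Ioi, ?_⟩
  rw [← setIntegral_congr_fun measurableSet_Ioi e, h.2, omegaIn, ← mul_assoc, Set.Ioi_inter_Iic]
  rfl

lemma integral_gammaTail_out (j : LinkState) (V : Lobe) {t : ℝ} (ht : 0 < t) :
    IntegrableOn (fun r => r * if P.D < r then
      gammaTail (P.nak j) (r ^ P.alpha j / (P.gain V * P.pl j * t)) else 0) (Set.Ioi 0) ∧
    P.lobeProb V * ∫ r in Set.Ioi 0, (r * if P.D < r then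
      gammaTail (P.nak j) (r ^ P.alpha j / (P.gain V * P.pl j * t)) else 0) = P.omegaOut j V t := by
  have hα := P.alpha_pos j
  have hD := P.D_pos
  have hK : 0 < P.gain V * P.pl j * t := mul_pos (mul_pos (P.gain_pos V) (P.pl_pos j)) ht
  have h := integral_gammaTail_comp hα hK (P.nak j)
    (measurableSet_Ioi (a := P.D ^ P.alpha j / (P.gain V * P.pl j * t)))
  have e : Set.EqOn (fun r => r * (Set.Ioi (P.D ^ P.alpha j / (P.gain V * P.pl j * t))).indicator
      (gammaTail (P.nak j)) (r ^ P.alpha j / (P.gain V * P.pl j * t)))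
      (fun r => r * if P.D < r then
      gammaTail (P.nak j) (r ^ P.alpha j / (P.gain V * P.pl j * t)) else 0) (Set.Ioi 0) := by
    intro r hr
    have : P.D ^ P.alpha j / (P.gain V * P.pl j * t) < r ^ P.alpha j / (P.gain V * P.pl j * t) ↔
        P.D < r := by
      rw [div_lt_div_iff_of_pos_right hK, Real.rpow_lt_rpow_iff P.D_pos.le (le_of_lt hr) hα]
    simp only [Set.indicator_apply, Set.mem_Ioi, this]
  refine ⟨IntegrableOn.congr_fun h.1 e measurableSet_Ioi, ?_⟩
  rw [← setIntegral_congr_fun measurableSet_Ioi e, h.2, omegaOut, ← mul_assoc, Set.Ioi_inter_Ioi,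
    max_eq_right (div_nonneg (by positivity) hK.le)]
  rfl

lemma exceedReal_nonneg {t d : ℝ} (ht : 0 < t) (hd : 0 ≤ d) : 0 ≤ P.exceedReal t d := by
  have hg : ∀ V j, 0 ≤ gammaTail (P.nak j) (d ^ P.alpha j / (P.gain V * P.pl j * t)) := fun V j => by
    have h1 := P.gain_pos V
    have h2 := P.pl_pos j
    exact gammaTail_nonneg _ (by positivity)
  exact sum_nonneg fun j _ => mul_nonneg (P.stateProb_nonneg j d)
    (add_nonneg (mul_nonneg (P.lobeProb_nonneg _) (hg _ j))
      (mul_nonneg (P.lobeProb_nonneg _) (hg _ j)))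

/-- Up to distance `D` both states occur, with weights `q j`; beyond `D` every link is NLOS with
full weight. This accounts for the single, unweighted outer term. -/
lemma integral_exceedReal {t : ℝ} (ht : 0 < t) :
    IntegrableOn (fun r => r * P.exceedReal t r) (Set.Ioi 0) ∧
    2 * Real.pi * P.lamE * ∫ r in Set.Ioi 0, r * P.exceedReal t r = P.LambdaE t := by
  have hin := fun j V => P.integral_gammaTail_in j V ht
  have hout := fun V => P.integral_gammaTail_out .nlos V ht
  have e : ∀ r, r * P.exceedReal t r =
      (∑ j, P.q j * (P.lobeProb .main * (r * if r ≤ P.D then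
        gammaTail (P.nak j) (r ^ P.alpha j / (P.gain .main * P.pl j * t)) else 0) +
      P.lobeProb .side * (r * if r ≤ P.D then
        gammaTail (P.nak j) (r ^ P.alpha j / (P.gain .side * P.pl j * t)) else 0))) +
      (P.lobeProb .main * (r * if P.D < r then
        gammaTail (P.nak .nlos) (r ^ P.alpha .nlos / (P.gain .main * P.pl .nlos * t)) else 0) +
      P.lobeProb .side * (r * if P.D < r then
        gammaTail (P.nak .nlos) (r ^ P.alpha .nlos / (P.gain .side * P.pl .nlos * t)) else 0)) :=
    fun r => by
    rw [exceedReal, sum_state, sum_state]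
    by_cases h : r ≤ P.D
    · simp only [stateProb, q, if_pos h, if_neg (not_lt.2 h)]; ring
    · simp only [stateProb, q, if_neg h, if_pos (not_le.1 h)]; ring
  simp only [e]
  have i1 : ∀ j, IntegrableOn (fun r => P.q j * (P.lobeProb .main * (r * if r ≤ P.D then
        gammaTail (P.nak j) (r ^ P.alpha j / (P.gain .main * P.pl j * t)) else 0) +
      P.lobeProb .side * (r * if r ≤ P.D then
        gammaTail (P.nak j) (r ^ P.alpha j / (P.gain .side * P.pl j * t)) else 0))) (Set.Ioi 0) :=
    fun j => (((hin j .main).1.const_mul _).add ((hin j .side).1.const_mul _)).const_mul _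
  have i2 : IntegrableOn (fun r => ∑ j, P.q j * (P.lobeProb .main * (r * if r ≤ P.D then
        gammaTail (P.nak j) (r ^ P.alpha j / (P.gain .main * P.pl j * t)) else 0) +
      P.lobeProb .side * (r * if r ≤ P.D then
        gammaTail (P.nak j) (r ^ P.alpha j / (P.gain .side * P.pl j * t)) else 0))) (Set.Ioi 0) :=
    integrable_finsetSum _ fun j _ => i1 j
  have i3 := ((hout .main).1.const_mul (P.lobeProb .main))
  have i4 := ((hout .side).1.const_mul (P.lobeProb .side))
  refine ⟨i2.add (i3.add i4), ?_⟩
  have h34 := integral_add i2 (i3.add i4)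
  simp only [Pi.add_apply] at h34
  rw [h34, integral_add i3 i4, integral_finsetSum _ fun j _ => i1 j, LambdaE]
  congr 1
  rw [integral_const_mul, integral_const_mul, (hout .main).2, (hout .side).2, add_assoc]
  congr 1
  refine sum_congr rfl fun j _ => ?_
  rw [integral_const_mul, integral_add ((hin j .main).1.const_mul _) ((hin j .side).1.const_mul _),
    integral_const_mul, integral_const_mul, (hin j .main).2, (hin j .side).2]

lemma LambdaE_nonneg {t : ℝ} (ht : 0 < t) : 0 ≤ P.LambdaE t := by
  rw [← (P.integral_exceedReal ht).2]
  have := P.lamE_pos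
  refine mul_nonneg (by positivity) (setIntegral_nonneg measurableSet_Ioi fun r hr => ?_)
  exact mul_nonneg (le_of_lt hr) (P.exceedReal_nonneg ht (le_of_lt hr))

/-- The mean number of eavesdroppers at which the strength exceeds `1 / t`. -/
lemma lintegral_exceedProb {t : ℝ} (ht : 0 < t) (x : Plane) :
    ENNReal.ofReal P.lamE * ∫⁻ y, P.exceedProb (dist x y) (1 / t) =
      ENNReal.ofReal (P.LambdaE t) := by
  have h := P.integral_exceedReal ht
  have h1 : ∫⁻ y, P.exceedProb (dist x y) (1 / t) = ∫⁻ y : Plane, P.exceedProb ‖y‖ (1 / t) := by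
    simp only [dist_comm x, dist_eq_norm]
    -- Translation invariance: the mean does not depend on where the serving station stands.
    exact lintegral_sub_right_eq_self (fun y : Plane => P.exceedProb ‖y‖ (1 / t)) x
  have h2 : ∫⁻ y : Plane, P.exceedProb ‖y‖ (1 / t) =
      ∫⁻ y : Plane, ENNReal.ofReal (P.exceedReal t ‖y‖) := by
    refine lintegral_congr_ae ?_
    filter_upwards [compl_mem_ae_iff.2 (measure_singleton (0 : Plane))] with y hy
    exact P.exceedProb_eq ht (norm_pos_iff.2 hy)
  have hint : Integrable (fun y : Plane => P.exceedReal t ‖y‖) := by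
    rw [integrable_fun_norm_addHaar]
    simpa using h.1
  -- In polar coordinates the factor `2 π` appears as the dimension times the area of the unit disc.
  have hb : volume.real (Metric.ball (0 : Plane) 1) = Real.pi := by
    rw [measureReal_def, volume_ball_zero zero_le_one, one_pow, mul_one,
      ENNReal.toReal_ofReal Real.pi_pos.le]
  rw [h1, h2, ← ofReal_integral_eq_lintegral_ofReal hint
    (Eventually.of_forall fun y => P.exceedReal_nonneg ht (norm_nonneg y)),
    ← ENNReal.ofReal_mul P.lamE_pos.le, integral_fun_norm_addHaar volume, hb, ← h.2]
  congr 1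
  simp only [finrank_euclideanSpace, Fintype.card_fin, smul_eq_mul, nsmul_eq_mul,
    Nat.cast_ofNat, Nat.add_one_sub_one, pow_one]
  ring

end Params

/-! ### Secrecy conditioned on the serving station -/

namespace Params

variable (P : Params)

/-- The strength at the user of a link of length `d` in state `j` with fading `w`. -/
def strength (j : LinkState) (d w : ℝ) : ℝ := P.gain .main * P.pathLoss j d * w

/-- The probability of a secure connection, given that the link to the serving base station has
length `d` and is in state `j`. -/
def secureProb (j : LinkState) (d : ℝ) : ℝ≥0∞ :=
  ∫⁻ w, (if 0 < P.strength j d w then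
    ENNReal.ofReal (Real.exp (-P.LambdaE (1 / P.strength j d w))) else 0)
    ∂(gammaMeasure (P.nak j) 1)

open Classical in
/-- The probability that no other base station is preferred to base station `i`, if its link to
the user is in state `j`. -/
def preferProb (x : ℕ → Plane) (i : ℕ) (j : LinkState) : ℝ≥0∞ :=
  infProd fun k => ∫⁻ a, (if k = i ∨ P.pathLoss a.1 (dist (x k) 0) ≤ P.pathLoss j (dist (x i) 0)
    then 1 else 0) ∂(P.channelLaw (dist (x k) 0))

open Classical in
-- Integrate the coordinate `(i, none)` last. Once it is fixed, the serving event involves only the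
-- other links to the user and `φ` only the links from station `i` to eavesdroppers, so the two
-- parts factor. The general `K` and `φ` let the same computation serve both the secure event and
-- its conditional probability.
lemma lintegral_channelKernel_serving (x z : ℕ → Plane) (i : ℕ) (j : LinkState) {K : ℝ → ℝ≥0∞}
    (hK : Measurable K) {φ : ℝ → ℕ → LinkState × ℝ → ℝ≥0∞}
    (hφ : ∀ k, Measurable fun q : ℝ × (LinkState × ℝ) => φ q.1 k q.2) (hφ1 : ∀ w k a, φ w k a ≤ 1) :
    ∫⁻ c, (if (c (i, none)).1 = j ∧ ∀ k, P.pathLoss (c (k, none)).1 (dist (x k) 0) ≤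
          P.pathLoss (c (i, none)).1 (dist (x i) 0) then 1 else 0) * (K (c (i, none)).2 *
          infProd fun k => φ (c (i, none)).2 k (c (i, some k))) ∂(channelKernel P (x, z)) =
      ENNReal.ofReal (P.stateProb j (dist (x i) 0)) * P.preferProb x i j *
        ∫⁻ w, K w * infProd (fun k => ∫⁻ a, φ w k a ∂(P.channelLaw (dist (x i) (z k))))
          ∂(gammaMeasure (P.nak j) 1) := by
  have hpl : ∀ (l : Link) (d : ℝ), Measurable fun c : Link → LinkState × ℝ =>
      P.pathLoss (c l).1 d := fun l d =>
    (measurable_of_countable fun s : LinkState => P.pathLoss s d).comp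
      (measurable_fst.comp (measurable_pi_apply l))
  have hset : MeasurableSet {c : Link → LinkState × ℝ | (c (i, none)).1 = j ∧
      ∀ k, P.pathLoss (c (k, none)).1 (dist (x k) 0) ≤
          P.pathLoss (c (i, none)).1 (dist (x i) 0)} := by
    rw [Set.ofPred_and, Set.ofPred_forall]
    refine MeasurableSet.inter ?_ ?_
    · exact (measurable_fst.comp (measurable_pi_apply (i, none))) (MeasurableSet.of_discrete (s := {j}))
    · exact MeasurableSet.iInter fun k => measurableSet_le (hpl _ _) (hpl _ _)
  have hf : Measurable fun c : Link → LinkState × ℝ =>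
      (if (c (i, none)).1 = j ∧ ∀ k, P.pathLoss (c (k, none)).1 (dist (x k) 0) ≤
          P.pathLoss (c (i, none)).1 (dist (x i) 0) then (1 : ℝ≥0∞) else 0) * (K (c (i, none)).2 *
          infProd fun k => φ (c (i, none)).2 k (c (i, some k))) := by
    refine (Measurable.ite hset measurable_const measurable_const).mul
      ((hK.comp (by fun_prop)).mul (measurable_infProd fun k => ?_))
    exact (hφ k).comp (by fun_prop :
      Measurable fun c : Link → LinkState × ℝ => ((c (i, none)).2, c (i, some k)))
  have hker : channelKernel P (x, z) =
      Measure.infinitePi fun l => P.channelLaw (linkLength (x, z) l) := rfl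
  have hlen0 : ∀ k, linkLength (x, z) (k, none) = dist (x k) 0 := fun k => rfl
  have hlen1 : ∀ k, linkLength (x, z) (i, some k) = dist (x i) (z k) := fun k => rfl
  have hprefer : ∀ k, Measurable fun a : LinkState × ℝ => (if k = i ∨
      P.pathLoss a.1 (dist (x k) 0) ≤ P.pathLoss j (dist (x i) 0) then (1 : ℝ≥0∞) else 0) := fun k =>
    (measurable_of_countable fun s : LinkState => (if k = i ∨
      P.pathLoss s (dist (x k) 0) ≤ P.pathLoss j (dist (x i) 0) then (1 : ℝ≥0∞) else 0)).comp
      measurable_fst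
  rw [hker, lintegral_infinitePi_update (i, none) hf, hlen0]
  have hinner : ∀ a : LinkState × ℝ, ∫⁻ c, (if ((Function.update c (i, none) a) (i, none)).1 = j ∧
        ∀ k, P.pathLoss ((Function.update c (i, none) a) (k, none)).1 (dist (x k) 0) ≤
          P.pathLoss ((Function.update c (i, none) a) (i, none)).1 (dist (x i) 0) then (1 : ℝ≥0∞) else 0) *
        (K ((Function.update c (i, none) a) (i, none)).2 *
          infProd fun k => φ ((Function.update c (i, none) a) (i, none)).2 k
            ((Function.update c (i, none) a) (i, some k)))
        ∂(Measure.infinitePi fun l => P.channelLaw (linkLength (x, z) l)) =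
      (if a.1 = j then 1 else 0) * (K a.2 * (P.preferProb x i j *
        infProd fun k => ∫⁻ b, φ a.2 k b ∂(P.channelLaw (dist (x i) (z k))))) := by
    rintro ⟨l, w⟩
    have hne : ∀ k : ℕ, ((i, some k) : Link) ≠ (i, none) := fun k => by simp
    by_cases hl : l = j
    · subst hl
      -- The alternative `k = i` makes the factor of station `i` equal to `1`, so the overwritten
      -- coordinate no longer matters and the product may run over all `k`.
      have hpt : ∀ c : Link → LinkState × ℝ, (if ((Function.update c (i, none) (l, w)) (i, none)).1 = l ∧
          ∀ k, P.pathLoss ((Function.update c (i, none) (l, w)) (k, none)).1 (dist (x k) 0) ≤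
            P.pathLoss ((Function.update c (i, none) (l, w)) (i, none)).1 (dist (x i) 0)
            then (1 : ℝ≥0∞) else 0) = infProd fun k => if k = i ∨
            P.pathLoss (c (k, none)).1 (dist (x k) 0) ≤ P.pathLoss l (dist (x i) 0) then 1 else 0 := by
        intro c
        rw [infProd_ite]
        congr 1
        simp only [Function.update_self, true_and, eq_iff_iff]
        refine forall_congr' fun k => ?_
        by_cases hk : k = i
        · subst hk; simp
        · simp [hk]
      simp only [hpt]
      simp only [Function.update_self, Function.update_of_ne (hne _), if_true, one_mul]
      simp only [← mul_assoc, mul_comm _ (K w)]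
      simp only [mul_assoc]
      have h1 := lintegral_infinitePi_infProd_mul
        (ν := fun l => P.channelLaw (linkLength (x, z) l))
        (e := fun k => ((k, none) : Link)) (e' := fun k => ((i, some k) : Link))
        (fun a b h => by simpa using h) (fun a b h => by simpa using h) (fun a b h => by simp at h)
        (φ := fun k a => if k = i ∨
            P.pathLoss a.1 (dist (x k) 0) ≤ P.pathLoss l (dist (x i) 0) then 1 else 0)
        (φ' := fun k a => φ w k a) hprefer (fun k a => by split_ifs <;> simp)
        (fun k => (hφ k).comp (by fun_prop : Measurable fun a : LinkState × ℝ => (w, a)))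
        (fun k a => hφ1 w k a)
      simp only [hlen0, hlen1] at h1
      rw [lintegral_const_mul, h1]
      · rfl
      · refine (measurable_infProd fun k => ?_).mul (measurable_infProd fun k => ?_)
        · exact (hprefer k).comp (measurable_pi_apply _)
        · exact (hφ k).comp (by fun_prop : Measurable fun c : Link → LinkState × ℝ => (w, c (i, some k)))
    · simp [hl]
  simp only [hinner]
  have hKm : ∀ l : LinkState, Measurable fun w => K w * (P.preferProb x i j *
        infProd fun k => ∫⁻ b, φ w k b ∂(P.channelLaw (dist (x i) (z k)))) := fun l =>
    hK.mul ((measurable_infProd fun k => (hφ k).lintegral_prod_right').const_mul _)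
  rw [P.lintegral_channelLaw]
  · have hpref : P.preferProb x i j ≠ ∞ := ((infProd_le_one _).trans_lt ENNReal.one_lt_top).ne
    have e : ∫⁻ w, K w * (P.preferProb x i j *
        infProd fun k => ∫⁻ b, φ w k b ∂(P.channelLaw (dist (x i) (z k)))) ∂(gammaMeasure (P.nak j) 1) =
        P.preferProb x i j * ∫⁻ w, K w *
        (infProd fun k => ∫⁻ b, φ w k b ∂(P.channelLaw (dist (x i) (z k)))) ∂(gammaMeasure (P.nak j) 1) := by
      rw [← lintegral_const_mul' _ _ hpref]
      congr 1; ext w; ring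
    rw [Finset.sum_eq_single j]
    · simp only [if_true, one_mul]
      rw [e, mul_assoc]
    · intro l _ hl
      simp [hl]
    · simp
  · have hj : Measurable fun a : LinkState × ℝ => (if a.1 = j then (1 : ℝ≥0∞) else 0) :=
      (measurable_of_countable fun s : LinkState => if s = j then (1 : ℝ≥0∞) else 0).comp measurable_fst
    exact hj.mul ((hKm j).comp measurable_snd)

end Params


lemma measurable_pathLoss_link {α : Type*} [MeasurableSpace α] (P : Params) {x : α → Locations}
    {c : α → Link → LinkState × ℝ} (hx : Measurable x) (hc : Measurable c) (l : Link) :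
    Measurable fun a => P.pathLoss (c a l).1 (linkLength (x a) l) :=
  P.measurable_pathLoss_uncurry.comp
    ((measurable_fst.comp ((measurable_pi_apply l).comp hc)).prodMk
      ((measurable_linkLength l).comp hx))

namespace Params

variable (P : Params)

lemma measurable_strength (j : LinkState) : Measurable fun p : ℝ × ℝ => P.strength j p.1 p.2 := by
  have := P.measurable_pathLoss j
  unfold strength; fun_prop

lemma measurable_exceedProb_comp {α : Type*} [MeasurableSpace α] {d s : α → ℝ}
    (hd : Measurable d) (hs : Measurable s) : Measurable fun a => P.exceedProb (d a) (s a) :=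
  P.measurable_exceedProb.comp (f := fun a => (d a, s a)) (hd.prodMk hs)

/-- Measurability is read off from the representation of `LambdaE` as a mean of `exceedProb`, which
avoids studying incomplete gamma functions in their parameter. -/
lemma measurable_LambdaE_comp {α : Type*} [MeasurableSpace α] {f : α → ℝ} (hf : Measurable f) :
    Measurable fun a => if 0 < f a then
      ENNReal.ofReal (Real.exp (-P.LambdaE (1 / f a))) else 0 := by
  have h : ∀ a, (if 0 < f a then ENNReal.ofReal (Real.exp (-P.LambdaE (1 / f a))) else 0) =
      if 0 < f a then negExp (ENNReal.ofReal P.lamE * ∫⁻ y, P.exceedProb (dist (0 : Plane) y) (f a))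
        else 0 := fun a => by
    split_ifs with h0
    · have := P.lintegral_exceedProb (one_div_pos.2 h0) 0
      rw [one_div_one_div] at this
      rw [this, negExp_ofReal (P.LambdaE_nonneg (one_div_pos.2 h0))]
    · rfl
  simp only [h]
  refine Measurable.ite (measurableSet_lt measurable_const hf) ?_ measurable_const
  refine continuous_negExp.measurable.comp (Measurable.const_mul ?_ _)
  refine Measurable.lintegral_prod_right' (f := fun q : α × Plane =>
    P.exceedProb (dist (0 : Plane) q.2) (f q.1)) ?_
  have hd : Measurable fun q : α × Plane => dist (0 : Plane) q.2 :=
    measurable_const.dist measurable_snd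
  exact P.measurable_exceedProb_comp hd (hf.comp measurable_fst)

lemma measurable_secureProb (j : LinkState) : Measurable (P.secureProb j) := by
  unfold secureProb
  have h := P.measurable_LambdaE_comp (f := fun q : ℝ × ℝ => P.strength j q.1 q.2)
    (P.measurable_strength j)
  exact Measurable.lintegral_prod_right (ν := gammaMeasure (P.nak j) 1) h

end Params

lemma ite_mul_ite (p q r : Prop) [Decidable p] [Decidable q] [Decidable r]
    [Decidable (p ∧ q ∧ r)] :
    (if p then (1 : ℝ≥0∞) else 0) * ((if q then 1 else 0) * if r then 1 else 0) =
      if p ∧ q ∧ r then 1 else 0 := by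
  by_cases hp : p <;> by_cases hq : q <;> by_cases hr : r <;> simp [hp, hq, hr]

namespace Network

variable {P : Params} {Ω : Type*} [MeasurableSpace Ω] {μ : Measure Ω} [IsProbabilityMeasure μ]

lemma lintegral_eve (N : Network P μ) (x : Plane) {s : ℝ} (hs : 0 < s) :
    ∫⁻ z, infProd (fun k => 1 - P.exceedProb (dist x (z k)) s) ∂(μ.map fun ω k => N.eve k ω) =
      ENNReal.ofReal (Real.exp (-P.LambdaE (1 / s))) := by
  have hd : Measurable fun y : Plane => P.exceedProb (dist x y) s := by
    have h : Measurable fun y : Plane => dist x y := measurable_const.dist measurable_id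
    exact P.measurable_exceedProb_comp h measurable_const
  rw [lintegral_map (f := fun z => infProd fun k => 1 - P.exceedProb (dist x (z k)) s)
    (measurable_infProd fun k => (hd.comp (measurable_pi_apply k)).const_sub 1)
    (measurable_pi_lambda _ N.eve_ppp.measurable),
    N.eve_ppp.lintegral_infProd hd fun y => P.exceedProb_le_one _ _]
  have := P.lintegral_exceedProb (one_div_pos.2 hs) x
  rw [one_div_one_div] at this
  rw [this, negExp_ofReal (P.LambdaE_nonneg (one_div_pos.2 hs))]

open Classical in
lemma lintegral_serving (N : Network P μ) (i : ℕ) (j : LinkState) :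
    ∫⁻ ω, (if (N.channel (i, none) ω).1 = j ∧ N.IsServing i ω then
        P.secureProb j ‖N.bs i ω‖ else 0) ∂μ =
      ∫⁻ x, ENNReal.ofReal (P.stateProb j (dist (x i) 0)) * P.preferProb x i j *
        P.secureProb j (dist (x i) 0) ∂(μ.map fun ω i => N.bs i ω) := by
  -- The trivial product of ones brings the integrand to the shape required by
  -- `lintegral_channelKernel_serving`.
  let F : Locations → (Link → LinkState × ℝ) → (ℕ × ℕ → ℝ) → ℝ≥0∞ := fun x c _ =>
    (if (c (i, none)).1 = j ∧ ∀ k, P.pathLoss (c (k, none)).1 (dist (x.1 k) 0) ≤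
          P.pathLoss (c (i, none)).1 (dist (x.1 i) 0) then 1 else 0) *
        (P.secureProb j (dist (x.1 i) 0) * infProd fun _ => 1)
  have hset : MeasurableSet {p : (Locations × (Link → LinkState × ℝ)) × (ℕ × ℕ → ℝ) |
      (p.1.2 (i, none)).1 = j ∧ ∀ k, P.pathLoss (p.1.2 (k, none)).1 (dist (p.1.1.1 k) 0) ≤
          P.pathLoss (p.1.2 (i, none)).1 (dist (p.1.1.1 i) 0)} := by
    rw [Set.ofPred_and, Set.ofPred_forall]
    refine MeasurableSet.inter ?_ ?_
    · exact (by fun_prop : Measurable fun p : (Locations × (Link → LinkState × ℝ)) × (ℕ × ℕ → ℝ) =>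
        (p.1.2 (i, none)).1) (MeasurableSet.of_discrete (s := {j}))
    · exact MeasurableSet.iInter fun k => measurableSet_le
        (measurable_pathLoss_link P (by fun_prop) (by fun_prop) (k, none))
        (measurable_pathLoss_link P (by fun_prop) (by fun_prop) (i, none))
  have hF : Measurable fun p : (Locations × (Link → LinkState × ℝ)) × (ℕ × ℕ → ℝ) =>
      F p.1.1 p.1.2 p.2 := by
    refine (Measurable.ite hset measurable_const measurable_const).mul (Measurable.mul_const ?_ _)
    exact (P.measurable_secureProb j).comp ((by fun_prop :
      Measurable fun p : (Locations × (Link → LinkState × ℝ)) × (ℕ × ℕ → ℝ) => p.1.1.1 i).dist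
        measurable_const)
  have key := N.lintegral_comp hF
  have e : ∀ ω, F (N.loc ω) (fun l => N.channel l ω) (fun m => N.angle m ω) =
      if (N.channel (i, none) ω).1 = j ∧ N.IsServing i ω then
        P.secureProb j ‖N.bs i ω‖ else 0 := fun ω => by
    simp only [F, infProd_one, mul_one, ite_mul, one_mul, zero_mul, loc, dist_zero_right]
    congr 1
    simp only [IsServing, linkLoss, linkLength, receiver, loc, dist_zero_right]
  simp only [e] at key
  rw [key]
  have hpe : IsProbabilityMeasure (μ.map fun ω k => N.eve k ω) :=
    Measure.isProbabilityMeasure_map (measurable_pi_lambda _ N.eve_ppp.measurable).aemeasurable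
  refine lintegral_congr fun x => ?_
  have h1 : ∀ z : ℕ → Plane, ∫⁻ c, ∫⁻ θ, F (x, z) c θ ∂(Measure.infinitePi fun _ => angleLaw)
        ∂(channelKernel P (x, z)) = ENNReal.ofReal (P.stateProb j (dist (x i) 0)) *
        P.preferProb x i j * P.secureProb j (dist (x i) 0) := fun z => by
    have := P.lintegral_channelKernel_serving x z i j
      (K := fun _ => P.secureProb j (dist (x i) 0)) measurable_const (φ := fun _ _ _ => 1)
      (fun _ => measurable_const) (fun _ _ _ => le_rfl)
    simp only [lintegral_const, measure_univ, mul_one, infProd_one] at this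
    simp only [F, lintegral_const, measure_univ, mul_one, infProd_one]
    exact this
  simp only [h1, lintegral_const, measure_univ, mul_one]

open Classical in
/-- Given that base station `i` serves the user through a link in state `j`, the probability of a
secure connection is `secureProb`. -/
lemma measure_serving_secure (N : Network P μ) (i : ℕ) (j : LinkState) :
    μ {ω | ((N.channel (i, none) ω).1 = j ∧ N.IsServing i ω) ∧
      0 < N.userStrength i ω ∧ ∀ k, N.eveStrength i k ω ≤ N.userStrength i ω} =
    ∫⁻ ω, (if (N.channel (i, none) ω).1 = j ∧ N.IsServing i ω then
        P.secureProb j ‖N.bs i ω‖ else 0) ∂μ := by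
  rw [N.lintegral_serving i j]
  let F : Locations → (Link → LinkState × ℝ) → (ℕ × ℕ → ℝ) → ℝ≥0∞ := fun x c θ =>
    (if (c (i, none)).1 = j ∧ ∀ k, P.pathLoss (c (k, none)).1 (dist (x.1 k) 0) ≤
          P.pathLoss (c (i, none)).1 (dist (x.1 i) 0) then 1 else 0) *
        ((if 0 < P.strength j (dist (x.1 i) 0) (c (i, none)).2 then 1 else 0) * infProd fun k =>
          if P.arrayGain (θ (i, k)) * P.pathLoss (c (i, some k)).1 (dist (x.1 i) (x.2 k)) *
            (c (i, some k)).2 ≤ P.strength j (dist (x.1 i) 0) (c (i, none)).2 then 1 else 0)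
  have hset : MeasurableSet {p : (Locations × (Link → LinkState × ℝ)) × (ℕ × ℕ → ℝ) |
      (p.1.2 (i, none)).1 = j ∧ ∀ k, P.pathLoss (p.1.2 (k, none)).1 (dist (p.1.1.1 k) 0) ≤
          P.pathLoss (p.1.2 (i, none)).1 (dist (p.1.1.1 i) 0)} := by
    rw [Set.ofPred_and, Set.ofPred_forall]
    refine MeasurableSet.inter ?_ ?_
    · exact (by fun_prop : Measurable fun p : (Locations × (Link → LinkState × ℝ)) × (ℕ × ℕ → ℝ) =>
        (p.1.2 (i, none)).1) (MeasurableSet.of_discrete (s := {j}))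
    · exact MeasurableSet.iInter fun k => measurableSet_le
        (measurable_pathLoss_link P (by fun_prop) (by fun_prop) (k, none))
        (measurable_pathLoss_link P (by fun_prop) (by fun_prop) (i, none))
  have hstr : Measurable fun p : (Locations × (Link → LinkState × ℝ)) × (ℕ × ℕ → ℝ) =>
      P.strength j (dist (p.1.1.1 i) 0) (p.1.2 (i, none)).2 :=
    (P.measurable_strength j).comp (((by fun_prop :
      Measurable fun p : (Locations × (Link → LinkState × ℝ)) × (ℕ × ℕ → ℝ) => p.1.1.1 i).dist
        measurable_const).prodMk (by fun_prop))
  have heve : ∀ k, Measurable fun p : (Locations × (Link → LinkState × ℝ)) × (ℕ × ℕ → ℝ) =>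
      P.arrayGain (p.2 (i, k)) * P.pathLoss (p.1.2 (i, some k)).1 (dist (p.1.1.1 i) (p.1.1.2 k)) *
        (p.1.2 (i, some k)).2 := fun k =>
    ((P.measurable_arrayGain.comp (by fun_prop)).mul
      (measurable_pathLoss_link P (by fun_prop) (by fun_prop) (i, some k))).mul (by fun_prop)
  have hF : Measurable fun p : (Locations × (Link → LinkState × ℝ)) × (ℕ × ℕ → ℝ) =>
      F p.1.1 p.1.2 p.2 := by
    refine (Measurable.ite hset measurable_const measurable_const).mul
      ((Measurable.ite (measurableSet_lt measurable_const hstr) measurable_const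
        measurable_const).mul (measurable_infProd fun k => ?_))
    exact Measurable.ite (measurableSet_le (heve k) hstr) measurable_const measurable_const
  have hm : Measurable fun ω => ((N.loc ω, fun l => N.channel l ω), fun m => N.angle m ω) := by
    have h1 := N.bs_ppp.measurable
    have h2 := N.eve_ppp.measurable
    have h3 := N.channel_measurable
    have h4 := N.angle_measurable
    unfold loc; fun_prop
  have key := N.lintegral_comp hF
  have e : ∀ ω, F (N.loc ω) (fun l => N.channel l ω) (fun m => N.angle m ω) =
      {ω | ((N.channel (i, none) ω).1 = j ∧ N.IsServing i ω) ∧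
      0 < N.userStrength i ω ∧ ∀ k, N.eveStrength i k ω ≤ N.userStrength i ω}.indicator 1 ω :=
    fun ω => by
    simp only [F, Set.indicator_apply, infProd_ite, Set.mem_ofPred_eq]
    by_cases hj : (N.channel (i, none) ω).1 = j
    · have h0 : N.userStrength i ω =
          P.strength j (dist ((N.loc ω).1 i) 0) (N.channel (i, none) ω).2 := by
        simp only [userStrength, Params.strength, linkLoss, linkLength, receiver, hj]
      have h1 : N.IsServing i ω ↔ ∀ k, P.pathLoss (N.channel (k, none) ω).1
          (dist ((N.loc ω).1 k) 0) ≤ P.pathLoss (N.channel (i, none) ω).1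
          (dist ((N.loc ω).1 i) 0) := by
        simp only [IsServing, linkLoss, linkLength, receiver]
      have h2 : ∀ k, N.eveStrength i k ω = P.arrayGain (N.angle (i, k) ω) *
          P.pathLoss (N.channel (i, some k) ω).1 (dist ((N.loc ω).1 i) ((N.loc ω).2 k)) *
          (N.channel (i, some k) ω).2 := fun k => by
        simp only [eveStrength, linkLoss, linkLength, receiver]
      simp only [← h0, ← h1, ← h2]
      exact (ite_mul_ite _ _ _).trans (if_congr Iff.rfl rfl rfl)
    · simp [hj]
  simp only [e] at key
  rw [lintegral_indicator_one₀] at key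
  swap
  · have : Measurable fun ω => {ω | ((N.channel (i, none) ω).1 = j ∧ N.IsServing i ω) ∧
      0 < N.userStrength i ω ∧ ∀ k, N.eveStrength i k ω ≤ N.userStrength i ω}.indicator
        (1 : Ω → ℝ≥0∞) ω := by
      simp only [← e]; exact hF.comp hm
    exact ((measurable_indicator_const_iff (1 : ℝ≥0∞)).1 this).nullMeasurableSet
  rw [key]
  refine lintegral_congr fun x => ?_
  have hK : Measurable fun w => if 0 < P.strength j (dist (x i) 0) w then (1 : ℝ≥0∞) else 0 :=
    Measurable.ite (measurableSet_lt measurable_const ((P.measurable_strength j).comp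
      (by fun_prop : Measurable fun w : ℝ => (dist (x i) 0, w)))) measurable_const measurable_const
  have hw : Measurable fun w => P.strength j (dist (x i) 0) w :=
    (P.measurable_strength j).comp (by fun_prop : Measurable fun w : ℝ => (dist (x i) 0, w))
  have h1 : ∀ z : ℕ → Plane, ∫⁻ c, ∫⁻ θ, F (x, z) c θ ∂(Measure.infinitePi fun _ => angleLaw)
        ∂(channelKernel P (x, z)) = ENNReal.ofReal (P.stateProb j (dist (x i) 0)) *
        P.preferProb x i j * ∫⁻ w, (if 0 < P.strength j (dist (x i) 0) w then (1 : ℝ≥0∞) else 0) *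
          infProd (fun k => 1 - P.exceedProb (dist (x i) (z k)) (P.strength j (dist (x i) 0) w))
          ∂(gammaMeasure (P.nak j) 1) := fun z => by
    have := P.lintegral_channelKernel_serving x z i j hK
      (φ := fun w k a => angleLaw {θ | P.arrayGain θ * P.pathLoss a.1 (dist (x i) (z k)) * a.2 ≤
        P.strength j (dist (x i) 0) w}) (fun k => ?_) (fun _ _ _ => prob_le_one)
    · simp only [P.lintegral_angleLaw_le] at this
      rw [← this]
      refine lintegral_congr fun c => ?_
      have hθ : ∀ k, Measurable fun t : ℝ =>
          (if P.arrayGain t * P.pathLoss (c (i, some k)).1 (dist (x i) (z k)) *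
            (c (i, some k)).2 ≤ P.strength j (dist (x i) 0) (c (i, none)).2 then (1 : ℝ≥0∞) else 0) :=
        fun k => Measurable.ite (measurableSet_le
          ((P.measurable_arrayGain.mul_const _).mul_const _) measurable_const) measurable_const
          measurable_const
      simp only [F]
      rw [lintegral_const_mul' _ _ (by split_ifs <;> simp),
        lintegral_const_mul' _ _ (by split_ifs <;> simp)]
      congr 2
      -- With the channels frozen, the angles `(i, k)` are independent in `k`, so the product over
      -- eavesdroppers is averaged factor by factor.
      have h := lintegral_infinitePi_infProd (ν := fun _ : ℕ × ℕ => angleLaw)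
        (e := fun k : ℕ => (i, k)) (fun a b h => by simpa using h) hθ
        (fun k a => by split_ifs <;> simp)
      rw [h]
      congr 1
      ext k
      have := lintegral_indicator_one (μ := angleLaw) (measurableSet_le
        ((P.measurable_arrayGain.mul_const (P.pathLoss (c (i, some k)).1 (dist (x i) (z k)))).mul_const
          (c (i, some k)).2) (measurable_const (a := P.strength j (dist (x i) 0) (c (i, none)).2)))
      rw [← this]
      rfl
    · have hc : ∀ q : ℝ × (LinkState × ℝ), angleLaw {θ | P.arrayGain θ *
          P.pathLoss q.2.1 (dist (x i) (z k)) * q.2.2 ≤ P.strength j (dist (x i) 0) q.1} =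
          1 - angleLaw {θ | P.strength j (dist (x i) 0) q.1 < P.arrayGain θ *
          P.pathLoss q.2.1 (dist (x i) (z k)) * q.2.2} := fun q => by
        rw [← prob_compl_eq_one_sub (measurableSet_lt measurable_const
          ((P.measurable_arrayGain.mul_const _).mul_const _))]
        congr 1; ext θ; simp
      simp only [hc]
      exact (P.measurable_angleLaw_exceed.comp (f := fun q : ℝ × (LinkState × ℝ) =>
        ((dist (x i) (z k), P.strength j (dist (x i) 0) q.1), q.2)) (by fun_prop)).const_sub 1
  simp only [h1]
  have hpref : ENNReal.ofReal (P.stateProb j (dist (x i) 0)) * P.preferProb x i j ≠ ∞ :=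
    ENNReal.mul_ne_top ENNReal.ofReal_ne_top ((infProd_le_one _).trans_lt ENNReal.one_lt_top).ne
  rw [lintegral_const_mul' _ _ hpref]
  congr 1
  have hpe : IsProbabilityMeasure (μ.map fun ω k => N.eve k ω) :=
    Measure.isProbabilityMeasure_map (measurable_pi_lambda _ N.eve_ppp.measurable).aemeasurable
  have hex : ∀ k, Measurable fun q : (ℕ → Plane) × ℝ =>
      1 - P.exceedProb (dist (x i) (q.1 k)) (P.strength j (dist (x i) 0) q.2) := fun k =>
    by
      have h : Measurable fun q : (ℕ → Plane) × ℝ => dist (x i) (q.1 k) :=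
        measurable_const.dist (by fun_prop)
      exact (P.measurable_exceedProb_comp h (hw.comp measurable_snd)).const_sub 1
  -- The eavesdroppers are averaged before the fading, so that the generating functional is applied
  -- at a fixed user strength.
  rw [lintegral_lintegral_swap ((hK.comp measurable_snd).mul (measurable_infProd hex)).aemeasurable,
    Params.secureProb]
  refine lintegral_congr fun w => ?_
  rw [lintegral_const_mul' _ _ (by split_ifs <;> simp)]
  split_ifs with h0
  · rw [one_mul, N.lintegral_eve (x i) h0]
  · rw [zero_mul]

end Network

/-! ### Nearest stations in each state: independence and densities -/

namespace Params

variable (P : Params)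

lemma sum_stateProb (r : ℝ) : P.stateProb .los r + P.stateProb .nlos r = 1 := by
  simp [stateProb]

open Classical in
/-- The mean number of base stations in state `j` at distance less than `s` from the user. -/
def meanCloser (j : LinkState) (s : ℝ≥0∞) : ℝ≥0∞ :=
  ENNReal.ofReal P.lamB * ∫⁻ y : Plane, ENNReal.ofReal (P.stateProb j ‖y‖) *
    if ENNReal.ofReal ‖y‖ < s then 1 else 0

lemma meanCloser_zero (j : LinkState) : P.meanCloser j 0 = 0 := by simp [meanCloser]

end Params

namespace Network

variable {P : Params} {Ω : Type*} [MeasurableSpace Ω] {μ : Measure Ω}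

open Classical in
/-- The distance from the user to the nearest base station whose link to the user is in
state `j`. -/
def nearest (N : Network P μ) (j : LinkState) (ω : Ω) : ℝ≥0∞ :=
  ⨅ k, if (N.channel (k, none) ω).1 = j then ENNReal.ofReal ‖N.bs k ω‖ else ⊤

lemma measurable_nearest (N : Network P μ) (j : LinkState) : Measurable (N.nearest j) := by
  unfold nearest
  refine Measurable.iInf fun k => Measurable.ite ?_ ?_ measurable_const
  · exact (measurable_fst.comp (N.channel_measurable (k, none))) (MeasurableSet.of_discrete (s := {j}))
  · exact (N.bs_ppp.measurable k).norm.ennreal_ofReal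

lemma le_nearest_iff (N : Network P μ) (j : LinkState) (ω : Ω) (s : ℝ≥0∞) :
    s ≤ N.nearest j ω ↔ ∀ k, (N.channel (k, none) ω).1 = j → s ≤ ENNReal.ofReal ‖N.bs k ω‖ := by
  unfold nearest
  rw [le_iInf_iff]
  refine forall_congr' fun k => ?_
  split_ifs with h <;> simp [h]

variable [IsProbabilityMeasure μ]

open Classical in
-- Given the locations, a station at `y` violates the condition with probability `p y`, the chance
-- that its state `j` satisfies `‖y‖ < t j`. The generating functional then applies, and the mean
-- splits as a sum over states; this additivity is the independence of the thinned processes.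
lemma measure_le_nearest (N : Network P μ) (t : LinkState → ℝ≥0∞) :
    μ {ω | ∀ j, t j ≤ N.nearest j ω} = negExp (∑ j, P.meanCloser j (t j)) := by
  let F : Locations → (Link → LinkState × ℝ) → (ℕ × ℕ → ℝ) → ℝ≥0∞ := fun x c _ =>
    infProd fun k => if t (c (k, none)).1 ≤ ENNReal.ofReal ‖x.1 k‖ then 1 else 0
  have ht : Measurable t := measurable_of_countable t
  have hF : Measurable fun p : (Locations × (Link → LinkState × ℝ)) × (ℕ × ℕ → ℝ) =>
      F p.1.1 p.1.2 p.2 := by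
    refine measurable_infProd fun k => Measurable.ite (measurableSet_le ?_ ?_) measurable_const
      measurable_const
    · exact ht.comp (by fun_prop)
    · exact (by fun_prop : Measurable fun p : (Locations × (Link → LinkState × ℝ)) × (ℕ × ℕ → ℝ) =>
        p.1.1.1 k).norm.ennreal_ofReal
  have key := N.lintegral_comp hF
  have e : ∀ ω, F (N.loc ω) (fun l => N.channel l ω) (fun m => N.angle m ω) =
      {ω | ∀ j, t j ≤ N.nearest j ω}.indicator 1 ω := fun ω => by
    simp only [F, infProd_ite, Set.indicator_apply, Set.mem_ofPred_eq, Pi.one_apply,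
      le_nearest_iff, loc]
    refine if_congr ?_ rfl rfl
    exact ⟨fun h j k hk => hk ▸ h k, fun h k => h _ k rfl⟩
  have hset : MeasurableSet {ω | ∀ j, t j ≤ N.nearest j ω} := by
    rw [Set.ofPred_forall]
    exact MeasurableSet.iInter fun j => measurableSet_le measurable_const (N.measurable_nearest j)
  simp only [e] at key
  rw [lintegral_indicator_one hset] at key
  have hpe : IsProbabilityMeasure (μ.map fun ω k => N.eve k ω) :=
    Measure.isProbabilityMeasure_map (measurable_pi_lambda _ N.eve_ppp.measurable).aemeasurable
  let p : Plane → ℝ≥0∞ := fun y => ∑ j, ENNReal.ofReal (P.stateProb j ‖y‖) *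
    if ENNReal.ofReal ‖y‖ < t j then 1 else 0
  have hterm : ∀ j, Measurable fun y : Plane => ENNReal.ofReal (P.stateProb j ‖y‖) *
      if ENNReal.ofReal ‖y‖ < t j then 1 else 0 := fun j => by
    refine (((P.measurable_stateProb j).comp measurable_norm).ennreal_ofReal).mul ?_
    exact Measurable.ite (measurableSet_lt measurable_norm.ennreal_ofReal measurable_const)
      measurable_const measurable_const
  have hp : Measurable p := Finset.measurable_sum _ fun j _ => hterm j
  have hsum : ∀ r, ∑ j, ENNReal.ofReal (P.stateProb j r) = 1 := fun r => by
    rw [← ENNReal.ofReal_sum_of_nonneg fun j _ => P.stateProb_nonneg j r, Params.sum_state,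
      Params.sum_stateProb, ENNReal.ofReal_one]
  have hp1 : ∀ y, p y ≤ 1 := fun y => by
    rw [← hsum ‖y‖]
    refine sum_le_sum fun j _ => ?_
    split_ifs <;> simp
  have hx : ∀ x z : ℕ → Plane, ∫⁻ c, ∫⁻ θ, F (x, z) c θ ∂(Measure.infinitePi fun _ => angleLaw)
      ∂(channelKernel P (x, z)) = infProd fun k => 1 - p (x k) := fun x z => by
    have hker : channelKernel P (x, z) =
      Measure.infinitePi fun l => P.channelLaw (linkLength (x, z) l) := rfl
    have hm : ∀ k, Measurable fun a : LinkState × ℝ =>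
        if t a.1 ≤ ENNReal.ofReal ‖x k‖ then (1 : ℝ≥0∞) else 0 := fun k =>
      Measurable.ite (measurableSet_le (ht.comp measurable_fst) measurable_const) measurable_const
        measurable_const
    simp only [F, lintegral_const, measure_univ, mul_one]
    rw [hker, lintegral_infinitePi_infProd (e := fun k => ((k, none) : Link))
      (fun a b h => by simpa using h) hm fun k a => by split_ifs <;> simp]
    congr 1
    ext k
    have hlen : linkLength (x, z) (k, none) = ‖x k‖ := dist_zero_right _
    rw [P.lintegral_channelLaw _ (hm k), hlen]
    refine ENNReal.eq_sub_of_add_eq ((hp1 _).trans_lt ENNReal.one_lt_top).ne ?_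
    simp only [p]
    rw [← sum_add_distrib]
    refine Eq.trans (sum_congr rfl fun j _ => ?_) (hsum ‖x k‖)
    by_cases h : t j ≤ ENNReal.ofReal ‖x k‖
    · simp only [if_pos h, if_neg (not_lt.2 h), lintegral_const, measure_univ, mul_one, mul_zero,
        add_zero]
    · simp only [if_neg h, if_pos (not_le.1 h), lintegral_const, measure_univ, mul_one, mul_zero,
        zero_add]
  simp only [hx, lintegral_const, measure_univ, mul_one] at key
  rw [key, lintegral_map (f := fun x => infProd fun k => 1 - p (x k))
    (measurable_infProd fun k => (hp.comp (measurable_pi_apply k)).const_sub 1)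
    (measurable_pi_lambda _ N.bs_ppp.measurable), N.bs_ppp.lintegral_infProd hp hp1]
  congr 1
  simp only [p]
  rw [lintegral_finsetSum _ fun j _ => hterm j, mul_sum]
  rfl

lemma measure_le_nearest_and (N : Network P μ) {j j' : LinkState} (h : j ≠ j') (s s' : ℝ≥0∞) :
    μ {ω | s ≤ N.nearest j ω ∧ s' ≤ N.nearest j' ω} =
      negExp (P.meanCloser j s) * negExp (P.meanCloser j' s') := by
  have := N.measure_le_nearest fun l => if l = j then s else s'
  rw [← negExp_add]
  rw [Params.sum_state] at this
  cases j <;> cases j' <;> simp at h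
  · have e : {ω | s ≤ N.nearest .los ω ∧ s' ≤ N.nearest .nlos ω} =
        {ω | ∀ l, (if l = LinkState.los then s else s') ≤ N.nearest l ω} := by
      ext ω
      exact ⟨fun h' l => by cases l <;> simp [h'.1, h'.2],
        fun h' => ⟨by simpa using h' .los, by simpa using h' .nlos⟩⟩
    rw [e, this]
    simp
  · have e : {ω | s ≤ N.nearest .nlos ω ∧ s' ≤ N.nearest .los ω} =
        {ω | ∀ l, (if l = LinkState.nlos then s else s') ≤ N.nearest l ω} := by
      ext ω
      exact ⟨fun h' l => by cases l <;> simp [h'.1, h'.2],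
        fun h' => ⟨by simpa using h' .nlos, by simpa using h' .los⟩⟩
    rw [e, this, add_comm]
    simp

lemma measure_le_nearest_single (N : Network P μ) (j : LinkState) (s : ℝ≥0∞) :
    μ {ω | s ≤ N.nearest j ω} = negExp (P.meanCloser j s) := by
  have : ∀ j' : LinkState, j ≠ j' → μ {ω | s ≤ N.nearest j ω} = negExp (P.meanCloser j s) :=
    fun j' h => by
      have := N.measure_le_nearest_and h s 0
      simpa [P.meanCloser_zero, negExp_zero] using this
  cases j
  · exact this .nlos (by simp)
  · exact this .los (by simp)

/-- The half-lines `[s, ∞]` form a generating π-system, so the factorization of the joint tails is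
independence. -/
lemma map_nearest_prod (N : Network P μ) {j j' : LinkState} (h : j ≠ j') :
    μ.map (fun ω => (N.nearest j ω, N.nearest j' ω)) =
      (μ.map (N.nearest j)).prod (μ.map (N.nearest j')) := by
  have hj := N.measurable_nearest j
  have hj' := N.measurable_nearest j'
  have hp : IsProbabilityMeasure (μ.map (N.nearest j)) :=
    Measure.isProbabilityMeasure_map hj.aemeasurable
  have hp' : IsProbabilityMeasure (μ.map (N.nearest j')) :=
    Measure.isProbabilityMeasure_map hj'.aemeasurable
  have hgen : MeasurableSpace.generateFrom (Set.range (Set.Ici : ℝ≥0∞ → Set ℝ≥0∞)) =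
      (inferInstance : MeasurableSpace ℝ≥0∞) := by
    rw [BorelSpace.measurable_eq (α := ℝ≥0∞), borel_eq_generateFrom_Ici]
  have hspan : ∀ ν : Measure ℝ≥0∞, IsProbabilityMeasure ν →
      Nonempty (ν.FiniteSpanningSetsIn (Set.range (Set.Ici : ℝ≥0∞ → Set ℝ≥0∞))) := fun ν hν =>
    ⟨⟨fun _ => Set.univ, fun _ => ⟨0, by ext; simp⟩, fun _ => by simp, Set.iUnion_const _⟩⟩
  refine (Measure.prod_eq_generateFrom hgen hgen isPiSystem_Ici isPiSystem_Ici
    (hspan _ hp).some (hspan _ hp').some ?_).symm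
  rintro _ ⟨s, rfl⟩ _ ⟨s', rfl⟩
  rw [Measure.map_apply (hj.prodMk hj') (measurableSet_Ici.prod measurableSet_Ici),
    Measure.map_apply hj measurableSet_Ici, Measure.map_apply hj' measurableSet_Ici]
  exact (N.measure_le_nearest_and h s s').trans (congrArg₂ _ (N.measure_le_nearest_single j s).symm
    (N.measure_le_nearest_single j' s').symm)

end Network

namespace Params

variable (P : Params)

/-- `P.meanCloser`, by an explicit formula. -/
def meanCount (j : LinkState) (r : ℝ) : ℝ :=
  match j with
  | .los => P.lamB * Real.pi * (P.C * min r P.D ^ 2)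
  | .nlos => P.lamB * Real.pi * (r ^ 2 - P.C * min r P.D ^ 2)

lemma meanCount_nonneg (j : LinkState) {r : ℝ} (hr : 0 ≤ r) : 0 ≤ P.meanCount j r := by
  have h1 := P.lamB_pos
  have h2 := P.C_nonneg
  have h3 := P.C_le_one
  have h4 := P.D_pos
  have h5 := Real.pi_pos
  cases j
  · unfold meanCount; positivity
  · refine mul_nonneg (by positivity) ?_
    have h6 : 0 ≤ min r P.D := le_min hr h4.le
    have h7 : min r P.D ^ 2 ≤ r ^ 2 := pow_le_pow_left₀ h6 (min_le_left _ _) 2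
    nlinarith [sq_nonneg (min r P.D)]

lemma meanCloser_add (r : ℝ) (hr : 0 ≤ r) :
    P.meanCloser .los (ENNReal.ofReal r) + P.meanCloser .nlos (ENNReal.ofReal r) =
      ENNReal.ofReal (P.lamB * Real.pi * r ^ 2) := by
  classical
  unfold meanCloser
  rw [← mul_add, ← lintegral_add_left]
  · have : ∀ y : Plane, ENNReal.ofReal (P.stateProb .los ‖y‖) *
        (if ENNReal.ofReal ‖y‖ < ENNReal.ofReal r then 1 else 0) +
        ENNReal.ofReal (P.stateProb .nlos ‖y‖) *
        (if ENNReal.ofReal ‖y‖ < ENNReal.ofReal r then 1 else 0) =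
        (Metric.ball (0 : Plane) r).indicator 1 y := fun y => by
      rw [← add_mul, ← ENNReal.ofReal_add (P.stateProb_nonneg _ _) (P.stateProb_nonneg _ _),
        sum_stateProb, ENNReal.ofReal_one, one_mul, Set.indicator_apply]
      simp only [mem_ball_zero_iff, ENNReal.ofReal_lt_ofReal_iff_of_nonneg (norm_nonneg y),
        Pi.one_apply]
    simp only [this]
    rw [lintegral_indicator_one measurableSet_ball, volume_ball_zero hr,
      ← ENNReal.ofReal_mul P.lamB_pos.le, mul_assoc]
  · refine (((P.measurable_stateProb .los).comp measurable_norm).ennreal_ofReal).mul ?_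
    exact Measurable.ite (measurableSet_lt measurable_norm.ennreal_ofReal measurable_const)
      measurable_const measurable_const

/-- The LOS mean is `C` times the mean count in the smaller of the two discs of radii `r` and `D`;
the NLOS mean follows by subtraction from the full disc. -/
lemma meanCloser_ofReal (j : LinkState) {r : ℝ} (hr : 0 ≤ r) :
    P.meanCloser j (ENNReal.ofReal r) = ENNReal.ofReal (P.meanCount j r) := by
  classical
  have hlos : P.meanCloser .los (ENNReal.ofReal r) = ENNReal.ofReal (P.meanCount .los r) := by
    unfold meanCloser
    have hm0 : 0 ≤ min r P.D := le_min hr P.D_pos.le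
    have : ∀ᵐ y : Plane, ENNReal.ofReal (P.stateProb .los ‖y‖) *
        (if ENNReal.ofReal ‖y‖ < ENNReal.ofReal r then 1 else 0) =
        (Metric.ball (0 : Plane) (min r P.D)).indicator (fun _ => ENNReal.ofReal P.C) y := by
      -- The blockage model uses `≤ D` while open balls use `< D`; the circle in between is null.
      have hs : volume (Metric.sphere (0 : Plane) P.D) = 0 := Measure.addHaar_sphere _ _ _
      filter_upwards [compl_mem_ae_iff.2 hs] with y hy
      have hy' : ‖y‖ ≠ P.D := by simpa using hy
      have hle : ‖y‖ ≤ P.D ↔ ‖y‖ < P.D := ⟨fun h => lt_of_le_of_ne h hy', le_of_lt⟩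
      rw [Set.indicator_apply]
      simp only [mem_ball_zero_iff, ENNReal.ofReal_lt_ofReal_iff_of_nonneg (norm_nonneg y),
        stateProb, hle, lt_min_iff]
      by_cases h1 : ‖y‖ < r <;> by_cases h2 : ‖y‖ < P.D <;> simp [h1, h2]
    rw [lintegral_congr_ae this, lintegral_indicator_const measurableSet_ball, volume_ball_zero hm0,
      ← ENNReal.ofReal_mul P.C_nonneg, ← ENNReal.ofReal_mul P.lamB_pos.le]
    congr 1
    simp only [meanCount]; ring
  cases j
  · exact hlos
  · have h := P.meanCloser_add r hr
    rw [hlos] at h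
    have e : P.lamB * Real.pi * r ^ 2 = P.meanCount .los r + P.meanCount .nlos r := by
      simp only [meanCount]; ring
    rw [e, ENNReal.ofReal_add (P.meanCount_nonneg _ hr) (P.meanCount_nonneg _ hr)] at h
    exact (ENNReal.add_right_inj ENNReal.ofReal_ne_top).1 h

lemma negExp_meanCloser (j : LinkState) {r : ℝ} (hr : 0 ≤ r) :
    negExp (P.meanCloser j (ENNReal.ofReal r)) = ENNReal.ofReal (Real.exp (-P.meanCount j r)) := by
  rw [P.meanCloser_ofReal j hr, negExp_ofReal (P.meanCount_nonneg j hr)]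

/-- The density of the distance to the nearest base station in state `j`. -/
def nearestDensity (j : LinkState) (r : ℝ) : ℝ :=
  2 * Real.pi * P.lamB * r * P.stateProb j r * Real.exp (-P.meanCount j r)

lemma nearestDensity_nonneg (j : LinkState) {r : ℝ} (hr : 0 ≤ r) : 0 ≤ P.nearestDensity j r := by
  have h1 := P.lamB_pos
  have h2 := P.stateProb_nonneg j r
  have h5 := Real.pi_pos
  unfold nearestDensity; positivity

lemma continuous_meanCount (j : LinkState) : Continuous (P.meanCount j) := by
  cases j <;> (unfold meanCount; fun_prop)

lemma measurable_nearestDensity (j : LinkState) : Measurable (P.nearestDensity j) := by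
  have h1 := P.measurable_stateProb j
  have h2 := (P.continuous_meanCount j).measurable
  unfold nearestDensity; fun_prop

lemma hasDerivAt_meanCount (j : LinkState) {r : ℝ} (hr : r ≠ P.D) :
    HasDerivAt (P.meanCount j) (2 * Real.pi * P.lamB * r * P.stateProb j r) r := by
  have hmin : HasDerivAt (fun r => P.C * min r P.D ^ 2) (2 * r * if r ≤ P.D then P.C else 0) r := by
    rcases lt_or_gt_of_ne hr with h | h
    · rw [if_pos h.le]
      have h' : HasDerivAt (fun r : ℝ => P.C * r ^ 2) (2 * r * P.C) r := by
        have := (hasDerivAt_pow 2 r).const_mul P.C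
        refine this.congr_deriv ?_
        norm_num; ring
      refine h'.congr_of_eventuallyEq ?_
      filter_upwards [Iio_mem_nhds h] with s hs
      rw [min_eq_left (le_of_lt hs)]
    · rw [if_neg (not_le.2 h), mul_zero]
      refine (hasDerivAt_const r (P.C * P.D ^ 2)).congr_of_eventuallyEq ?_
      filter_upwards [Ioi_mem_nhds h] with s hs
      rw [min_eq_right (le_of_lt hs)]
  cases j
  · refine (hmin.const_mul (P.lamB * Real.pi)).congr_deriv ?_
    simp only [stateProb]; ring
  · have h2 : HasDerivAt (fun r : ℝ => r ^ 2) (2 * r) r := by simpa using hasDerivAt_pow 2 r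
    refine ((h2.sub hmin).const_mul (P.lamB * Real.pi)).congr_deriv ?_
    simp only [stateProb]; ring

lemma intervalIntegrable_nearestDensity (j : LinkState) (a b : ℝ) :
    IntervalIntegrable (P.nearestDensity j) volume a b := by
  have h1 : IntervalIntegrable (P.stateProb j) volume a b := by
    rw [intervalIntegrable_iff]
    refine Measure.integrableOn_of_bounded (M := 1) (by simp [Set.uIoc])
      (P.measurable_stateProb j).aestronglyMeasurable (Eventually.of_forall fun r => ?_)
    rw [Real.norm_of_nonneg (P.stateProb_nonneg j r)]
    have h := P.sum_stateProb r
    have h1 := P.stateProb_nonneg .los r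
    have h2 := P.stateProb_nonneg .nlos r
    cases j <;> linarith
  have h2 := P.continuous_meanCount j
  have h3 : Continuous fun r => 2 * Real.pi * P.lamB * r * Real.exp (-P.meanCount j r) := by
    fun_prop
  refine (h1.continuousOn_mul h3.continuousOn).congr fun r _ => ?_
  simp only [nearestDensity]; ring

/-- The density is the derivative of `-exp (-meanCount)` except at `D`, where the state
probabilities may jump; one exceptional point is harmless for the fundamental theorem of calculus.
-/
lemma lintegral_nearestDensity (j : LinkState) {a b : ℝ} (ha : 0 ≤ a) (hab : a ≤ b) :
    ∫⁻ r in Set.Ioc a b, ENNReal.ofReal (P.nearestDensity j r) =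
      ENNReal.ofReal (Real.exp (-P.meanCount j a)) - ENNReal.ofReal (Real.exp (-P.meanCount j b)) := by
  have hi := P.intervalIntegrable_nearestDensity j a b
  have hc := P.continuous_meanCount j
  have hftc := integral_eq_of_hasDerivAt_off_countable_of_le
    (fun r => -Real.exp (-P.meanCount j r)) (P.nearestDensity j) hab (Set.countable_singleton P.D)
    (by fun_prop) (fun r hr => by
      have hr' : r ≠ P.D := fun h => hr.2 (by simp [h])
      refine ((P.hasDerivAt_meanCount j hr').neg.exp.neg).congr_deriv ?_
      simp only [nearestDensity, Pi.neg_apply]; ring) hi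
  rw [intervalIntegral.integral_of_le hab] at hftc
  rw [← ofReal_integral_eq_lintegral_ofReal
    ((intervalIntegrable_iff_integrableOn_Ioc_of_le hab).1 hi)
    ((ae_restrict_mem measurableSet_Ioc).mono fun r hr =>
      P.nearestDensity_nonneg j (ha.trans hr.1.le)), hftc,
    ← ENNReal.ofReal_sub _ (Real.exp_pos _).le]
  congr 1; ring

end Params

namespace Network

variable {P : Params} {Ω : Type*} [MeasurableSpace Ω] {μ : Measure Ω} [IsProbabilityMeasure μ]

/-- The value `⊤` must be removed: with positive probability there may be no LOS station at all. On
the finite part the two measures agree on intervals, by differences of tails. -/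
lemma map_toReal_nearest (N : Network P μ) (j : LinkState) :
    (((μ.map (N.nearest j)).restrict {⊤}ᶜ).map ENNReal.toReal) =
      (volume.restrict (Set.Ioi 0)).withDensity fun r => ENNReal.ofReal (P.nearestDensity j r) := by
  have hm := N.measurable_nearest j
  have hprob : IsProbabilityMeasure (μ.map (N.nearest j)) :=
    Measure.isProbabilityMeasure_map hm.aemeasurable
  have hmt : MeasurableSet ({⊤}ᶜ : Set ℝ≥0∞) := (measurableSet_singleton _).compl
  refine Measure.ext_of_Ico _ _ fun a b hab => ?_
  rw [Measure.map_apply ENNReal.measurable_toReal measurableSet_Ico,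
    Measure.restrict_apply (ENNReal.measurable_toReal measurableSet_Ico),
    withDensity_apply _ measurableSet_Ico, Measure.restrict_restrict measurableSet_Ico]
  rcases le_or_gt b 0 with hb | hb
  · have e1 : ENNReal.toReal ⁻¹' Set.Ico a b ∩ {⊤}ᶜ = ∅ := by
      ext s
      simp only [Set.mem_inter_iff, Set.mem_preimage, Set.mem_Ico, Set.mem_empty_iff_false,
        iff_false]
      rintro ⟨⟨-, h⟩, -⟩
      exact absurd h (not_lt.2 (hb.trans ENNReal.toReal_nonneg))
    have e2 : Set.Ico a b ∩ Set.Ioi 0 = ∅ := by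
      ext r
      simp only [Set.mem_inter_iff, Set.mem_Ico, Set.mem_Ioi, Set.mem_empty_iff_false, iff_false]
      rintro ⟨⟨-, h⟩, h'⟩
      linarith
    rw [e1, e2]; simp
  · have ha' : 0 ≤ max a 0 := le_max_right _ _
    have hab' : max a 0 ≤ b := max_le hab.le hb.le
    have e1 : ENNReal.toReal ⁻¹' Set.Ico a b ∩ {⊤}ᶜ =
        Set.Ici (ENNReal.ofReal (max a 0)) \ Set.Ici (ENNReal.ofReal b) := by
      ext s
      simp only [Set.mem_inter_iff, Set.mem_preimage, Set.mem_Ico, Set.mem_compl_iff,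
        Set.mem_singleton_iff, Set.mem_sdiff, Set.mem_Ici, not_le]
      constructor
      · rintro ⟨⟨h1, h2⟩, h3⟩
        exact ⟨ENNReal.ofReal_le_of_le_toReal (max_le h1 ENNReal.toReal_nonneg),
          (ENNReal.lt_ofReal_iff_toReal_lt h3).2 h2⟩
      · rintro ⟨h1, h2⟩
        have h3 : s ≠ ⊤ := (h2.trans ENNReal.ofReal_lt_top).ne
        exact ⟨⟨(le_max_left _ _).trans ((ENNReal.ofReal_le_iff_le_toReal h3).1 h1),
          (ENNReal.lt_ofReal_iff_toReal_lt h3).1 h2⟩, h3⟩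
    have hI : ∀ r : ℝ, 0 ≤ r → (μ.map (N.nearest j)) (Set.Ici (ENNReal.ofReal r)) =
        ENNReal.ofReal (Real.exp (-P.meanCount j r)) := fun r hr => by
      rw [Measure.map_apply hm measurableSet_Ici, ← P.negExp_meanCloser j hr]
      exact N.measure_le_nearest_single j _
    rw [e1, measure_sdiff (Set.Ici_subset_Ici.2 (ENNReal.ofReal_le_ofReal hab'))
      measurableSet_Ici.nullMeasurableSet (measure_ne_top _ _), hI _ ha', hI _ hb.le,
      ← P.lintegral_nearestDensity j ha' hab']
    refine setLIntegral_congr ?_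
    refine Ioo_ae_eq_Ioc.symm.trans ?_
    have e2 : (Set.Ico a b ∩ Set.Ioi 0 : Set ℝ) =ᵐ[volume] (Set.Ioo a b ∩ Set.Ioi 0 : Set ℝ) :=
      Ioo_ae_eq_Ico.symm.inter (Filter.EventuallyEq.rfl)
    have e3 : Set.Ioo (max a 0) b = Set.Ioo a b ∩ Set.Ioi 0 := by
      ext r
      simp only [Set.mem_Ioo, Set.mem_inter_iff, Set.mem_Ioi, max_lt_iff]
      tauto
    rw [e3]
    exact e2.symm

lemma lintegral_nearest (N : Network P μ) (j : LinkState) {f : ℝ → ℝ≥0∞} (hf : Measurable f) :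
    ∫⁻ s in {⊤}ᶜ, f s.toReal ∂(μ.map (N.nearest j)) =
      ∫⁻ r in Set.Ioi 0, ENNReal.ofReal (P.nearestDensity j r) * f r := by
  rw [← lintegral_map hf ENNReal.measurable_toReal, N.map_toReal_nearest j,
    lintegral_withDensity_eq_lintegral_mul _ (P.measurable_nearestDensity j).ennreal_ofReal hf]
  rfl

end Network

/-! ### Equivalent lengths and the serving station -/

namespace Params

variable (P : Params)

/-- The length at which a link in state `j'` has the same path loss as a link of length `r` in
state `j`. -/
def equivLength (j j' : LinkState) (r : ℝ) : ℝ :=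
  (P.pl j' / P.pl j) ^ (1 / P.alpha j') * r ^ (P.alpha j / P.alpha j')

lemma equivLength_pos (j j' : LinkState) {r : ℝ} (hr : 0 < r) : 0 < P.equivLength j j' r := by
  have h1 := P.pl_pos j
  have h2 := P.pl_pos j'
  unfold equivLength; positivity

lemma measurable_equivLength (j j' : LinkState) : Measurable (P.equivLength j j') := by
  unfold equivLength; fun_prop

lemma equivLength_self (j : LinkState) (r : ℝ) : P.equivLength j j r = r := by
  rw [equivLength, div_self (P.pl_pos j).ne', div_self (P.alpha_pos j).ne', Real.one_rpow,
    Real.rpow_one, one_mul]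

lemma equivLength_rpow (j j' : LinkState) {r : ℝ} (hr : 0 < r) :
    P.equivLength j j' r ^ P.alpha j' = P.pl j' / P.pl j * r ^ P.alpha j := by
  have h1 := P.pl_pos j
  have h2 := P.pl_pos j'
  have h3 := P.alpha_pos j'
  rw [equivLength, Real.mul_rpow (by positivity) (by positivity), ← Real.rpow_mul (by positivity),
    ← Real.rpow_mul hr.le, one_div_mul_cancel h3.ne', div_mul_cancel₀ _ h3.ne', Real.rpow_one]

lemma pathLoss_le_iff (j j' : LinkState) {r d : ℝ} (hr : 0 < r) (hd : 0 < d) :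
    P.pathLoss j' d ≤ P.pathLoss j r ↔ P.equivLength j j' r ≤ d := by
  have h1 := P.pl_pos j
  have h2 := P.pl_pos j'
  rw [← Real.rpow_le_rpow_iff (P.equivLength_pos j j' hr).le hd.le (P.alpha_pos j'),
    P.equivLength_rpow j j' hr, pathLoss, pathLoss, Real.rpow_neg hd.le, Real.rpow_neg hr.le,
    ← div_eq_mul_inv, ← div_eq_mul_inv, div_le_div_iff₀ (by positivity) (by positivity),
    div_mul_eq_mul_div, div_le_iff₀ h1]
  constructor <;> intro h <;> linarith

lemma pathLoss_equivLength (j j' : LinkState) {r : ℝ} (hr : 0 < r) :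
    P.pathLoss j' (P.equivLength j j' r) = P.pathLoss j r := by
  have he := P.equivLength_pos j j' hr
  refine le_antisymm ((P.pathLoss_le_iff j j' hr he).2 le_rfl) ?_
  rw [P.pathLoss_le_iff j' j he hr,
    ← Real.rpow_le_rpow_iff (P.equivLength_pos j' j he).le hr.le (P.alpha_pos j),
    P.equivLength_rpow j' j he, P.equivLength_rpow j j' hr, ← mul_assoc,
    div_mul_div_cancel₀ (P.pl_pos j').ne', div_self (P.pl_pos j).ne', one_mul]

/-- Both inequalities compare the same two path losses, since passing to the equivalent length
preserves the loss. -/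
lemma le_equivLength_iff (j j' : LinkState) {r d : ℝ} (hr : 0 < r) (hd : 0 < d) :
    d ≤ P.equivLength j j' r ↔ P.equivLength j' j d ≤ r := by
  rw [← P.pathLoss_le_iff j' j hd hr, ← P.pathLoss_equivLength j j' hr,
    P.pathLoss_le_iff j' j' hd (P.equivLength_pos j j' hr), P.equivLength_self]

lemma equivLength_eq_of_pathLoss_eq (j j' : LinkState) {r d : ℝ} (hr : 0 < r) (hd : 0 < d)
    (h : P.pathLoss j' d = P.pathLoss j r) : P.equivLength j j' r = d :=
  le_antisymm ((P.pathLoss_le_iff j j' hr hd).1 h.le)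
    ((P.le_equivLength_iff j j' hr hd).2 ((P.pathLoss_le_iff j' j hd hr).1 h.ge))

end Params

namespace Network

variable {P : Params} {Ω : Type*} [MeasurableSpace Ω] {μ : Measure Ω}

/-- Path loss decreases with length within each state, so only the nearest competitor in each state
matters. Positive distances are needed because the real power gives the path loss at distance `0`
the value `0`. -/
lemma isServing_iff (N : Network P μ) {ω : Ω} (hω : ∀ k, 0 < ‖N.bs k ω‖) {i : ℕ} {j : LinkState}
    (hi : (N.channel (i, none) ω).1 = j) :
    N.IsServing i ω ↔ ∀ j', ENNReal.ofReal (P.equivLength j j' ‖N.bs i ω‖) ≤ N.nearest j' ω := by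
  have h : ∀ k, (N.linkLoss (k, none) ω ≤ N.linkLoss (i, none) ω ↔
      ENNReal.ofReal (P.equivLength j (N.channel (k, none) ω).1 ‖N.bs i ω‖) ≤
        ENNReal.ofReal ‖N.bs k ω‖) := fun k => by
    simp only [linkLoss, linkLength, receiver, loc, dist_zero_right]
    rw [ENNReal.ofReal_le_ofReal_iff (hω k).le, hi]
    exact P.pathLoss_le_iff _ _ (hω i) (hω k)
  simp only [IsServing, h, le_nearest_iff]
  exact ⟨fun h j' k hk => hk ▸ h k, fun h k => h _ k rfl⟩

lemma ofReal_norm_eq_nearest (N : Network P μ) {ω : Ω} (hω : ∀ k, 0 < ‖N.bs k ω‖) {i : ℕ}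
    {j : LinkState} (hi : (N.channel (i, none) ω).1 = j) (hs : N.IsServing i ω) :
    ENNReal.ofReal ‖N.bs i ω‖ = N.nearest j ω := by
  refine le_antisymm ?_ ((N.le_nearest_iff j ω _).1 le_rfl i hi)
  simpa only [P.equivLength_self] using (N.isServing_iff hω hi).1 hs j

/-- Local finiteness makes the infimum a minimum: only the finitely many stations in a ball around
the origin compete. -/
lemma exists_nearest (N : Network P μ) {ω : Ω}
    (hfin : ∀ n : ℕ, {k | N.bs k ω ∈ Metric.ball (0 : Plane) n}.Finite) {j : LinkState}
    (h : N.nearest j ω ≠ ⊤) :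
    ∃ i, (N.channel (i, none) ω).1 = j ∧ ENNReal.ofReal ‖N.bs i ω‖ = N.nearest j ω := by
  have h0 : ∃ k, (N.channel (k, none) ω).1 = j := by
    by_contra! hne
    exact h (top_le_iff.1 ((N.le_nearest_iff j ω ⊤).2 fun k hk => absurd hk (hne k)))
  obtain ⟨k, hk⟩ := h0
  obtain ⟨n, hn⟩ := exists_nat_gt ‖N.bs k ω‖
  obtain ⟨i, ⟨hi1, hi2⟩, hmin⟩ := Set.exists_min_image
    ({k | N.bs k ω ∈ Metric.ball (0 : Plane) n} ∩ {k | (N.channel (k, none) ω).1 = j})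
    (fun k => ‖N.bs k ω‖) ((hfin n).inter_of_left _) ⟨k, by simpa using hn, hk⟩
  simp only [Set.mem_ofPred_eq, mem_ball_zero_iff] at hi1 hi2
  refine ⟨i, hi2, le_antisymm ((N.le_nearest_iff j ω _).2 fun l hl => ?_)
    ((N.le_nearest_iff j ω _).1 le_rfl i hi2)⟩
  refine ENNReal.ofReal_le_ofReal ?_
  rcases lt_or_ge ‖N.bs l ω‖ n with hl' | hl'
  · exact hmin l ⟨by simpa using hl', hl⟩
  · exact hi1.le.trans hl'

lemma ae_norm_pos (N : Network P μ) : ∀ᵐ ω ∂μ, ∀ k, 0 < ‖N.bs k ω‖ := by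
  filter_upwards [N.bs_ppp.ae_notMem (measurableSet_singleton 0) (by simp)] with ω hω k
  exact norm_pos_iff.2 fun h => hω k h

lemma ae_finite_ball (N : Network P μ) :
    ∀ᵐ ω ∂μ, ∀ n : ℕ, {k | N.bs k ω ∈ Metric.ball (0 : Plane) n}.Finite :=
  ae_all_iff.2 fun _ => N.bs_ppp.ae_finite measurableSet_ball measure_ball_lt_top.ne

open Classical in
/-- If there is a serving base station with a link in state `j`, then it is the nearest one with a
link in that state. -/
lemma tsum_serving (N : Network P μ) {j j' : LinkState} (hj : j ≠ j') {ω : Ω}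
    (hω : ∀ k, 0 < ‖N.bs k ω‖)
    (hfin : ∀ n : ℕ, {k | N.bs k ω ∈ Metric.ball (0 : Plane) n}.Finite)
    (hinj : ∀ i k, ‖N.bs i ω‖ = ‖N.bs k ω‖ → i = k) (φ : ℝ → ℝ≥0∞) :
    ∑' i, (if (N.channel (i, none) ω).1 = j ∧ N.IsServing i ω then φ ‖N.bs i ω‖ else 0) =
      if N.nearest j ω ≠ ⊤ ∧
        ENNReal.ofReal (P.equivLength j j' (N.nearest j ω).toReal) ≤ N.nearest j' ω
      then φ (N.nearest j ω).toReal else 0 := by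
  by_cases ht : N.nearest j ω = ⊤
  · rw [if_neg (by simp [ht])]
    refine ENNReal.tsum_eq_zero.2 fun i => if_neg fun h => ?_
    exact ENNReal.ofReal_ne_top ((N.ofReal_norm_eq_nearest hω h.1 h.2).trans ht)
  obtain ⟨i, hi, hn⟩ := N.exists_nearest hfin ht
  have hn' : (N.nearest j ω).toReal = ‖N.bs i ω‖ := by
    rw [← hn, ENNReal.toReal_ofReal (norm_nonneg _)]
  -- Any station serving in state `j` is at the nearest distance for that state, and distinct
  -- stations have distinct norms.
  rw [tsum_eq_single i fun k hk => if_neg fun h => hk <| hinj _ _ ?_]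
  · rw [hn']
    refine if_congr ?_ rfl rfl
    rw [N.isServing_iff hω hi]
    constructor
    · exact fun h => ⟨ht, h.2 j'⟩
    · refine fun h => ⟨hi, fun l => ?_⟩
      by_cases hl : l = j
      · rw [hl, P.equivLength_self, hn]
      · have : l = j' := by cases l <;> cases j <;> cases j' <;> simp_all
        rw [this]; exact h.2
  · have := N.ofReal_norm_eq_nearest hω h.1 h.2
    rwa [← hn, ENNReal.ofReal_eq_ofReal_iff (norm_nonneg _) (norm_nonneg _)] at this

lemma measurable_linkLoss (N : Network P μ) (l : Link) : Measurable (N.linkLoss l) := by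
  have h1 := N.bs_ppp.measurable
  have h2 := N.eve_ppp.measurable
  have h3 := N.channel_measurable
  exact measurable_pathLoss_link P (x := N.loc) (c := fun ω l => N.channel l ω)
    (by unfold loc; fun_prop) (by fun_prop) l

lemma measurableSet_isServing (N : Network P μ) (i : ℕ) (j : LinkState) :
    MeasurableSet {ω | (N.channel (i, none) ω).1 = j ∧ N.IsServing i ω} := by
  rw [Set.ofPred_and]
  refine ((N.channel_measurable (i, none)).fst (MeasurableSet.of_discrete (s := {j}))).inter ?_
  unfold IsServing
  rw [Set.ofPred_forall]
  exact MeasurableSet.iInter fun k => measurableSet_le (N.measurable_linkLoss _)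
    (N.measurable_linkLoss _)

/-- Base station `i` serves the user through a link in state `j`, and the connection is secure. -/
def secureVia (N : Network P μ) (p : LinkState × ℕ) : Set Ω :=
  {ω | ((N.channel (p.2, none) ω).1 = p.1 ∧ N.IsServing p.2 ω) ∧
    0 < N.userStrength p.2 ω ∧ ∀ k, N.eveStrength p.2 k ω ≤ N.userStrength p.2 ω}

lemma measurableSet_secureVia (N : Network P μ) (p : LinkState × ℕ) :
    MeasurableSet (N.secureVia p) := by
  have hu : Measurable (N.userStrength p.2) :=
    ((N.measurable_linkLoss _).const_mul _).mul (N.channel_measurable _).snd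
  have he : ∀ k, Measurable (N.eveStrength p.2 k) := fun k =>
    ((P.measurable_arrayGain.comp (N.angle_measurable _)).mul (N.measurable_linkLoss _)).mul
      (N.channel_measurable _).snd
  unfold secureVia
  have h := N.measurableSet_isServing p.2 p.1
  rw [Set.ofPred_and] at h
  simp only [Set.ofPred_and, Set.ofPred_forall]
  exact h.inter ((measurableSet_lt measurable_const hu).inter
    (MeasurableSet.iInter fun k => measurableSet_le (he k) hu))

/-- In `ℝ≥0∞` one has `0 / 0 = 0`, while a positive number over `0` is `⊤`. Hence positivity of `u`
is a separate requirement, and a vanishing denominator is then no obstacle. -/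
lemma one_le_ofReal_div_iSup {u : ℝ} {e : ℕ → ℝ} :
    1 ≤ ENNReal.ofReal u / ⨆ k, ENNReal.ofReal (e k) ↔ 0 < u ∧ ∀ k, e k ≤ u := by
  rcases le_or_gt u 0 with hu | hu
  · simp [ENNReal.ofReal_eq_zero.2 hu, not_lt.2 hu]
  · have h0 : ENNReal.ofReal u ≠ 0 := (ENNReal.ofReal_pos.2 hu).ne'
    rw [ENNReal.le_div_iff_mul_le (Or.inr h0) (Or.inr ENNReal.ofReal_ne_top), one_mul, iSup_le_iff]
    simp only [ENNReal.ofReal_le_ofReal_iff hu.le, hu, true_and]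

lemma secureEvent_eq (N : Network P μ) : N.secureEvent = ⋃ p, N.secureVia p := by
  ext ω
  simp only [secureEvent, secureVia, one_le_ofReal_div_iSup, Set.mem_iUnion, Set.mem_ofPred_eq,
    Prod.exists]
  constructor
  · rintro ⟨i, h1, h2⟩
    exact ⟨_, i, ⟨rfl, h1⟩, h2⟩
  · rintro ⟨_, i, ⟨-, h1⟩, h2⟩
    exact ⟨i, h1, h2⟩

variable [IsProbabilityMeasure μ]

lemma map_nearest_singleton (N : Network P μ) (j : LinkState) {s : ℝ≥0∞} (hs : s ≠ ⊤) :
    μ.map (N.nearest j) {s} = 0 := by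
  have h := N.lintegral_nearest j (f := ({s.toReal} : Set ℝ).indicator 1)
    (measurable_const.indicator (measurableSet_singleton _))
  have h0 : ∫⁻ r in Set.Ioi 0, ENNReal.ofReal (P.nearestDensity j r) *
      ({s.toReal} : Set ℝ).indicator 1 r = 0 := by
    rw [lintegral_eq_zero_iff' (by
      have := P.measurable_nearestDensity j
      exact (this.ennreal_ofReal.mul
        (measurable_const.indicator (measurableSet_singleton _))).aemeasurable)]
    have hne : ∀ᵐ r : ℝ ∂volume, r ≠ s.toReal := by simp [ae_iff]
    filter_upwards [ae_restrict_of_ae hne] with r hr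
    simp [hr]
  rw [h0, ← lintegral_indicator (measurableSet_singleton _).compl] at h
  have h1 : ∫⁻ x, ({s} : Set ℝ≥0∞).indicator 1 x ∂(μ.map (N.nearest j)) ≤ 0 := by
    rw [← h]
    refine lintegral_mono fun x => ?_
    by_cases hx : x = s
    · subst hx; simp [hs]
    · simp [hx]
  rw [lintegral_indicator_one (measurableSet_singleton _)] at h1
  exact le_antisymm h1 bot_le

/-- By independence, the distance in state `j'` is integrated first and contributes its tail at the
equivalent length; the finite part of the distance in state `j` then has a density. -/
lemma lintegral_nearest_equivLength (N : Network P μ) {j j' : LinkState} (hj : j ≠ j')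
    {φ : ℝ → ℝ≥0∞} (hφ : Measurable φ) :
    ∫⁻ ω, (if N.nearest j ω ≠ ⊤ ∧
        ENNReal.ofReal (P.equivLength j j' (N.nearest j ω).toReal) ≤ N.nearest j' ω
      then φ (N.nearest j ω).toReal else 0) ∂μ =
      ∫⁻ r in Set.Ioi 0, ENNReal.ofReal (P.nearestDensity j r) *
        (φ r * ENNReal.ofReal (Real.exp (-P.meanCount j' (P.equivLength j j' r)))) := by
  have hm := N.measurable_nearest j
  have hm' := N.measurable_nearest j'
  have hp : IsProbabilityMeasure (μ.map (N.nearest j')) :=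
    Measure.isProbabilityMeasure_map hm'.aemeasurable
  have hp' : IsProbabilityMeasure (μ.map (N.nearest j)) :=
    Measure.isProbabilityMeasure_map hm.aemeasurable
  have hel := P.measurable_equivLength j j'
  have hset : MeasurableSet {q : ℝ≥0∞ × ℝ≥0∞ | q.1 ≠ ⊤ ∧
      ENNReal.ofReal (P.equivLength j j' q.1.toReal) ≤ q.2} := by
    rw [Set.ofPred_and]
    refine MeasurableSet.inter ?_ (measurableSet_le (by fun_prop) measurable_snd)
    exact measurable_fst (measurableSet_singleton ⊤).compl
  have hG : Measurable fun q : ℝ≥0∞ × ℝ≥0∞ => if q.1 ≠ ⊤ ∧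
      ENNReal.ofReal (P.equivLength j j' q.1.toReal) ≤ q.2 then φ q.1.toReal else 0 :=
    Measurable.ite hset (by fun_prop) measurable_const
  have h1 := lintegral_map (μ := μ) hG (hm.prodMk hm')
  rw [N.map_nearest_prod hj, lintegral_prod _ hG.aemeasurable] at h1
  have hmc := (P.continuous_meanCount j').measurable
  rw [← h1, ← N.lintegral_nearest j (f := fun r =>
    φ r * ENNReal.ofReal (Real.exp (-P.meanCount j' (P.equivLength j j' r)))) (by fun_prop), ← lintegral_indicator (measurableSet_singleton _).compl]
  refine lintegral_congr fun a => ?_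
  by_cases ha : a = ⊤
  · simp [ha]
  · rw [Set.indicator_of_mem (by simpa using ha)]
    have h2 : ∀ b, (if a ≠ ⊤ ∧ ENNReal.ofReal (P.equivLength j j' a.toReal) ≤ b
        then φ a.toReal else 0) =
        (Set.Ici (ENNReal.ofReal (P.equivLength j j' a.toReal))).indicator
          (fun _ => φ a.toReal) b := fun b => by
      simp [Set.indicator_apply, ha]
    have h0 : 0 ≤ P.equivLength j j' a.toReal := by
      have h1 := P.pl_pos j
      have h2 := P.pl_pos j'
      have h3 : 0 ≤ a.toReal := ENNReal.toReal_nonneg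
      unfold Params.equivLength; positivity
    simp only [h2]
    rw [lintegral_indicator measurableSet_Ici, setLIntegral_const,
      Measure.map_apply hm' measurableSet_Ici]
    congr 1
    exact (N.measure_le_nearest_single j' _).trans (P.negExp_meanCloser j' h0)

/-- The nearest distance in state `j'` is independent of the other one and has no finite atom, so it
misses a finite value determined by the other distance. -/
lemma ae_nearest_ne_equivLength (N : Network P μ) {j j' : LinkState} (hj : j ≠ j') :
    ∀ᵐ ω ∂μ, N.nearest j' ω ≠ ENNReal.ofReal (P.equivLength j j' (N.nearest j ω).toReal) := by
  have hm := N.measurable_nearest j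
  have hm' := N.measurable_nearest j'
  have hp : IsProbabilityMeasure (μ.map (N.nearest j')) :=
    Measure.isProbabilityMeasure_map hm'.aemeasurable
  have hel := P.measurable_equivLength j j'
  have hset : MeasurableSet {q : ℝ≥0∞ × ℝ≥0∞ |
      q.2 = ENNReal.ofReal (P.equivLength j j' q.1.toReal)} :=
    measurableSet_eq_fun measurable_snd (by fun_prop)
  have h : μ.map (fun ω => (N.nearest j ω, N.nearest j' ω)) {q : ℝ≥0∞ × ℝ≥0∞ |
      q.2 = ENNReal.ofReal (P.equivLength j j' q.1.toReal)} = 0 := by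
    rw [N.map_nearest_prod hj, Measure.prod_apply hset]
    refine (lintegral_congr fun a => ?_).trans lintegral_zero
    refine (congrArg _ ?_).trans (N.map_nearest_singleton j'
      (s := ENNReal.ofReal (P.equivLength j j' a.toReal)) ENNReal.ofReal_ne_top)
    ext b; simp
  rw [Measure.map_apply (hm.prodMk hm') hset] at h
  rw [ae_iff]
  simpa using h

/-- The serving base station is almost surely unique. -/
lemma ae_isServing_unique (N : Network P μ) :
    ∀ᵐ ω ∂μ, ∀ i k, N.IsServing i ω → N.IsServing k ω → i = k := by
  filter_upwards [N.ae_norm_pos, N.bs_ppp.ae_norm_injective,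
    N.ae_nearest_ne_equivLength (j := .los) (j' := .nlos) (by decide),
    N.ae_nearest_ne_equivLength (j := .nlos) (j' := .los) (by decide)] with ω hω hinj h1 h2 i k hi hk
  have h3 := N.ofReal_norm_eq_nearest hω rfl hi
  have h4 := N.ofReal_norm_eq_nearest hω rfl hk
  have h5 : P.equivLength (N.channel (i, none) ω).1 (N.channel (k, none) ω).1 ‖N.bs i ω‖ =
      ‖N.bs k ω‖ := by
    refine P.equivLength_eq_of_pathLoss_eq _ _ (hω i) (hω k) ?_
    have := le_antisymm (hi k) (hk i)
    simpa only [linkLoss, linkLength, receiver, loc, dist_zero_right] using this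
  have h6 : (N.nearest (N.channel (i, none) ω).1 ω).toReal = ‖N.bs i ω‖ := by
    rw [← h3, ENNReal.toReal_ofReal (norm_nonneg _)]
  rw [← h5, ← h6] at h4
  by_cases hs : (N.channel (i, none) ω).1 = (N.channel (k, none) ω).1
  · rw [hs, P.equivLength_self] at h5
    exact hinj _ _ h5
  -- Two serving stations in different states would have equal path loss, placing one nearest
  -- distance exactly at the equivalent length of the other.
  · exfalso
    generalize (N.channel (i, none) ω).1 = a at *
    generalize (N.channel (k, none) ω).1 = b at *
    cases a <;> cases b
    · exact hs rfl
    · exact h1 h4.symm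
    · exact h2 h4.symm
    · exact hs rfl

/-- The state other than `j`. -/
def _root_.MmWave.LinkState.other : LinkState → LinkState
  | .los => .nlos
  | .nlos => .los

/-- Conditioning replaces each indexed piece by an expectation of `secureProb`; the sum over indices
is then taken pathwise, where it reduces to the nearest station in state `j`. -/
lemma measure_secureEvent (N : Network P μ) :
    μ N.secureEvent = ∑ j : LinkState, ∫⁻ r in Set.Ioi 0, ENNReal.ofReal (P.nearestDensity j r) *
      (P.secureProb j r *
        ENNReal.ofReal (Real.exp (-P.meanCount j.other (P.equivLength j j.other r)))) := by
  classical
  have hdis : Pairwise (Function.onFun (AEDisjoint μ) N.secureVia) := fun p q hpq => by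
    refine measure_mono_null (fun ω hω => ?_) (ae_iff.1 N.ae_isServing_unique)
    intro h
    have h2 : p.2 = q.2 := h _ _ hω.1.1.2 hω.2.1.2
    refine hpq (Prod.ext ?_ h2)
    rw [← hω.1.1.1, ← hω.2.1.1, h2]
  rw [N.secureEvent_eq, measure_iUnion₀ hdis fun p => (N.measurableSet_secureVia p).nullMeasurableSet,
    ENNReal.tsum_prod (f := fun j i => μ (N.secureVia (j, i))), tsum_fintype]
  refine Finset.sum_congr rfl fun j _ => ?_
  have hj : j ≠ j.other := by cases j <;> decide
  rw [← N.lintegral_nearest_equivLength hj (P.measurable_secureProb j)]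
  have h1 : ∀ i, μ (N.secureVia (j, i)) = _ := fun i => N.measure_serving_secure i j
  simp only [h1]
  rw [← lintegral_tsum]
  swap
  · exact fun i => (Measurable.ite (N.measurableSet_isServing i j)
      ((P.measurable_secureProb j).comp (N.bs_ppp.measurable i).norm) measurable_const).aemeasurable
  refine lintegral_congr_ae ?_
  filter_upwards [N.ae_norm_pos, N.ae_finite_ball, N.bs_ppp.ae_norm_injective] with ω h1 h2 h3
  rw [N.tsum_serving hj h1 h2 h3]

end Network

/-! ### Identification with the closed formulas -/

namespace Params

variable (P : Params)

lemma equivLength_sq (j j' : LinkState) {r : ℝ} (hr : 0 ≤ r) :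
    P.equivLength j j' r ^ 2 =
      (P.pl j' / P.pl j) ^ (2 / P.alpha j') * r ^ (2 * P.alpha j / P.alpha j') := by
  have h1 := P.pl_pos j
  have h2 := P.pl_pos j'
  rw [equivLength, mul_pow, ← Real.rpow_mul_natCast (by positivity), ← Real.rpow_mul_natCast hr]
  congr 2 <;> push_cast <;> ring

lemma mu_eq_equivLength : P.mu = P.equivLength .los .nlos P.D := by
  have h1 := P.pl_pos .los
  have h2 := P.pl_pos .nlos
  rw [mu, equivLength, neg_div, Real.rpow_neg (by positivity), ← Real.inv_rpow (by positivity),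
    inv_div]

lemma mu_pos : 0 < P.mu := P.mu_eq_equivLength ▸ P.equivLength_pos _ _ P.D_pos

lemma le_mu_iff {r : ℝ} (hr : 0 < r) : r ≤ P.mu ↔ P.equivLength .nlos .los r ≤ P.D := by
  rw [mu_eq_equivLength, P.le_equivLength_iff _ _ P.D_pos hr]

lemma integrand_AN_nonneg {x : ℝ} (hx : x ∈ Set.Ioc 0 P.mu) :
    0 ≤ Real.exp (-(Real.pi * P.C * P.lamB * (P.pl .los / P.pl .nlos) ^ (2 / P.alpha .los) *
        x ^ (2 * P.alpha .nlos / P.alpha .los))) -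
      Real.exp (-(Real.pi * P.C * P.lamB * P.D ^ 2)) := by
  have h1 := P.lamB_pos
  have h2 := P.C_nonneg
  have h3 := (P.le_mu_iff hx.1).1 hx.2
  have h4 := (P.equivLength_pos .nlos .los hx.1).le
  rw [mul_assoc, ← P.equivLength_sq .nlos .los hx.1.le, sub_nonneg, Real.exp_le_exp, neg_le_neg_iff]
  gcongr

lemma AN_pos : 0 < P.AN := by
  have h1 := P.lamB_pos
  have h2 := P.C_le_one
  refine add_pos_of_nonneg_of_pos (setIntegral_nonneg measurableSet_Ioc fun x hx => ?_)
    (Real.exp_pos _)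
  have h3 : 0 ≤ 1 - P.C := by linarith
  have h4 := hx.1
  have h5 := P.integrand_AN_nonneg hx
  have h6 := Real.pi_pos
  exact mul_nonneg (mul_nonneg h5 (by positivity)) (Real.exp_pos _).le

/-- Bounding the first exponential by `1` gives `AN ≤ (1 - a) (1 - b) + a`, where `a < 1` because `C
> 0`, and `b > 0` is the mass that the density `g` misses on `(0, mu]`. -/
lemma AN_lt_one (hC : 0 < P.C) : P.AN < 1 := by
  have h1 := P.lamB_pos
  have h3 : 0 ≤ 1 - P.C := by linarith [P.C_le_one]
  have h6 := Real.pi_pos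
  have hD := P.D_pos
  have hmu := P.mu_pos
  set a := Real.exp (-(Real.pi * P.C * P.lamB * P.D ^ 2)) with ha
  have ha1 : a < 1 := by
    rw [ha, Real.exp_lt_one_iff]
    have : 0 < Real.pi * P.C * P.lamB * P.D ^ 2 := by positivity
    linarith
  let g : ℝ → ℝ := fun x => (2 * Real.pi * (1 - P.C) * P.lamB * x) *
    Real.exp (-(Real.pi * (1 - P.C) * P.lamB * x ^ 2))
  have hg : Continuous g := by fun_prop
  have hgi : ∫ x in Set.Ioc 0 P.mu, g x =
      1 - Real.exp (-(Real.pi * (1 - P.C) * P.lamB * P.mu ^ 2)) := by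
    rw [← intervalIntegral.integral_of_le hmu.le, intervalIntegral.integral_eq_sub_of_hasDerivAt
      (f := fun x => -Real.exp (-(Real.pi * (1 - P.C) * P.lamB * x ^ 2)))
      (fun x _ => ?_) (hg.intervalIntegrable _ _)]
    · simp
      ring
    · refine (((hasDerivAt_pow 2 x).const_mul _).neg.exp.neg).congr_deriv ?_
      simp only [g, Pi.neg_apply]
      norm_num
      ring
  have hle : P.AN ≤ (∫ x in Set.Ioc 0 P.mu, (1 - a) * g x) + a := by
    refine add_le_add_left (integral_mono_of_nonneg ?_ ?_ ?_) _
    · filter_upwards [ae_restrict_mem measurableSet_Ioc] with x hx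
      have h4 := hx.1
      have h5 := P.integrand_AN_nonneg hx
      exact mul_nonneg (mul_nonneg h5 (by positivity)) (Real.exp_pos _).le
    · exact ((hg.const_mul _).integrableOn_Icc).mono_set Set.Ioc_subset_Icc_self
    · filter_upwards [ae_restrict_mem measurableSet_Ioc] with x hx
      have h4 := hx.1
      have h7 := P.pl_pos .los
      have h8 := P.pl_pos .nlos
      simp only [g]
      rw [mul_assoc]
      gcongr
      rw [Real.exp_le_one_iff]
      have : 0 ≤ Real.pi * P.C * P.lamB * (P.pl .los / P.pl .nlos) ^ (2 / P.alpha .los) *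
        x ^ (2 * P.alpha .nlos / P.alpha .los) := by positivity
      linarith
  rw [integral_const_mul, hgi] at hle
  nlinarith [Real.exp_pos (-(Real.pi * (1 - P.C) * P.lamB * P.mu ^ 2))]

lemma A_mul_fL (hD : P.pathLoss .nlos P.D ≤ P.pathLoss .los P.D) {r : ℝ} (hr : 0 < r) :
    P.A .los * P.fL r =
      P.nearestDensity .los r * Real.exp (-P.meanCount .nlos (P.equivLength .los .nlos r)) := by
  simp only [fL, nearestDensity, stateProb]
  split_ifs with h
  · rcases P.C_nonneg.eq_or_lt with hC | hC
    -- Without LOS links `A .los` vanishes and cannot be cancelled, but both sides are zero.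
    · simp [← hC]
    have hA : P.A .los ≠ 0 := (sub_pos.2 (P.AN_lt_one hC)).ne'
    -- An NLOS link of length `D` is no stronger than a LOS link of length `D`, hence no stronger
    -- than one of length `r ≤ D`.
    have hk : P.equivLength .los .nlos r ≤ P.D := by
      rw [← P.pathLoss_le_iff _ _ hr P.D_pos]
      refine hD.trans ((P.pathLoss_le_iff _ _ hr P.D_pos).2 ?_)
      rwa [P.equivLength_self]
    rw [mul_div_cancel₀ _ hA]
    simp only [meanCount, min_eq_left h, min_eq_left hk]
    rw [mul_assoc ((1 - P.C) * P.lamB * Real.pi), ← P.equivLength_sq .los .nlos hr.le,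
      show -(P.lamB * Real.pi * (P.equivLength .los .nlos r ^ 2 -
        P.C * P.equivLength .los .nlos r ^ 2)) =
        -((1 - P.C) * P.lamB * Real.pi * P.equivLength .los .nlos r ^ 2) by ring,
      show -(P.lamB * Real.pi * (P.C * r ^ 2)) = -(P.C * P.lamB * Real.pi * r ^ 2) by ring]
    ring
  · simp

/-- The threshold `mu` is where the equivalent LOS length reaches `D` and the LOS mean count
saturates. The point `r = D` is excluded because both indicators in `fN` equal `1` there. -/
lemma A_mul_fN (hD : P.pathLoss .nlos P.D ≤ P.pathLoss .los P.D) {r : ℝ} (hr : 0 < r)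
    (hrD : r ≠ P.D) :
    P.A .nlos * P.fN r =
      P.nearestDensity .nlos r * Real.exp (-P.meanCount .los (P.equivLength .nlos .los r)) := by
  have hA : P.A .nlos ≠ 0 := P.AN_pos.ne'
  have hmu : P.mu ≤ P.D := by
    rwa [mu_eq_equivLength, ← P.pathLoss_le_iff _ _ P.D_pos P.D_pos]
  have hcancel : ∀ u v w : ℝ, P.A .nlos * (u / P.A .nlos + v / P.A .nlos * w) = u + v * w :=
    fun u v w => by field_simp
  have hmu' : (P.pl .nlos / P.pl .los) ^ (1 / P.alpha .nlos) *
      P.D ^ (P.alpha .los / P.alpha .nlos) = P.mu := P.mu_eq_equivLength.symm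
  rw [fN, hcancel, hmu', mul_assoc (P.C * P.lamB * Real.pi), ← P.equivLength_sq .nlos .los hr.le]
  simp only [nearestDensity, stateProb, meanCount]
  rcases lt_or_gt_of_ne hrD with h | h
  · have e1 : Real.exp (-(P.lamB * Real.pi * (r ^ 2 - P.C * r ^ 2))) =
        Real.exp (-((1 - P.C) * P.lamB * Real.pi * r ^ 2)) := by ring_nf
    have e2 : Real.exp (-(Real.pi * P.lamB * r ^ 2)) *
        Real.exp (Real.pi * P.C * P.lamB * (r ^ 2 - P.D ^ 2)) =
        Real.exp (-((1 - P.C) * P.lamB * Real.pi * r ^ 2)) *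
          Real.exp (-(P.C * P.lamB * Real.pi * P.D ^ 2)) := by
      rw [← Real.exp_add, ← Real.exp_add]; congr 1; ring
    rw [if_pos h.le, if_neg (not_le.2 h), if_pos h.le, min_eq_left h.le, e1]
    by_cases hm : r ≤ P.mu
    · rw [if_pos hm, min_eq_left ((P.le_mu_iff hr).1 hm),
        show -(P.lamB * Real.pi * (P.C * P.equivLength .nlos .los r ^ 2)) =
          -(P.C * P.lamB * Real.pi * P.equivLength .nlos .los r ^ 2) by ring]
      -- The term with `exp (-π C lamB D ^ 2)` from the first summand cancels the one subtracted in
      -- the second.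
      linear_combination (2 * Real.pi * P.lamB * r * (1 - P.C)) * e2
    · rw [if_neg hm, min_eq_right (not_le.1 ((P.le_mu_iff hr).not.1 hm)).le,
        show -(P.lamB * Real.pi * (P.C * P.D ^ 2)) =
          -(P.C * P.lamB * Real.pi * P.D ^ 2) by ring]
      linear_combination (2 * Real.pi * P.lamB * r * (1 - P.C)) * e2
  · have hm : ¬ r ≤ P.mu := not_le.2 (hmu.trans_lt h)
    have e2 : Real.exp (-(P.lamB * Real.pi * (r ^ 2 - P.C * P.D ^ 2))) *
        Real.exp (-(P.lamB * Real.pi * (P.C * P.D ^ 2))) =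
        Real.exp (-(Real.pi * P.lamB * r ^ 2)) := by
      rw [← Real.exp_add]; congr 1; ring
    rw [if_neg (not_le.2 h), if_pos h.le, if_neg (not_le.2 h), if_neg hm, min_eq_right h.le,
      min_eq_right (not_le.1 ((P.le_mu_iff hr).not.1 hm)).le]
    linear_combination (-2 * Real.pi * P.lamB * r) * e2

lemma A_mul_f (hD : P.pathLoss .nlos P.D ≤ P.pathLoss .los P.D) (j : LinkState) {r : ℝ}
    (hr : 0 < r) (hrD : r ≠ P.D) :
    P.A j * P.f j r =
      P.nearestDensity j r * Real.exp (-P.meanCount j.other (P.equivLength j j.other r)) := by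
  cases j
  · exact P.A_mul_fL hD hr
  · exact P.A_mul_fN hD hr hrD

lemma secureProb_ne_top (j : LinkState) (r : ℝ) : P.secureProb j r ≠ ⊤ := by
  refine ne_top_of_le_ne_top ENNReal.one_ne_top ?_
  refine (lintegral_mono (g := fun _ => 1) fun w => ?_).trans (by simp)
  split_ifs with h
  · refine ENNReal.ofReal_le_one.2 (Real.exp_le_one_iff.2 ?_)
    linarith [P.LambdaE_nonneg (one_div_pos.2 h)]
  · exact zero_le_one

lemma strength_pos_iff (j : LinkState) {r : ℝ} (hr : 0 < r) (w : ℝ) :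
    0 < P.strength j r w ↔ 0 < w :=
  mul_pos_iff_of_pos_left (mul_pos (P.gain_pos _) (P.pathLoss_pos j hr))

lemma toReal_secureProb (j : LinkState) {r : ℝ} (hr : 0 < r) :
    (P.secureProb j r).toReal = ∫ w in Set.Ioi (0 : ℝ),
      Real.exp (-P.LambdaE (r ^ P.alpha j / (P.gain .main * w * P.pl j))) *
        w ^ (P.nak j - 1) * Real.exp (-w) / Real.Gamma (P.nak j) := by
  have hm : Measurable fun w => if 0 < P.strength j r w then
      ENNReal.ofReal (Real.exp (-P.LambdaE (1 / P.strength j r w))) else 0 :=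
    P.measurable_LambdaE_comp ((P.measurable_strength j).comp measurable_prodMk_left)
  have hn : (0 : ℝ) < P.nak j := by exact_mod_cast P.nak_pos j
  have hpdf : Measurable (gammaPDF (P.nak j) 1) := (measurable_gammaPDFReal _ _).ennreal_ofReal
  rw [secureProb, gammaMeasure, lintegral_withDensity_eq_lintegral_mul _ hpdf hm,
    ← integral_toReal (hpdf.mul hm).aemeasurable (Eventually.of_forall fun w => ?_),
    ← setIntegral_eq_integral_of_forall_compl_eq_zero (s := Set.Ioi 0) fun w hw => ?_]
  · refine setIntegral_congr_fun measurableSet_Ioi fun w hw => ?_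
    have hw' : 0 < w := hw
    have e1 : 1 / P.strength j r w = r ^ P.alpha j / (P.gain .main * w * P.pl j) := by
      have h1 := P.gain_pos .main
      have h2 := P.pl_pos j
      rw [strength, pathLoss, Real.rpow_neg hr.le]
      field_simp
    -- The natural subtraction is exact because the shape is at least `1`.
    have e2 : w ^ ((P.nak j : ℝ) - 1) = w ^ (P.nak j - 1) := by
      rw [← Real.rpow_natCast, Nat.cast_sub (P.nak_pos j), Nat.cast_one]
    rw [Pi.mul_apply, if_pos ((P.strength_pos_iff j hr w).2 hw'), e1, ENNReal.toReal_mul,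
      gammaPDF, ENNReal.toReal_ofReal (gammaPDFReal_nonneg hn one_pos w),
      ENNReal.toReal_ofReal (Real.exp_pos _).le, gammaPDFReal, if_pos hw'.le, e2, Real.one_rpow,
      one_mul]
    ring
  · rw [Pi.mul_apply, if_neg (by rw [P.strength_pos_iff j hr]; simpa using hw), mul_zero,
      ENNReal.toReal_zero]
  · rw [Pi.mul_apply]
    refine ENNReal.mul_lt_top ENNReal.ofReal_lt_top ?_
    split_ifs
    · exact ENNReal.ofReal_lt_top
    · exact ENNReal.zero_lt_top

end Params

end MmWave

end

/-! ### Passage to real integrals -/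

theorem theorem1 (P : MmWave.Params)
    (hD : P.pathLoss .nlos P.D ≤ P.pathLoss .los P.D)
    {Ω : Type*} [MeasurableSpace Ω] (μ : MeasureTheory.Measure Ω)
    [MeasureTheory.IsProbabilityMeasure μ] (N : MmWave.Network P μ) :
    N.secureConnectivityProb =
      ∑ j, P.A j * ∫ r in Set.Ioi (0 : ℝ), P.f j r *
        ∫ w in Set.Ioi (0 : ℝ),
          Real.exp (-P.LambdaE (r ^ P.alpha j / (P.gain .main * w * P.pl j))) *
            w ^ (P.nak j - 1) * Real.exp (-w) / Real.Gamma (P.nak j) := by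
  have hsum := N.measure_secureEvent
  have hfin : ∀ j ∈ Finset.univ, (∫⁻ r in Set.Ioi 0, ENNReal.ofReal (P.nearestDensity j r) *
      (P.secureProb j r * ENNReal.ofReal (Real.exp
        (-P.meanCount j.other (P.equivLength j j.other r))))) ≠ ∞ :=
    -- The summands are finite because they add up to a probability.
    ENNReal.sum_ne_top.1 (hsum ▸ measure_ne_top μ _)
  rw [MmWave.Network.secureConnectivityProb, measureReal_def, hsum, ENNReal.toReal_sum hfin]
  refine Finset.sum_congr rfl fun j _ => ?_
  have h1 := P.measurable_nearestDensity j
  have h2 := P.measurable_secureProb j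
  have h3 := (P.continuous_meanCount j.other).measurable
  have h4 := P.measurable_equivLength j j.other
  rw [← integral_toReal (by fun_prop) (Filter.Eventually.of_forall fun r =>
    ENNReal.mul_lt_top ENNReal.ofReal_lt_top (ENNReal.mul_lt_top
      (P.secureProb_ne_top j r).lt_top ENNReal.ofReal_lt_top)), ← integral_const_mul]
  refine integral_congr_ae ?_
  -- The identity for the weights may fail at `r = D`, a null set.
  have hne : ∀ᵐ r : ℝ ∂volume, r ≠ P.D := by simp [ae_iff]
  filter_upwards [ae_restrict_mem measurableSet_Ioi, ae_restrict_of_ae hne] with r hr hrD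
  have hr' : 0 < r := hr
  rw [← mul_assoc (P.A j), P.A_mul_f hD j hr' hrD, ← P.toReal_secureProb j hr', ENNReal.toReal_mul,
    ENNReal.toReal_mul, ENNReal.toReal_ofReal (P.nearestDensity_nonneg j hr'.le),
    ENNReal.toReal_ofReal (Real.exp_pos _).le]
  ring
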